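/- Let $X$ be a locally compact Hausdorff space. For a topological space $Y$, $\Phi(Y)$ denotes the class of lower semicontinuous functions $\psi:Y\to(-\infty,\infty]$ with $\psi\ge 0$ unless $Y$ is compact. For Radon measures write $\kappa_\nu(x)=\int\kappa(x,y)\,d\nu(y)$, $\kappa(\nu,\mu)=\int\kappa\,d(\nu\otimes\mu)$, $\langle\psi,\nu\rangle=\int\psi\,d\nu$. Let $\mathcal E$ be the set of signed Radon measures with finite energy $\kappa(\nu,\nu)$, and let $\mathcal E^+$ be the set of its nonnegative elements. Let $\kappa\in\Phi(X\times X)$ be a kernel that is - positive definite: symmetric, with $\kappa(\nu,\nu)\ge0$ for every signed Radon measure $\nu$ whose energy is defined; put $\|\nu\|=\sqrt{\kappa(\nu,\nu)}$ on $\mathcal E$, and call convergence in this seminorm strong; - perfect: $\mathcal E^+$ is complete in $\|\cdot\|$, and on $\mathcal E^+$ the strong topology is finer than the vague one (convergence on compactly supported continuous functions). The interior capacity $C(A)$ is the supremum over compact $K\subset A$ of $1/\inf\kappa(\mu,\mu)$, with $\mu$ ranging over the Radon probability measures supported by $K$; a property holds nearly everywhere (n.e.) in $A$ if it fails at most on a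 subset of $A$ of interior capacity $0$. The external field $f$ is either an element of $\Phi(X)$, or $f=\kappa_\zeta$ for a signed measure $\zeta\in\mathcal E$. Let $\Sigma\subset X$ be nonempty and closed, $U\supset\Sigma$ open, $g$ positive and continuous on $U$, and suppose that $X$ is $\sigma$-compact or $\inf_U g>0$. For closed $E\subset U$ and a Radon measure $\sigma\ge0$ supported by $E$, let $\mathcal E^\sigma(E,g)$ be the set of the $\nu\in\mathcal E^+$ supported by $E$ with $\langle g,\nu\rangle=1$ and $\nu\le\sigma$. Put $G_f(\nu)=\|\nu\|^2+2\langle f,\nu\rangle$ and $G_f^\sigma(E,g)=\inf_{\nu\in\mathcal E^\sigma(E,g)}G_f(\nu)$ (with $\inf\emptyset=+\infty$). An equilibrium measure $\lambda_E^\sigma$ is a $\nu\in\mathcal E^\sigma(E,g)$ with $G_f(\nu)=G_f^\sigma(E,g)$. **Theorem.** Fix a Radon measure $\sigma\ge0$ supported by $\Sigma$. Assume $G_f^\sigma(\Sigma,g)<\infty$, $C(\Sigma)<\infty$, and that either $g$ is bounded on $U$ or there are $r\in(1,\infty)$ and a signed measure $\omega\in\mathcal E$ with $g^r\le\kappa_\omega$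 n.e. in $U$. Then: (a) There is a unique equilibrium measure $\lambda_\Sigma^\sigma$. (b) Let $(\Sigma_s)_{s\in S}$ be a decreasing net of closed subsets of $U$ with $C(\Sigma_s)<\infty$ and $\bigcap_s\Sigma_s=\Sigma$, and let $(\sigma_s)_{s\in S}$ be a decreasing net of Radon measures $\sigma_s\ge0$, $\sigma_s$ supported by $\Sigma_s$, converging vaguely to $\sigma$. Then $\lim_s G_f^{\sigma_s}(\Sigma_s,g)=G_f^\sigma(\Sigma,g)$, every $\lambda_{\Sigma_s}^{\sigma_s}$ exists and is unique, and $\lambda_{\Sigma_s}^{\sigma_s}\to\lambda_\Sigma^\sigma$ strongly and vaguely. (c) Let $\sigma_K$ be the restriction of $\sigma$ to $K$, and suppose that $G_f^{\sigma_K}(K,g)<\infty$ for at least one compact $K\subset\Sigma$. Direct the compact subsets $K$ of $\Sigma$ by inclusion. Then there is a decreasing net $(\beta_K^*)_K\subset[1,\infty)$ with $\beta_K^*\to1$, which can be chosen in $(1,\infty)$ whenever $\Sigma$ has a sequence of compact subsets not all contained in one compact subset of $\Sigma$ (for example if $\Sigma$ is noncompact and $\sigma$-compact), such that for all $\beta_K\in[1,\beta_K^*]$: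 $\lim_{K\uparrow\Sigma}G_f^{\beta_K\sigma_K}(K,g)=G_f^\sigma(\Sigma,g)$, the equilibrium measure $\lambda_K^{\beta_K\sigma_K}$ exists and is unique for all sufficiently large $K$, and $\lambda_K^{\beta_K\sigma_K}\to\lambda_\Sigma^\sigma$ strongly and vaguely. -/

import Mathlib

open Set Filter Topology MeasureTheory
open scoped ENNReal

/-
Positive Radon measures on a locally compact Hausdorff space are the regular Borel measures
(finite on compact sets, outer regular, inner regular on open sets); by the Riesz representation
theorem they correspond bijectively to the positive linear functionals on `C_c(X)`, and the order
of functionals is the order `≤` of measures.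
-/
namespace ConstrainedEnergy

noncomputable section

/-- The integral of an extended-real-valued function against a positive measure,
`∫ ψ⁺ dν - ∫ ψ⁻ dν`. It is only used where one of the two terms is finite. -/
def eint {X : Type*} [MeasurableSpace X] (ψ : X → EReal) (ν : Measure X) : EReal :=
  ((∫⁻ x, (ψ x).toENNReal ∂ν : ℝ≥0∞) : EReal) - ((∫⁻ x, (-ψ x).toENNReal ∂ν : ℝ≥0∞) : EReal)

/-- The class `Φ(Y)`: lower semicontinuous functions `Y → (-∞, ∞]`, nonnegative unless `Y` is
compact. -/
def IsPhi {Y : Type*} [TopologicalSpace Y] (ψ : Y → EReal) : Prop :=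
  LowerSemicontinuous ψ ∧ (∀ y, ψ y ≠ ⊥) ∧ (CompactSpace Y ∨ ∀ y, 0 ≤ ψ y)

/-- The potential `κ_ν(x) = ∫ κ(x,y) dν(y)` of a positive measure. -/
def potential {X : Type*} [MeasurableSpace X] (κ : X × X → EReal) (ν : Measure X) (x : X) :
    EReal :=
  eint (fun y => κ (x, y)) ν

/-- The mutual energy `κ(ν,μ) = ∫ κ d(ν ⊗ μ)` of two positive Radon measures, written as the
iterated integral `∫ κ_ν dμ` (for a kernel in `Φ(X × X)` this is the integral against the
product Radon measure). -/
def mutualEnergy {X : Type*} [MeasurableSpace X] (κ : X × X → EReal) (ν μ : Measure X) : EReal :=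
  eint (potential κ ν) μ

/-- The positive Radon measures `𝔐⁺(E)` supported by a closed set `E`. -/
def radonOn {X : Type*} [TopologicalSpace X] [MeasurableSpace X] (E : Set X) :
    Set (Measure X) :=
  {ν | ν.Regular ∧ ν.support ⊆ E}

/-- The positive Radon measures `𝓔⁺(E)` of finite energy supported by a closed set `E`. -/
def finiteEnergyOn {X : Type*} [TopologicalSpace X] [MeasurableSpace X] (κ : X × X → EReal)
    (E : Set X) : Set (Measure X) :=
  {ν | ν ∈ radonOn E ∧ ⊥ < mutualEnergy κ ν ν ∧ mutualEnergy κ ν ν < ⊤}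

/-- `κ` is symmetric and the energy of every signed Radon measure `p - m` (with `p, m` positive)
is nonnegative whenever it is defined: that energy is `κ(p,p) + κ(m,m) - 2 κ(p,m)`, and the
inequality below holds trivially when `κ(p,p) + κ(m,m) = ∞`. -/
def IsPositiveDefinite {X : Type*} [TopologicalSpace X] [MeasurableSpace X]
    (κ : X × X → EReal) : Prop :=
  (∀ x y, κ (x, y) = κ (y, x)) ∧
    ∀ p m : Measure X, p.Regular → m.Regular →
      2 * mutualEnergy κ p m ≤ mutualEnergy κ p p + mutualEnergy κ m m

/-- The strong distance `‖ν - μ‖` of two positive measures of finite energy. -/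
def strongDist {X : Type*} [MeasurableSpace X] (κ : X × X → EReal) (ν μ : Measure X) : ℝ :=
  Real.sqrt (mutualEnergy κ ν ν + mutualEnergy κ μ μ - 2 * mutualEnergy κ ν μ).toReal

/-- Strong convergence of a net (or along any filter) of positive measures. -/
def StrongTendsto {X ι : Type*} [MeasurableSpace X] (κ : X × X → EReal)
    (u : ι → Measure X) (l : Filter ι) (ν : Measure X) : Prop :=
  Tendsto (fun i => strongDist κ (u i) ν) l (𝓝 0)

/-- Vague convergence: convergence on every continuous function with compact support. -/
def VagueTendsto {X ι : Type*} [TopologicalSpace X] [MeasurableSpace X]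
    (u : ι → Measure X) (l : Filter ι) (ν : Measure X) : Prop :=
  ∀ φ : X → ℝ, Continuous φ → HasCompactSupport φ →
    Tendsto (fun i => ∫ x, φ x ∂(u i)) l (𝓝 (∫ x, φ x ∂ν))

/-- A positive definite kernel is perfect if `𝓔⁺` is strongly complete (every Cauchy filter
converges) and the strong topology on `𝓔⁺` is finer than the vague topology. -/
def IsPerfect {X : Type*} [TopologicalSpace X] [MeasurableSpace X] (κ : X × X → EReal) : Prop :=
  (∀ F : Filter (Measure X), F.NeBot → finiteEnergyOn κ univ ∈ F →
    (∀ ε : ℝ, 0 < ε → ∃ A ∈ F, ∀ ν ∈ A, ∀ μ ∈ A, strongDist κ ν μ < ε) →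
    ∃ ν ∈ finiteEnergyOn κ univ, StrongTendsto κ id F ν) ∧
  (∀ φ : X → ℝ, Continuous φ → HasCompactSupport φ → ∀ ν ∈ finiteEnergyOn κ univ,
    ∀ ε : ℝ, 0 < ε → ∃ δ : ℝ, 0 < δ ∧ ∀ μ ∈ finiteEnergyOn κ univ,
      strongDist κ μ ν < δ → |(∫ x, φ x ∂μ) - ∫ x, φ x ∂ν| < ε)

/-- The interior (Wiener) capacity: the supremum over compact `K ⊆ A` of `1 / w(K)`, where `w(K)`
is the infimum of the energy over the Radon probability measures supported by `K`. -/
def capacity {X : Type*} [TopologicalSpace X] [MeasurableSpace X] (κ : X × X → EReal)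
    (A : Set X) : ℝ≥0∞ :=
  ⨆ (K : Set X) (_ : IsCompact K) (_ : K ⊆ A),
    (⨅ (μ : Measure X) (_ : μ ∈ radonOn K) (_ : μ univ = 1), (mutualEnergy κ μ μ).toENNReal)⁻¹

/-- `P` holds nearly everywhere in `A`: the exceptional set has interior capacity zero. -/
def NearlyEverywhereOn {X : Type*} [TopologicalSpace X] [MeasurableSpace X]
    (κ : X × X → EReal) (A : Set X) (P : X → Prop) : Prop :=
  capacity κ {x | x ∈ A ∧ ¬ P x} = 0

/-- A signed (real-valued) Radon measure, given as a difference `pos - neg` of two positive Radon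
measures (both may have infinite total mass). -/
structure SignedRadon (X : Type*) [TopologicalSpace X] [MeasurableSpace X] where
  /-- the measure with the sign plus -/
  pos : Measure X
  /-- the measure with the sign minus -/
  neg : Measure X
  pos_regular : pos.Regular
  neg_regular : neg.Regular

/-- Membership of a signed measure in the space `𝓔` of measures of finite energy. -/
def SignedRadon.FiniteEnergy {X : Type*} [TopologicalSpace X] [MeasurableSpace X]
    (κ : X × X → EReal) (ζ : SignedRadon X) : Prop :=
  ζ.pos ∈ finiteEnergyOn κ univ ∧ ζ.neg ∈ finiteEnergyOn κ univ

/-- The potential of a signed measure is well defined at `x` (not of the form `∞ - ∞`). -/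
def SignedRadon.PotentialDefinedAt {X : Type*} [TopologicalSpace X] [MeasurableSpace X]
    (κ : X × X → EReal) (ζ : SignedRadon X) (x : X) : Prop :=
  potential κ ζ.pos x ≠ ⊤ ∨ potential κ ζ.neg x ≠ ⊤

/-- The potential of a signed measure. -/
def SignedRadon.potential {X : Type*} [TopologicalSpace X] [MeasurableSpace X]
    (κ : X × X → EReal) (ζ : SignedRadon X) (x : X) : EReal :=
  ConstrainedEnergy.potential κ ζ.pos x - ConstrainedEnergy.potential κ ζ.neg x

/-- `f` is an external field: either `f ∈ Φ(X)`, or `f` is the potential of a signed measure of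
finite energy (with arbitrary values at the points where that potential is not defined). -/
def IsExternalField {X : Type*} [TopologicalSpace X] [MeasurableSpace X]
    (κ : X × X → EReal) (f : X → EReal) : Prop :=
  IsPhi f ∨ ∃ ζ : SignedRadon X, ζ.FiniteEnergy κ ∧
    ∀ x, ζ.PotentialDefinedAt κ x → f x = ζ.potential κ x

/-- The `f`-weighted energy `G_f(ν) = ‖ν‖² + 2⟨f,ν⟩` of a positive measure. -/
def weightedEnergy {X : Type*} [MeasurableSpace X] (κ : X × X → EReal) (f : X → EReal)
    (ν : Measure X) : EReal :=
  mutualEnergy κ ν ν + 2 * eint f ν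

/-- The class `𝓔^σ(E,g)` of the measures `ν ∈ 𝓔⁺(E)` with `⟨g,ν⟩ = 1` and `ν ≤ σ`. -/
def admissible {X : Type*} [TopologicalSpace X] [MeasurableSpace X] (κ : X × X → EReal)
    (g : X → ℝ) (E : Set X) (σ : Measure X) : Set (Measure X) :=
  {ν | ν ∈ finiteEnergyOn κ E ∧ (∫⁻ x, ENNReal.ofReal (g x) ∂ν) = 1 ∧ ν ≤ σ}

/-- The constrained minimal weighted energy `G_f^σ(E,g)`; it is `+∞` for an empty class. -/
def minEnergy {X : Type*} [TopologicalSpace X] [MeasurableSpace X] (κ : X × X → EReal)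
    (f : X → EReal) (g : X → ℝ) (E : Set X) (σ : Measure X) : EReal :=
  ⨅ ν ∈ admissible κ g E σ, weightedEnergy κ f ν

/-- `ν` is an equilibrium measure for the data `κ, f, g, E, σ`. -/
def IsEquilibrium {X : Type*} [TopologicalSpace X] [MeasurableSpace X] (κ : X × X → EReal)
    (f : X → EReal) (g : X → ℝ) (E : Set X) (σ : Measure X) (ν : Measure X) : Prop :=
  ν ∈ admissible κ g E σ ∧ weightedEnergy κ f ν = minEnergy κ f g E σ

/-- The family of all compact subsets of `E`, ordered by inclusion. -/
abbrev CompactIn {X : Type*} [TopologicalSpace X] (E : Set X) : Type _ :=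
  {K : Set X // IsCompact K ∧ K ⊆ E}

end

end ConstrainedEnergy

open scoped NNReal

set_option linter.unusedSectionVars false

namespace ConstrainedEnergy

/-! ### Regular measures: supports and sums. -/

section General

variable {X : Type*} [TopologicalSpace X] [MeasurableSpace X]

/-! The proof rests on convexity and completeness. Since G is a quadratic form plus a linear term,
‖ν - μ‖² = 2G(ν) + 2G(μ) - 4G((ν + μ)/2). If ν and μ lie in one admissible class with infimum m, so
does their midpoint, whence ‖ν - μ‖² ≤ 2G(ν) + 2G(μ) - 4m (`strongDist_sq_le`). So minimizing
sequences are Cauchy, two minimizers are at distance zero, and perfectness provides a strong limit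
that is also a vague one. The limit is a minimizer because G is strongly lower semicontinuous
(`FieldDecomp.realWeightedEnergy_le`) and the admissible class is strongly closed
(`mem_admissible_of_tendsto`).

In the closedness, the delicate point is that no part of ⟨g, ν⟩ = 1 escapes to infinity. For a
perfect kernel and C(E) finite, C(E \ K) becomes arbitrarily small for compact K
(`exists_compact_capacity_sdiff_lt`): otherwise nearly optimal probability measures on the sets E \
K would converge strongly, with energies bounded away from zero, to the vague limit 0. As ν(Q)² ≤
C(A) ‖ν|_Q‖² for compact Q in A (`measure_sq_le`), measures of bounded energy are tight. A bounded g
preserves this; otherwise Hölder's inequality applies, with ∫ g^r dν controlled by the mutual energy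
of ν and the positive part of ω (`exists_compact_weight_compl_le`).

For (b), the minimal energies increase to some L ≤ m. The basic inequality makes the equilibrium
measures a Cauchy net; its limit is admissible for the intersection and has energy at most L, so L =
m.

For (c), the lower bound is (b) for the constant set Σ and the constraints β*σ. The upper bound
(`exists_tendsto_minEnergy_restrict_le`) needs a competitor on K below σ_K itself: the restriction
of the equilibrium measure λ to K has too little g-mass, and the deficit is supplied by mixing in,
with weight tending to zero, the maximum of λ|_K and one fixed admissible measure on a compact set.

Technically, kernels and fields of class Φ are written as nonnegative lower semicontinuous functions
minus constants, which vanish unless X is compact. Integrals of such functions are suprema of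
integrals of compactly supported continuous ones, which gives vague semicontinuity and Fubini's
theorem without σ-finiteness. -/

lemma mem_radonOn_iff {E : Set X} (hE : IsClosed E) {ν : Measure X} :
    ν ∈ radonOn E ↔ ν.Regular ∧ ν Eᶜ = 0 := by
  refine ⟨fun h => ⟨h.1, ?_⟩, fun h => ⟨h.1, Measure.support_subset_of_isClosed hE h.2⟩⟩
  have := h.1
  exact measure_mono_null (compl_subset_compl.2 h.2) Measure.measure_compl_support_of_regular

lemma mem_finiteEnergyOn_univ {κ : X × X → EReal} {E : Set X} {ν : Measure X}
    (h : ν ∈ finiteEnergyOn κ E) : ν ∈ finiteEnergyOn κ univ :=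
  ⟨⟨h.1.1, subset_univ _⟩, h.2⟩

lemma regular_add [BorelSpace X] {μ ν : Measure X} (hμ : μ.Regular) (hν : ν.Regular) : (μ + ν).Regular := by
  have hout : (μ + ν).OuterRegular := by
    constructor
    intro A hA r hr
    rw [Measure.add_apply] at hr
    obtain ⟨a, ha, b, hb, hab⟩ := ENNReal.exists_add_lt_of_add_lt hr
    obtain ⟨U, hAU, hU, hUa⟩ := A.exists_isOpen_lt_of_lt a ha
    obtain ⟨V, hAV, hV, hVb⟩ := A.exists_isOpen_lt_of_lt b hb
    refine ⟨U ∩ V, subset_inter hAU hAV, hU.inter hV, ?_⟩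
    rw [Measure.add_apply]
    exact (add_le_add ((measure_mono inter_subset_left).trans hUa.le)
      ((measure_mono inter_subset_right).trans hVb.le)).trans_lt hab
  have hfin : IsFiniteMeasureOnCompacts (μ + ν) :=
    ⟨fun K hK => by
      rw [Measure.add_apply]
      exact ENNReal.add_lt_top.2 ⟨hK.measure_lt_top, hK.measure_lt_top⟩⟩
  refine ⟨fun U hU r hr => ?_⟩
  rw [Measure.add_apply] at hr
  -- Splitting `r` below both `μ U` and `ν U` requires both to be positive, so the null cases are
  -- treated apart.
  rcases eq_or_ne (μ U) 0 with h0 | h0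
  · rw [h0, zero_add] at hr
    obtain ⟨K, hKU, hK, hr⟩ := hU.exists_lt_isCompact hr
    exact ⟨K, hKU, hK, hr.trans_le (by rw [Measure.add_apply]; exact le_add_self)⟩
  rcases eq_or_ne (ν U) 0 with h1 | h1
  · rw [h1, add_zero] at hr
    obtain ⟨K, hKU, hK, hr⟩ := hU.exists_lt_isCompact hr
    exact ⟨K, hKU, hK, hr.trans_le (by rw [Measure.add_apply]; exact le_self_add)⟩
  obtain ⟨a, ha, b, hb, hab⟩ := ENNReal.exists_lt_add_of_lt_add hr h0 h1
  obtain ⟨K, hKU, hK, hKa⟩ := hU.exists_lt_isCompact ha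
  obtain ⟨K', hKU', hK', hKb⟩ := hU.exists_lt_isCompact hb
  refine ⟨K ∪ K', union_subset hKU hKU', hK.union hK', hab.trans_le ?_⟩
  rw [Measure.add_apply]
  exact add_le_add (hKa.le.trans (measure_mono subset_union_left))
    (hKb.le.trans (measure_mono subset_union_right))

end General

/-! ### Integration of lower semicontinuous functions against regular measures. -/

section LowerSemicontinuous

variable {X : Type*} [TopologicalSpace X] [T2Space X] [MeasurableSpace X] [BorelSpace X]

/-- Integrals against regular measures commute with directed suprema of lower semicontinuous
functions. -/
theorem lintegral_iSup_of_directed_lowerSemicontinuous (μ : Measure X) [μ.Regular] {ι : Type*}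
    [Nonempty ι] {f : ι → X → ℝ≥0∞} (hf : ∀ i, LowerSemicontinuous (f i))
    (hd : Directed (· ≤ ·) f) : ∫⁻ x, ⨆ i, f i x ∂μ = ⨆ i, ∫⁻ x, f i x ∂μ := by
  refine le_antisymm ?_ (iSup_le fun i => lintegral_mono fun x => le_iSup (fun i => f i x) i)
  set L := ⨆ i, ∫⁻ x, f i x ∂μ with hL
  have hcover : ∀ (t : ℝ≥0∞) (K : Set X), IsCompact K → (∀ x ∈ K, t < ⨆ i, f i x) →
      ∃ i, ∀ x ∈ K, t < f i x := by
    intro t K hK h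
    obtain ⟨i, hi⟩ := hK.elim_directed_cover (fun i => {x | t < f i x})
      (fun i => (hf i).isOpen_preimage t)
      (fun x hx => by simpa [lt_iSup_iff] using h x hx)
      (fun i j => by
        obtain ⟨k, h1, h2⟩ := hd i j
        exact ⟨k, fun x hx => lt_of_lt_of_le hx (h1 x), fun x hx => lt_of_lt_of_le hx (h2 x)⟩)
    exact ⟨i, hi⟩
  by_cases hLt : L = ⊤
  · rw [hLt]; exact le_top
  rw [lintegral_eq_nnreal]
  refine iSup₂_le fun φ hφ => ?_
  refine ENNReal.le_of_forall_lt_one_mul_le fun a ha => ?_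
  rcases eq_or_ne a 0 with rfl | ha0
  · simp
  have hatop : a ≠ ⊤ := ha.ne_top
  -- The factor `a < 1` makes the inequality strict, so that on compact parts of a level set a
  -- single index `i` suffices.
  have hlt : ∀ r : ℝ≥0, r ≠ 0 → ∀ x ∈ φ ⁻¹' {r}, a * r < ⨆ i, f i x := by
    intro r hr x hx
    have hx' : φ x = r := hx
    refine lt_of_lt_of_le ?_ (hφ x)
    rw [hx']
    calc a * r < 1 * r := by
          exact ENNReal.mul_lt_mul_left (by simpa using hr) (by simp) ha
      _ = r := one_mul _
  -- Inner regularity on the level sets requires finite measure. Each lies in an open set whose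
  -- compact subsets are bounded in measure by Markov's inequality.
  have hfin : ∀ r : ℝ≥0, r ≠ 0 → μ (φ ⁻¹' {r}) ≠ ⊤ := by
    intro r hr
    have har : a * r ≠ 0 := mul_ne_zero ha0 (by simpa using hr)
    have hopen : IsOpen {x | a * r < ⨆ i, f i x} :=
      (lowerSemicontinuous_iSup hf).isOpen_preimage _
    have hV : μ {x | a * r < ⨆ i, f i x} ≤ L / (a * r) := by
      rw [hopen.measure_eq_iSup_isCompact μ]
      refine iSup₂_le fun K hKV => iSup_le fun hK => ?_
      obtain ⟨i, hi⟩ := hcover _ K hK hKV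
      rw [ENNReal.le_div_iff_mul_le (Or.inl har) (Or.inr hLt)]
      calc μ K * (a * r) ≤ μ {x | a * r ≤ f i x} * (a * r) := by
            gcongr
            exact fun x hx => (hi x hx).le
        _ = (a * r) * μ {x | a * r ≤ f i x} := mul_comm _ _
        _ ≤ ∫⁻ x, f i x ∂μ := mul_meas_ge_le_lintegral (hf i).measurable _
        _ ≤ L := le_iSup (fun i => ∫⁻ x, f i x ∂μ) i
    refine ne_top_of_le_ne_top (ENNReal.div_ne_top hLt har) (le_trans (measure_mono ?_) hV)
    exact hlt r hr
  rw [SimpleFunc.map_lintegral]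
  refine ENNReal.le_of_forall_pos_le_add fun ε hε _ => ?_
  set C : ℝ≥0∞ := ∑ r ∈ φ.range, a * r with hC
  have hCt : C ≠ ⊤ := by
    rw [hC]
    exact ENNReal.sum_ne_top.2 fun r _ => ENNReal.mul_ne_top hatop (by simp)
  -- The loss on the level `r` is weighted by `a * r`, and these weights add up to `C`; the total
  -- loss is therefore at most `ε`.
  have hδ : (ε : ℝ≥0∞) / (C + 1) ≠ 0 := by
    refine (ENNReal.div_pos (by simpa using hε.ne') ?_).ne'
    simpa using hCt
  have hK : ∀ r : ℝ≥0, ∃ K : Set X, K ⊆ φ ⁻¹' {r} ∧ IsCompact K ∧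
      (r ≠ 0 → μ (φ ⁻¹' {r}) ≤ μ K + ε / (C + 1)) := by
    intro r
    by_cases hr : r = 0
    · exact ⟨∅, by simp, isCompact_empty, fun h => absurd hr h⟩
    · obtain ⟨K, h1, h2, h3⟩ :=
        (φ.measurableSet_preimage {r}).exists_isCompact_lt_add (hfin r hr) hδ
      exact ⟨K, h1, h2, fun _ => h3.le⟩
  choose K hKsub hKc hKμ using hK
  have hi : ∀ r : ℝ≥0, ∃ i, r ≠ 0 → ∀ x ∈ K r, a * r < f i x := by
    intro r
    by_cases hr : r = 0
    · exact ⟨Classical.arbitrary ι, fun h => absurd hr h⟩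
    · obtain ⟨i, hi⟩ := hcover (a * r) (K r) (hKc r) (fun x hx => hlt r hr x (hKsub r hx))
      exact ⟨i, fun _ => hi⟩
  choose i hi using hi
  classical
  obtain ⟨j, hj⟩ := hd.finset_le (φ.range.image i)
  have hsum : ∑ r ∈ φ.range, (a * r) * μ (K r) ≤ L := by
    calc ∑ r ∈ φ.range, (a * r) * μ (K r)
        = ∫⁻ x, ∑ r ∈ φ.range, (K r).indicator (fun _ => a * r) x ∂μ := by
          rw [lintegral_finsetSum]
          · exact Finset.sum_congr rfl fun r _ => by
              rw [lintegral_indicator_const (hKc r).measurableSet]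
          · exact fun r _ => measurable_const.indicator (hKc r).measurableSet
      _ ≤ ∫⁻ x, f j x ∂μ := by
          refine lintegral_mono fun x => ?_
          rw [Finset.sum_eq_single (φ x)]
          · by_cases hx : x ∈ K (φ x)
            · rw [indicator_of_mem hx]
              by_cases hr : φ x = 0
              · simp [hr]
              · exact (hi _ hr x hx).le.trans
                  (hj _ (Finset.mem_image_of_mem i (φ.mem_range_self x)) x)
            · rw [indicator_of_notMem hx]; exact zero_le
          · intro r _ hr
            exact indicator_of_notMem (fun hx => hr (hKsub r hx).symm) _
          · exact fun h => absurd (φ.mem_range_self x) h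
      _ ≤ L := le_iSup (fun i => ∫⁻ x, f i x ∂μ) j
  calc a * ∑ r ∈ φ.range, (r : ℝ≥0∞) * μ (φ ⁻¹' {r})
      = ∑ r ∈ φ.range, (a * r) * μ (φ ⁻¹' {r}) := by
        rw [Finset.mul_sum]
        exact Finset.sum_congr rfl fun r _ => by rw [mul_assoc]
    _ ≤ ∑ r ∈ φ.range, ((a * r) * μ (K r) + (a * r) * (ε / (C + 1))) := by
        refine Finset.sum_le_sum fun r _ => ?_
        by_cases hr : r = 0
        · simp [hr]
        · rw [← mul_add]
          gcongr
          exact hKμ r hr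
    _ = ∑ r ∈ φ.range, (a * r) * μ (K r) + C * (ε / (C + 1)) := by
        rw [Finset.sum_add_distrib, hC, Finset.sum_mul]
    _ ≤ L + ε := by
        gcongr
        calc C * (ε / (C + 1)) ≤ (C + 1) * (ε / (C + 1)) := by gcongr; exact le_self_add
          _ ≤ ε := ENNReal.mul_div_le

/-- The nonnegative continuous functions with compact support lying below `h`. -/
abbrev CompactMinorant {Y : Type*} [TopologicalSpace Y] (h : Y → ℝ≥0∞) : Type _ :=
  {φ : Y → ℝ // Continuous φ ∧ HasCompactSupport φ ∧ (∀ y, 0 ≤ φ y) ∧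
    ∀ y, ENNReal.ofReal (φ y) ≤ h y}

instance {Y : Type*} [TopologicalSpace Y] (h : Y → ℝ≥0∞) : Nonempty (CompactMinorant h) :=
  ⟨⟨0, continuous_zero, HasCompactSupport.zero, by simp, by simp⟩⟩

lemma directed_compactMinorant {Y : Type*} [TopologicalSpace Y] (h : Y → ℝ≥0∞) :
    Directed (· ≤ ·) (fun (φ : CompactMinorant h) (y : Y) => ENNReal.ofReal (φ.1 y)) := by
  rintro ⟨φ, h1, h2, h3, h4⟩ ⟨ψ, k1, k2, k3, k4⟩
  refine ⟨⟨φ ⊔ ψ, h1.sup k1, h2.sup k2, fun y => le_sup_of_le_left (h3 y), fun y => ?_⟩, ?_, ?_⟩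
  · rw [Pi.sup_apply]
    rcases le_total (φ y) (ψ y) with h | h
    · rw [sup_eq_right.2 h]; exact k4 y
    · rw [sup_eq_left.2 h]; exact h4 y
  · exact fun y => ENNReal.ofReal_le_ofReal le_sup_left
  · exact fun y => ENNReal.ofReal_le_ofReal le_sup_right

/-- For `s < h y`, a cut-off equal to 1 at `y` and supported in the open set where `h > s`,
multiplied by `s`, is a minorant reaching `s` at `y`. -/
lemma iSup_compactMinorant {Y : Type*} [TopologicalSpace Y] [T2Space Y] [LocallyCompactSpace Y]
    {h : Y → ℝ≥0∞} (hh : LowerSemicontinuous h) (y : Y) :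
    ⨆ φ : CompactMinorant h, ENNReal.ofReal (φ.1 y) = h y := by
  refine le_antisymm (iSup_le fun φ => φ.2.2.2.2 y) (le_of_forall_lt fun t ht => ?_)
  obtain ⟨s, hts, hs⟩ := exists_between ht
  have hst : s ≠ ⊤ := hs.ne_top
  obtain ⟨φ, h1, h2, h3, h4⟩ := exists_continuous_one_zero_of_isCompact
    (isCompact_singleton (x := y)) (hh.isOpen_preimage s).isClosed_compl
    (by simpa using hs)
  refine lt_of_lt_of_le (b := s) hts ?_
  refine le_iSup_of_le ⟨fun x => s.toReal * φ x, by fun_prop, h3.mul_left,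
    fun x => mul_nonneg ENNReal.toReal_nonneg (h4 x).1, fun x => ?_⟩ ?_
  · by_cases hx : x ∈ h ⁻¹' Ioi s
    · refine le_trans ?_ (le_of_lt hx)
      rw [ENNReal.ofReal_le_iff_le_toReal hst]
      exact mul_le_of_le_one_right ENNReal.toReal_nonneg (h4 x).2
    · have : φ x = 0 := h2 hx
      simp [this]
  · have : φ y = 1 := h1 rfl
    simp [this, ENNReal.ofReal_toReal hst]

variable [LocallyCompactSpace X]

lemma ofReal_integral_of_compactSupport (μ : Measure X) [IsFiniteMeasureOnCompacts μ] {φ : X → ℝ}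
    (h1 : Continuous φ) (h2 : HasCompactSupport φ) (h3 : ∀ y, 0 ≤ φ y) :
    ∫⁻ x, ENNReal.ofReal (φ x) ∂μ = ENNReal.ofReal (∫ x, φ x ∂μ) :=
  (ofReal_integral_eq_lintegral_ofReal (h1.integrable_of_hasCompactSupport h2)
    (Eventually.of_forall h3)).symm

/-- Exhibits the integral as a supremum of vaguely continuous functionals, which is the source of
vague lower semicontinuity. -/
lemma lintegral_eq_iSup_compactMinorant (μ : Measure X) [μ.Regular] {h : X → ℝ≥0∞}
    (hh : LowerSemicontinuous h) :
    ∫⁻ x, h x ∂μ = ⨆ φ : CompactMinorant h, ENNReal.ofReal (∫ x, φ.1 x ∂μ) := by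
  simp_rw [← iSup_compactMinorant hh]
  rw [lintegral_iSup_of_directed_lowerSemicontinuous μ
    (f := fun (φ : CompactMinorant h) x => ENNReal.ofReal (φ.1 x))
    (fun φ => (ENNReal.continuous_ofReal.comp φ.2.1).lowerSemicontinuous)
    (directed_compactMinorant h)]
  exact iSup_congr fun φ => ofReal_integral_of_compactSupport μ φ.2.1 φ.2.2.1 φ.2.2.2.1

/-- Vague lower semicontinuity of the integral of a lower semicontinuous function. -/
lemma VagueTendsto.lintegral_le {ι : Type*} {u : ι → Measure X} {l : Filter ι} {ν : Measure X}
    (hu : VagueTendsto u l ν) (hν : ν.Regular) (hur : ∃ᶠ i in l, (u i).Regular)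
    {h : X → ℝ≥0∞} (hh : LowerSemicontinuous h) {b : ℝ≥0∞}
    (hb : ∀ᶠ i in l, ∫⁻ x, h x ∂(u i) ≤ b) : ∫⁻ x, h x ∂ν ≤ b := by
  rw [lintegral_eq_iSup_compactMinorant ν hh]
  refine iSup_le fun φ => ?_
  have ht := (ENNReal.continuous_ofReal.tendsto _).comp (hu φ.1 φ.2.1 φ.2.2.1)
  refine le_of_tendsto_of_frequently ht ((hur.and_eventually hb).mono ?_)
  rintro i ⟨hr, hi⟩
  refine le_trans ?_ hi
  rw [lintegral_eq_iSup_compactMinorant (u i) hh]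
  exact le_iSup (fun φ : CompactMinorant h => ENNReal.ofReal (∫ x, φ.1 x ∂(u i))) φ

/-- Indicators of open sets are lower semicontinuous, so the comparison holds on open sets; outer
regularity of `ν` extends it to all sets. -/
lemma measure_le_of_integral_le {μ ν : Measure X} [μ.Regular] [ν.Regular]
    (h : ∀ φ : X → ℝ, Continuous φ → HasCompactSupport φ → (∀ x, 0 ≤ φ x) →
      ∫ x, φ x ∂μ ≤ ∫ x, φ x ∂ν) : μ ≤ ν := by
  have hopen : ∀ V : Set X, IsOpen V → μ V ≤ ν V := by
    intro V hV
    have hl : LowerSemicontinuous (V.indicator (1 : X → ℝ≥0∞)) :=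
      hV.lowerSemicontinuous_indicator zero_le_one
    rw [← lintegral_indicator_one hV.measurableSet, ← lintegral_indicator_one hV.measurableSet,
      lintegral_eq_iSup_compactMinorant μ hl, lintegral_eq_iSup_compactMinorant ν hl]
    exact iSup_mono fun φ => ENNReal.ofReal_le_ofReal (h φ.1 φ.2.1 φ.2.2.1 φ.2.2.2.1)
  refine Measure.le_iff.2 fun A _ => ?_
  rw [A.measure_eq_iInf_isOpen ν]
  refine le_iInf₂ fun V hAV => le_iInf fun hV => ?_
  exact (measure_mono hAV).trans (hopen V hV)

lemma integral_le_of_measure_le {μ ν : Measure X} [ν.Regular] (h : μ ≤ ν) {φ : X → ℝ}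
    (h1 : Continuous φ) (h2 : HasCompactSupport φ) (h3 : ∀ x, 0 ≤ φ x) :
    ∫ x, φ x ∂μ ≤ ∫ x, φ x ∂ν :=
  integral_mono_measure h (Eventually.of_forall h3) (h1.integrable_of_hasCompactSupport h2)

lemma eq_of_integral_eq {μ ν : Measure X} [μ.Regular] [ν.Regular]
    (h : ∀ φ : X → ℝ, Continuous φ → HasCompactSupport φ → ∫ x, φ x ∂μ = ∫ x, φ x ∂ν) : μ = ν :=
  Measure.ext_of_integral_eq_on_compactlySupported fun f => h f f.continuous f.hasCompactSupport

/-! ### Double integrals of nonnegative lower semicontinuous kernels. -/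

section Kernel

variable {k : X × X → ℝ≥0∞}

lemma continuous_integral_fiber (ν : Measure X) [IsFiniteMeasureOnCompacts ν] {φ : X × X → ℝ}
    (h1 : Continuous φ) (h2 : HasCompactSupport φ) : Continuous (fun x => ∫ y, φ (x, y) ∂ν) := by
  rw [← continuousOn_univ]
  refine continuousOn_integral_of_compact_support (f := fun x y => φ (x, y))
    (k := Prod.snd '' tsupport φ) (h2.image continuous_snd) h1.continuousOn ?_
  intro x y _ hy
  by_contra hne
  exact hy ⟨(x, y), subset_tsupport φ hne, rfl⟩

lemma hasCompactSupport_fiber {φ : X × X → ℝ} (h2 : HasCompactSupport φ) (x : X) :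
    HasCompactSupport (fun y => φ (x, y)) := by
  refine HasCompactSupport.intro (h2.image continuous_snd) fun y hy => ?_
  by_contra hne
  exact hy ⟨(x, y), subset_tsupport φ hne, rfl⟩

lemma hasCompactSupport_integral_fiber (ν : Measure X) {φ : X × X → ℝ}
    (h2 : HasCompactSupport φ) : HasCompactSupport (fun x => ∫ y, φ (x, y) ∂ν) := by
  refine HasCompactSupport.intro (h2.image continuous_fst) fun x hx => ?_
  have : ∀ y, φ (x, y) = 0 := by
    intro y
    by_contra hne
    exact hx ⟨(x, y), subset_tsupport φ hne, rfl⟩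
  simp [this]

lemma lintegral_fiber_eq_iSup (hk : LowerSemicontinuous k) (ν : Measure X) [ν.Regular] (x : X) :
    ∫⁻ y, k (x, y) ∂ν =
      ⨆ φ : CompactMinorant k, ENNReal.ofReal (∫ y, φ.1 (x, y) ∂ν) := by
  simp_rw [← iSup_compactMinorant hk]
  rw [lintegral_iSup_of_directed_lowerSemicontinuous ν
    (f := fun (φ : CompactMinorant k) y => ENNReal.ofReal (φ.1 (x, y)))]
  · refine iSup_congr fun φ => ofReal_integral_of_compactSupport ν ?_ ?_ fun y => φ.2.2.2.1 _
    · exact φ.2.1.comp (by fun_prop)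
    · exact hasCompactSupport_fiber φ.2.2.1 x
  · intro φ
    exact (ENNReal.continuous_ofReal.comp (φ.2.1.comp (by fun_prop))).lowerSemicontinuous
  · intro φ ψ
    obtain ⟨χ, h1, h2⟩ := directed_compactMinorant k φ ψ
    exact ⟨χ, fun y => h1 (x, y), fun y => h2 (x, y)⟩

lemma lowerSemicontinuous_lintegral_fiber (hk : LowerSemicontinuous k) (ν : Measure X)
    [ν.Regular] : LowerSemicontinuous (fun x => ∫⁻ y, k (x, y) ∂ν) := by
  simp_rw [lintegral_fiber_eq_iSup hk ν]
  exact lowerSemicontinuous_iSup fun φ => (ENNReal.continuous_ofReal.comp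
    (continuous_integral_fiber ν φ.2.1 φ.2.2.1)).lowerSemicontinuous

/-- Both integrations commute with the directed supremum over compact minorants, since fiber
integrals of minorants are again continuous with compact support. This reduces Fubini's theorem to
the compactly supported case, where no σ-finiteness is needed. -/
lemma lintegral_lintegral_eq_iSup (hk : LowerSemicontinuous k) (ν μ : Measure X) [ν.Regular]
    [μ.Regular] : ∫⁻ x, ∫⁻ y, k (x, y) ∂ν ∂μ =
      ⨆ φ : CompactMinorant k, ENNReal.ofReal (∫ x, ∫ y, φ.1 (x, y) ∂ν ∂μ) := by
  simp_rw [lintegral_fiber_eq_iSup hk ν]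
  rw [lintegral_iSup_of_directed_lowerSemicontinuous μ]
  · refine iSup_congr fun φ => ofReal_integral_of_compactSupport μ
      (continuous_integral_fiber ν φ.2.1 φ.2.2.1) (hasCompactSupport_integral_fiber ν φ.2.2.1)
      fun x => integral_nonneg fun y => φ.2.2.2.1 _
  · exact fun φ => (ENNReal.continuous_ofReal.comp
      (continuous_integral_fiber ν φ.2.1 φ.2.2.1)).lowerSemicontinuous
  · intro φ ψ
    obtain ⟨χ, h1, h2⟩ := directed_compactMinorant k φ ψ
    have key : ∀ (α β : CompactMinorant k),
        ((fun p => ENNReal.ofReal (α.1 p)) ≤ fun p => ENNReal.ofReal (β.1 p)) → ∀ x,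
        ENNReal.ofReal (∫ y, α.1 (x, y) ∂ν) ≤ ENNReal.ofReal (∫ y, β.1 (x, y) ∂ν) := by
      intro α β h x
      have e : ∀ γ : CompactMinorant k, ∫⁻ y, ENNReal.ofReal (γ.1 (x, y)) ∂ν =
          ENNReal.ofReal (∫ y, γ.1 (x, y) ∂ν) := fun γ =>
        ofReal_integral_of_compactSupport ν (γ.2.1.comp (by fun_prop))
          (hasCompactSupport_fiber γ.2.2.1 x) (fun y => γ.2.2.2.1 _)
      rw [← e, ← e]
      exact lintegral_mono fun y => h (x, y)
    exact ⟨χ, key φ χ h1, key ψ χ h2⟩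

/-- Fubini's theorem for lower semicontinuous functions and (not necessarily `σ`-finite) regular
measures. -/
lemma lintegral_lintegral_swap_of_lowerSemicontinuous (hk : LowerSemicontinuous k)
    (ν μ : Measure X) [ν.Regular] [μ.Regular] :
    ∫⁻ x, ∫⁻ y, k (x, y) ∂ν ∂μ = ∫⁻ y, ∫⁻ x, k (x, y) ∂μ ∂ν := by
  have hk' : LowerSemicontinuous (fun p : X × X => k p.swap) := hk.comp continuous_swap
  have hr := lintegral_lintegral_eq_iSup hk' μ ν
  simp only [Prod.swap_prod_mk] at hr
  rw [lintegral_lintegral_eq_iSup hk, hr]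
  have hsw : ∀ {h : X × X → ℝ≥0∞} (φ : CompactMinorant h), ∃ ψ : CompactMinorant
      (fun p : X × X => h p.swap), ∀ p, ψ.1 p = φ.1 p.swap := fun φ =>
    ⟨⟨fun p => φ.1 p.swap, φ.2.1.comp continuous_swap,
      φ.2.2.1.comp_homeomorph (Homeomorph.prodComm X X), fun p => φ.2.2.2.1 _,
      fun p => φ.2.2.2.2 _⟩, fun _ => rfl⟩
  have hF : ∀ φ : CompactMinorant k, ∫ x, ∫ y, φ.1 (x, y) ∂ν ∂μ = ∫ y, ∫ x, φ.1 (x, y) ∂μ ∂ν :=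
    fun φ => integral_integral_swap_of_hasCompactSupport (f := fun x y => φ.1 (x, y))
      φ.2.1 φ.2.2.1
  refine le_antisymm (iSup_le fun φ => ?_) (iSup_le fun ψ => ?_)
  · obtain ⟨ψ, hψ⟩ := hsw φ
    refine le_iSup_of_le ψ (le_of_eq ?_)
    rw [hF]
    simp [hψ]
  · obtain ⟨φ, hφ⟩ := hsw ψ
    refine le_iSup_of_le ⟨φ.1, by simpa using φ.2⟩ (le_of_eq ?_)
    rw [hF]
    simp [hφ]

end Kernel

end LowerSemicontinuous

/-! ### Extended-real integrals of differences. -/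

section Eint

variable {X : Type*} [MeasurableSpace X]

/-- For truncated subtraction `(h₁ - h₂) + h₂ = max h₁ h₂ = (h₂ - h₁) + h₁`; after integration the
finite terms may be moved across. All extended-real integrals are thereby replaced by pairs of
`lintegral`s. -/
lemma eint_eq_sub {ψ : X → EReal} {h₁ h₂ : X → ℝ≥0∞} {ν : Measure X} (m₁ : Measurable h₁)
    (m₂ : Measurable h₂) (h : ∀ᵐ x ∂ν, ψ x = (h₁ x : EReal) - h₂ x)
    (hfin : ∫⁻ x, h₂ x ∂ν ≠ ⊤) :
    eint ψ ν = ((∫⁻ x, h₁ x ∂ν : ℝ≥0∞) : EReal) - ((∫⁻ x, h₂ x ∂ν : ℝ≥0∞) : EReal) := by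
  have e1 : ∫⁻ x, (ψ x).toENNReal ∂ν = ∫⁻ x, (h₁ x - h₂ x) ∂ν := by
    refine lintegral_congr_ae (h.mono fun x hx => ?_)
    show (ψ x).toENNReal = h₁ x - h₂ x
    rw [hx, EReal.toENNReal_sub (EReal.coe_ennreal_nonneg _)]
    simp
  have e2 : ∫⁻ x, (-ψ x).toENNReal ∂ν = ∫⁻ x, (h₂ x - h₁ x) ∂ν := by
    refine lintegral_congr_ae ?_
    filter_upwards [h, ae_lt_top m₂ hfin] with x hx hx2
    show (-ψ x).toENNReal = h₂ x - h₁ x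
    rw [hx, EReal.neg_sub (by simp) (by simp [hx2.ne]), add_comm, ← sub_eq_add_neg,
      EReal.toENNReal_sub (EReal.coe_ennreal_nonneg _)]
    simp
  have hadd : ∫⁻ x, (h₁ x - h₂ x) ∂ν + ∫⁻ x, h₂ x ∂ν =
      ∫⁻ x, (h₂ x - h₁ x) ∂ν + ∫⁻ x, h₁ x ∂ν := by
    rw [← lintegral_add_right _ m₂, ← lintegral_add_right _ m₁]
    refine lintegral_congr fun x => ?_
    rw [tsub_add_eq_max, tsub_add_eq_max, max_comm]
  have hB : ∫⁻ x, (h₂ x - h₁ x) ∂ν ≠ ⊤ :=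
    ne_top_of_le_ne_top hfin (lintegral_mono fun x => tsub_le_self)
  rw [eint, e1, e2]
  generalize ∫⁻ x, (h₁ x - h₂ x) ∂ν = A at *
  generalize ∫⁻ x, (h₂ x - h₁ x) ∂ν = B at *
  generalize ∫⁻ x, h₁ x ∂ν = H at *
  generalize ∫⁻ x, h₂ x ∂ν = N at *
  lift B to ℝ≥0 using hB
  lift N to ℝ≥0 using hfin
  induction A with
  | top =>
    have : H = ⊤ := by
      by_contra hH
      lift H to ℝ≥0 using hH
      simp only [top_add] at hadd
      exact absurd hadd (by rw [← ENNReal.coe_add]; exact ENNReal.top_ne_coe)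
    rw [this]
    exact (EReal.top_sub_coe (B : ℝ)).trans (EReal.top_sub_coe (N : ℝ)).symm
  | coe A =>
    have hH : H ≠ ⊤ := by
      rintro rfl
      rw [add_top, ← ENNReal.coe_add] at hadd
      exact ENNReal.coe_ne_top hadd
    lift H to ℝ≥0 using hH
    have hadd' : (A : ℝ) + N = B + H := by exact_mod_cast hadd
    have : (A : ℝ) - B = H - N := by linarith
    simp only [EReal.coe_nnreal_eq_coe_real]
    exact_mod_cast this

end Eint

/-! ### Reduction to nonnegative kernels and fields. -/

section Decomposition

/-- A function of the class `Φ` is a nonnegative lower semicontinuous function minus a constant. -/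
lemma IsPhi.exists_eq_sub {Y : Type*} [TopologicalSpace Y] {ψ : Y → EReal} (h : IsPhi ψ) :
    ∃ (k : Y → ℝ≥0∞) (c : ℝ≥0), LowerSemicontinuous k ∧ (c = 0 ∨ CompactSpace Y) ∧
      ∀ y, ψ y = (k y : EReal) - ((c : ℝ≥0∞) : EReal) := by
  obtain ⟨hl, hb, hc⟩ := h
  have key : ∀ c : ℝ≥0, (c = 0 ∨ CompactSpace Y) → (∀ y, 0 ≤ ψ y + ((c : ℝ) : EReal)) →
      ∃ (k : Y → ℝ≥0∞) (c : ℝ≥0), LowerSemicontinuous k ∧ (c = 0 ∨ CompactSpace Y) ∧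
      ∀ y, ψ y = (k y : EReal) - ((c : ℝ≥0∞) : EReal) := by
    intro c hc0 hpos
    refine ⟨fun y => (ψ y + ((c : ℝ) : EReal)).toENNReal, c, ?_, hc0, fun y => ?_⟩
    · refine Continuous.comp_lowerSemicontinuous
        (g := fun z : EReal => (z + ((c : ℝ) : EReal)).toENNReal) ?_ hl ?_
      · refine EReal.continuous_toENNReal.comp ?_
        rw [continuous_iff_continuousAt]
        intro z
        exact (EReal.continuousAt_add (p := (z, ((c : ℝ) : EReal))) (by simp) (by simp)).comp
          (f := fun z : EReal => (z, ((c : ℝ) : EReal))) (by fun_prop)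
      · intro a b hab
        exact EReal.toENNReal_le_toENNReal (by gcongr)
    · rw [EReal.coe_toENNReal (hpos y), EReal.coe_nnreal_eq_coe_real, EReal.add_sub_cancel_right]
  rcases hc with hc | hc
  · rcases isEmpty_or_nonempty Y with hY | hY
    · exact key 0 (Or.inl rfl) fun y => isEmptyElim y
    · obtain ⟨y₀, -, hy₀⟩ := (hl.lowerSemicontinuousOn univ).exists_isMinOn univ_nonempty
        isCompact_univ
      have hmin : ∀ y, ψ y₀ ≤ ψ y := fun y => hy₀ (mem_univ y)
      -- The shift is the negative part of the minimum. If `ψ y₀ = ⊤`, then `toReal` is 0 and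
      -- nothing is shifted.
      refine key (-(ψ y₀).toReal).toNNReal (Or.inr hc) fun y => ?_
      refine le_trans ?_ (add_le_add_left (hmin y) _)
      by_cases ht : ψ y₀ = ⊤
      · simp [ht]
      · lift ψ y₀ to ℝ using ⟨ht, hb y₀⟩ with a
        rw [← EReal.coe_add]
        have := Real.le_coe_toNNReal (-a)
        simp only [EReal.toReal_coe]
        exact_mod_cast by linarith
  · exact key 0 (Or.inl rfl) fun y => by simpa using hc y

end Decomposition

/-- The kernel `κ` is the nonnegative symmetric kernel `k` minus a constant. -/
structure KernelDecomp {X : Type*} [TopologicalSpace X] (κ : X × X → EReal) (k : X × X → ℝ≥0∞)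
    (c : ℝ≥0) : Prop where
  lsc : LowerSemicontinuous k
  compact : c = 0 ∨ CompactSpace X
  symm : ∀ x y, k (x, y) = k (y, x)
  eq_sub : ∀ p, κ p = (k p : EReal) - ((c : ℝ≥0∞) : EReal)

lemma exists_kernelDecomp {X : Type*} [TopologicalSpace X] {κ : X × X → EReal} (h : IsPhi κ)
    (hs : ∀ x y, κ (x, y) = κ (y, x)) : ∃ k c, KernelDecomp κ k c := by
  obtain ⟨k, c, h1, h2, h3⟩ := h.exists_eq_sub
  refine ⟨k, c, h1, ?_, fun x y => ?_, h3⟩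
  · refine h2.imp_right fun hc => ⟨?_⟩
    have : (univ : Set X) = Prod.fst '' (univ : Set (X × X)) := by
      ext x; simpa using ⟨x⟩
    rw [this]
    exact hc.isCompact_univ.image continuous_fst
  · have := hs x y
    rw [h3, h3, EReal.coe_nnreal_eq_coe_real] at this
    have h4 := congrArg (fun z : EReal => z + ((c : ℝ) : EReal)) this
    simp only [EReal.sub_add_cancel] at h4
    exact EReal.coe_ennreal_injective h4

/-- The mutual energy with respect to a nonnegative kernel. -/
noncomputable def posEnergy {X : Type*} [MeasurableSpace X] (k : X × X → ℝ≥0∞) (ν μ : Measure X) : ℝ≥0∞ :=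
  ∫⁻ x, ∫⁻ y, k (x, y) ∂ν ∂μ

/-- The mutual energy as a real number. -/
noncomputable def energyForm {X : Type*} [MeasurableSpace X] (κ : X × X → EReal) (ν μ : Measure X) : ℝ :=
  (mutualEnergy κ ν μ).toReal

/-! ### Mutual energy as a positive semidefinite form; strong and vague convergence. -/

section Energy

variable {X : Type*} [TopologicalSpace X] [T2Space X] [LocallyCompactSpace X]
  [MeasurableSpace X] [BorelSpace X] {κ : X × X → EReal} {k : X × X → ℝ≥0∞} {c : ℝ≥0}

lemma KernelDecomp.const_mul_ne_top (hk : KernelDecomp κ k c) (ν : Measure X)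
    [IsFiniteMeasureOnCompacts ν] : (c : ℝ≥0∞) * ν univ ≠ ⊤ := by
  rcases hk.compact with rfl | h
  · simp
  · exact ENNReal.mul_ne_top (by simp) (measure_ne_top ν univ)

lemma KernelDecomp.const_mul_mul_ne_top (hk : KernelDecomp κ k c) (ν μ : Measure X)
    [IsFiniteMeasureOnCompacts ν] [IsFiniteMeasureOnCompacts μ] :
    (c : ℝ≥0∞) * ν univ * μ univ ≠ ⊤ := by
  rcases hk.compact with rfl | h
  · simp
  · exact ENNReal.mul_ne_top (ENNReal.mul_ne_top (by simp) (measure_ne_top ν univ))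
      (measure_ne_top μ univ)

lemma KernelDecomp.potential_eq (hk : KernelDecomp κ k c) (ν : Measure X) [ν.Regular] (x : X) :
    potential κ ν x =
      ((∫⁻ y, k (x, y) ∂ν : ℝ≥0∞) : EReal) - (((c : ℝ≥0∞) * ν univ : ℝ≥0∞) : EReal) := by
  have hm : Measurable (fun y => k (x, y)) :=
    (hk.lsc.comp (by fun_prop : Continuous fun y => (x, y))).measurable
  rw [potential, eint_eq_sub hm measurable_const (Eventually.of_forall fun y => hk.eq_sub (x, y))
    (by rw [lintegral_const]; exact hk.const_mul_ne_top ν), lintegral_const]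

lemma KernelDecomp.measurable_fiber (hk : KernelDecomp κ k c) (ν : Measure X) [ν.Regular] :
    Measurable (fun x => ∫⁻ y, k (x, y) ∂ν) :=
  (lowerSemicontinuous_lintegral_fiber hk.lsc ν).measurable

lemma KernelDecomp.mutualEnergy_eq (hk : KernelDecomp κ k c) (ν μ : Measure X) [ν.Regular]
    [μ.Regular] : mutualEnergy κ ν μ =
      (posEnergy k ν μ : EReal) - (((c : ℝ≥0∞) * ν univ * μ univ : ℝ≥0∞) : EReal) := by
  rw [mutualEnergy, eint_eq_sub (hk.measurable_fiber ν) measurable_const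
    (Eventually.of_forall fun x => hk.potential_eq ν x)
    (by rw [lintegral_const]; exact hk.const_mul_mul_ne_top ν μ), lintegral_const]
  rfl

lemma KernelDecomp.mem_finiteEnergyOn_iff (hk : KernelDecomp κ k c) {E : Set X} {ν : Measure X} :
    ν ∈ finiteEnergyOn κ E ↔ ν ∈ radonOn E ∧ posEnergy k ν ν ≠ ⊤ := by
  refine and_congr_right fun h => ?_
  have := h.1
  rw [hk.mutualEnergy_eq]
  have hc := hk.const_mul_mul_ne_top ν ν
  generalize (c : ℝ≥0∞) * ν univ * ν univ = a at *
  lift a to ℝ≥0 using hc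
  generalize posEnergy k ν ν = b
  induction b with
  | top => simp [EReal.coe_nnreal_eq_coe_real]
  | coe b =>
    simp only [EReal.coe_nnreal_eq_coe_real, ← EReal.coe_sub]
    simp [-EReal.coe_sub]

/-- Positive definiteness gives 2κ(ν,μ) ≤ κ(ν,ν) + κ(μ,μ), so an infinite mutual energy would force
an infinite self-energy. Afterwards all energies can be handled as real numbers. -/
lemma KernelDecomp.posEnergy_ne_top (hk : KernelDecomp κ k c) (hp : IsPositiveDefinite κ)
    {ν μ : Measure X} (hν : ν ∈ finiteEnergyOn κ univ) (hμ : μ ∈ finiteEnergyOn κ univ) :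
    posEnergy k ν μ ≠ ⊤ := by
  intro htop
  have := hν.1.1
  have := hμ.1.1
  have h := hp.2 ν μ hν.1.1 hμ.1.1
  rw [hk.mutualEnergy_eq ν μ, htop] at h
  have hc := hk.const_mul_mul_ne_top ν μ
  generalize (c : ℝ≥0∞) * ν univ * μ univ = a at *
  lift a to ℝ≥0 using hc
  rw [EReal.coe_nnreal_eq_coe_real, EReal.coe_ennreal_top, EReal.top_sub_coe,
    EReal.mul_top_of_pos (by norm_num), top_le_iff] at h
  exact (EReal.add_lt_top hν.2.2.ne hμ.2.2.ne).ne h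

lemma KernelDecomp.energyForm_eq (hk : KernelDecomp κ k c) (hp : IsPositiveDefinite κ)
    {ν μ : Measure X} (hν : ν ∈ finiteEnergyOn κ univ) (hμ : μ ∈ finiteEnergyOn κ univ) :
    mutualEnergy κ ν μ = (energyForm κ ν μ : EReal) ∧
      energyForm κ ν μ = (posEnergy k ν μ).toReal - ((c : ℝ≥0∞) * ν univ * μ univ).toReal := by
  have := hν.1.1
  have := hμ.1.1
  have h2 := hk.posEnergy_ne_top hp hν hμ
  rw [energyForm, hk.mutualEnergy_eq ν μ]
  have hc := hk.const_mul_mul_ne_top ν μ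
  generalize (c : ℝ≥0∞) * ν univ * μ univ = a at *
  generalize posEnergy k ν μ = b at *
  lift a to ℝ≥0 using hc
  lift b to ℝ≥0 using h2
  simp only [EReal.coe_nnreal_eq_coe_real, ← EReal.coe_sub]
  simp [-EReal.coe_sub]

lemma KernelDecomp.posEnergy_comm (hk : KernelDecomp κ k c) (ν μ : Measure X) [ν.Regular]
    [μ.Regular] : posEnergy k ν μ = posEnergy k μ ν := by
  rw [posEnergy, lintegral_lintegral_swap_of_lowerSemicontinuous hk.lsc, posEnergy]
  simp_rw [hk.symm]

lemma KernelDecomp.posEnergy_add_left (hk : KernelDecomp κ k c) (ν ν' μ : Measure X) [ν.Regular] :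
    posEnergy k (ν + ν') μ = posEnergy k ν μ + posEnergy k ν' μ := by
  simp_rw [posEnergy, lintegral_add_measure]
  rw [lintegral_add_left (hk.measurable_fiber ν)]

lemma posEnergy_add_right (ν μ μ' : Measure X) :
    posEnergy k ν (μ + μ') = posEnergy k ν μ + posEnergy k ν μ' := by
  simp_rw [posEnergy, lintegral_add_measure]

lemma KernelDecomp.posEnergy_smul_left (hk : KernelDecomp κ k c) (t : ℝ≥0) (ν μ : Measure X)
    [ν.Regular] : posEnergy k (t • ν) μ = t * posEnergy k ν μ := by
  simp_rw [posEnergy, lintegral_smul_measure, ENNReal.smul_def, smul_eq_mul]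
  rw [lintegral_const_mul _ (hk.measurable_fiber ν)]

lemma posEnergy_mono {ν ν' μ μ' : Measure X} (h : ν ≤ ν') (h' : μ ≤ μ') :
    posEnergy k ν μ ≤ posEnergy k ν' μ' :=
  lintegral_mono' h' fun _ => lintegral_mono' h le_rfl

lemma KernelDecomp.add_mem (hk : KernelDecomp κ k c) (hp : IsPositiveDefinite κ) {E : Set X}
    {ν μ : Measure X} (hν : ν ∈ finiteEnergyOn κ E) (hμ : μ ∈ finiteEnergyOn κ E) :
    ν + μ ∈ finiteEnergyOn κ E := by
  have := hν.1.1
  have := hμ.1.1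
  rw [hk.mem_finiteEnergyOn_iff]
  refine ⟨⟨regular_add hν.1.1 hμ.1.1, ?_⟩, ?_⟩
  · rw [Measure.support_add]
    exact union_subset hν.1.2 hμ.1.2
  · have h1 := hk.posEnergy_ne_top hp (mem_finiteEnergyOn_univ hν) (mem_finiteEnergyOn_univ hν)
    have h2 := hk.posEnergy_ne_top hp (mem_finiteEnergyOn_univ hμ) (mem_finiteEnergyOn_univ hμ)
    have h3 := hk.posEnergy_ne_top hp (mem_finiteEnergyOn_univ hν) (mem_finiteEnergyOn_univ hμ)
    rw [hk.posEnergy_add_left, posEnergy_add_right, posEnergy_add_right, hk.posEnergy_comm μ ν]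
    simp [h1, h2, h3]

lemma KernelDecomp.smul_mem (hk : KernelDecomp κ k c) {E : Set X} {ν : Measure X}
    (hν : ν ∈ finiteEnergyOn κ E) (t : ℝ≥0) : t • ν ∈ finiteEnergyOn κ E := by
  have := hν.1.1
  have h := (hk.mem_finiteEnergyOn_iff.1 hν).2
  rw [hk.mem_finiteEnergyOn_iff]
  refine ⟨⟨inferInstance, ?_⟩, ?_⟩
  · refine Subset.trans ?_ hν.1.2
    exact Measure.AbsolutelyContinuous.support_mono (Measure.smul_absolutelyContinuous (c := t))
  · rw [hk.posEnergy_smul_left, hk.posEnergy_comm, hk.posEnergy_smul_left]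
    exact ENNReal.mul_ne_top (by simp) (ENNReal.mul_ne_top (by simp) h)

lemma KernelDecomp.zero_mem (hk : KernelDecomp κ k c) {E : Set X} :
    (0 : Measure X) ∈ finiteEnergyOn κ E := by
  rw [hk.mem_finiteEnergyOn_iff]
  exact ⟨⟨inferInstance, by simp⟩, by simp [posEnergy]⟩

lemma KernelDecomp.energyForm_comm (hk : KernelDecomp κ k c) (hp : IsPositiveDefinite κ)
    {ν μ : Measure X} (hν : ν ∈ finiteEnergyOn κ univ) (hμ : μ ∈ finiteEnergyOn κ univ) :
    energyForm κ ν μ = energyForm κ μ ν := by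
  have := hν.1.1
  have := hμ.1.1
  rw [(hk.energyForm_eq hp hν hμ).2, (hk.energyForm_eq hp hμ hν).2, hk.posEnergy_comm, mul_right_comm]

lemma KernelDecomp.energyForm_add_left (hk : KernelDecomp κ k c) (hp : IsPositiveDefinite κ)
    {ν ν' μ : Measure X} (hν : ν ∈ finiteEnergyOn κ univ) (hν' : ν' ∈ finiteEnergyOn κ univ)
    (hμ : μ ∈ finiteEnergyOn κ univ) :
    energyForm κ (ν + ν') μ = energyForm κ ν μ + energyForm κ ν' μ := by
  have := hν.1.1
  have := hν'.1.1
  have := hμ.1.1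
  rw [(hk.energyForm_eq hp hν hμ).2, (hk.energyForm_eq hp hν' hμ).2,
    (hk.energyForm_eq hp (hk.add_mem hp hν hν') hμ).2, hk.posEnergy_add_left,
    ENNReal.toReal_add (hk.posEnergy_ne_top hp hν hμ) (hk.posEnergy_ne_top hp hν' hμ),
    Measure.add_apply, mul_add, add_mul,
    ENNReal.toReal_add (hk.const_mul_mul_ne_top ν μ) (hk.const_mul_mul_ne_top ν' μ)]
  ring

lemma KernelDecomp.energyForm_smul_left (hk : KernelDecomp κ k c) (hp : IsPositiveDefinite κ)
    {ν μ : Measure X} (hν : ν ∈ finiteEnergyOn κ univ) (hμ : μ ∈ finiteEnergyOn κ univ) (t : ℝ≥0) :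
    energyForm κ (t • ν) μ = t * energyForm κ ν μ := by
  have := hν.1.1
  have := hμ.1.1
  rw [(hk.energyForm_eq hp hν hμ).2, (hk.energyForm_eq hp (hk.smul_mem hν t) hμ).2,
    hk.posEnergy_smul_left, Measure.smul_apply, ENNReal.smul_def, smul_eq_mul]
  simp only [ENNReal.toReal_mul, ENNReal.coe_toReal]
  ring

lemma KernelDecomp.energyForm_add_right (hk : KernelDecomp κ k c) (hp : IsPositiveDefinite κ)
    {ν μ μ' : Measure X} (hν : ν ∈ finiteEnergyOn κ univ) (hμ : μ ∈ finiteEnergyOn κ univ)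
    (hμ' : μ' ∈ finiteEnergyOn κ univ) :
    energyForm κ ν (μ + μ') = energyForm κ ν μ + energyForm κ ν μ' := by
  rw [hk.energyForm_comm hp hν (hk.add_mem hp hμ hμ'), hk.energyForm_add_left hp hμ hμ' hν,
    hk.energyForm_comm hp hμ hν, hk.energyForm_comm hp hμ' hν]

lemma KernelDecomp.energyForm_smul_right (hk : KernelDecomp κ k c) (hp : IsPositiveDefinite κ)
    {ν μ : Measure X} (hν : ν ∈ finiteEnergyOn κ univ) (hμ : μ ∈ finiteEnergyOn κ univ) (t : ℝ≥0) :
    energyForm κ ν (t • μ) = t * energyForm κ ν μ := by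
  rw [hk.energyForm_comm hp hν (hk.smul_mem hμ t), hk.energyForm_smul_left hp hμ hν,
    hk.energyForm_comm hp hμ hν]

lemma KernelDecomp.energyForm_combo (hk : KernelDecomp κ k c) (hp : IsPositiveDefinite κ)
    {ν ν' : Measure X} (hν : ν ∈ finiteEnergyOn κ univ) (hν' : ν' ∈ finiteEnergyOn κ univ)
    (s t : ℝ≥0) :
    energyForm κ (s • ν + t • ν') (s • ν + t • ν') =
      s ^ 2 * energyForm κ ν ν + t ^ 2 * energyForm κ ν' ν' + 2 * s * t * energyForm κ ν ν' := by
  have h1 := hk.smul_mem hν s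
  have h2 := hk.smul_mem hν' t
  have h3 := hk.add_mem hp h1 h2
  rw [hk.energyForm_add_left hp h1 h2 h3, hk.energyForm_add_right hp h1 h1 h2,
    hk.energyForm_add_right hp h2 h1 h2]
  simp only [hk.energyForm_smul_left hp hν h1, hk.energyForm_smul_left hp hν h2,
    hk.energyForm_smul_left hp hν' h1, hk.energyForm_smul_left hp hν' h2,
    hk.energyForm_smul_right hp hν hν, hk.energyForm_smul_right hp hν hν',
    hk.energyForm_smul_right hp hν' hν, hk.energyForm_smul_right hp hν' hν',
    hk.energyForm_comm hp hν' hν]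
  ring

lemma KernelDecomp.energyForm_sub_nonneg (hk : KernelDecomp κ k c) (hp : IsPositiveDefinite κ)
    {ν μ : Measure X} (hν : ν ∈ finiteEnergyOn κ univ) (hμ : μ ∈ finiteEnergyOn κ univ) :
    0 ≤ energyForm κ ν ν + energyForm κ μ μ - 2 * energyForm κ ν μ := by
  have h := hp.2 ν μ hν.1.1 hμ.1.1
  rw [(hk.energyForm_eq hp hν hμ).1, (hk.energyForm_eq hp hν hν).1,
    (hk.energyForm_eq hp hμ hμ).1] at h
  rw [show (2 : EReal) = ((2 : ℝ) : EReal) from rfl, ← EReal.coe_mul, ← EReal.coe_add,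
    EReal.coe_le_coe_iff] at h
  linarith

lemma KernelDecomp.strongDist_eq (hk : KernelDecomp κ k c) (hp : IsPositiveDefinite κ)
    {ν μ : Measure X} (hν : ν ∈ finiteEnergyOn κ univ) (hμ : μ ∈ finiteEnergyOn κ univ) :
    strongDist κ ν μ = √(energyForm κ ν ν + energyForm κ μ μ - 2 * energyForm κ ν μ) := by
  rw [strongDist, (hk.energyForm_eq hp hν hμ).1, (hk.energyForm_eq hp hν hν).1,
    (hk.energyForm_eq hp hμ hμ).1]
  congr 1

lemma KernelDecomp.strongDist_sq (hk : KernelDecomp κ k c) (hp : IsPositiveDefinite κ)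
    {ν μ : Measure X} (hν : ν ∈ finiteEnergyOn κ univ) (hμ : μ ∈ finiteEnergyOn κ univ) :
    strongDist κ ν μ ^ 2 = energyForm κ ν ν + energyForm κ μ μ - 2 * energyForm κ ν μ := by
  rw [hk.strongDist_eq hp hν hμ, Real.sq_sqrt (hk.energyForm_sub_nonneg hp hν hμ)]

lemma strongDist_nonneg (ν μ : Measure X) : 0 ≤ strongDist κ ν μ := Real.sqrt_nonneg _

/-- The Cauchy-Schwarz inequality for the differences of measures of finite energy. -/
lemma KernelDecomp.abs_energyForm_le (hk : KernelDecomp κ k c) (hp : IsPositiveDefinite κ)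
    {a b p q : Measure X} (ha : a ∈ finiteEnergyOn κ univ) (hb : b ∈ finiteEnergyOn κ univ)
    (hp' : p ∈ finiteEnergyOn κ univ) (hq : q ∈ finiteEnergyOn κ univ) :
    |energyForm κ a p - energyForm κ a q - energyForm κ b p + energyForm κ b q| ≤
      strongDist κ a b * strongDist κ p q := by
  -- This is ‖(a - b) + t(p - q)‖² ≥ 0, written for the positive measures `a + t • p` and `b + t •
  -- q`, which forces `t ≥ 0`. Negative `t` are reached below by exchanging `p` and `q`.
  have expand : ∀ {a b p q : Measure X}, a ∈ finiteEnergyOn κ univ → b ∈ finiteEnergyOn κ univ →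
      p ∈ finiteEnergyOn κ univ → q ∈ finiteEnergyOn κ univ → ∀ t : ℝ≥0,
      0 ≤ strongDist κ p q ^ 2 * (t * t) +
        2 * (energyForm κ a p - energyForm κ a q - energyForm κ b p + energyForm κ b q) * t +
        strongDist κ a b ^ 2 := by
    intro a b p q ha hb hp' hq t
    have htp := hk.smul_mem hp' t
    have htq := hk.smul_mem hq t
    have h1 := hk.add_mem hp ha htp
    have h2 := hk.add_mem hp hb htq
    have h := hk.energyForm_sub_nonneg hp h1 h2
    simp only [hk.energyForm_add_left hp ha htp h1, hk.energyForm_add_left hp hb htq h2,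
      hk.energyForm_add_left hp ha htp h2,
      hk.energyForm_add_right hp ha ha htp, hk.energyForm_add_right hp htp ha htp,
      hk.energyForm_add_right hp hb hb htq, hk.energyForm_add_right hp htq hb htq,
      hk.energyForm_add_right hp ha hb htq, hk.energyForm_add_right hp htp hb htq,
      hk.energyForm_smul_left hp hp' ha, hk.energyForm_smul_left hp hq hb,
      hk.energyForm_smul_left hp hp' hb, hk.energyForm_smul_left hp hp' htp,
      hk.energyForm_smul_left hp hq htq, hk.energyForm_smul_left hp hp' htq,
      hk.energyForm_smul_right hp ha hp', hk.energyForm_smul_right hp hb hq,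
      hk.energyForm_smul_right hp ha hq, hk.energyForm_smul_right hp hp' hp',
      hk.energyForm_smul_right hp hp' hq, hk.energyForm_smul_right hp hq hq,
      hk.energyForm_comm hp hp' ha, hk.energyForm_comm hp hq hb, hk.energyForm_comm hp hp' hb] at h
    rw [hk.strongDist_sq hp ha hb, hk.strongDist_sq hp hp' hq]
    nlinarith [h]
  have hd := discrim_le_zero (a := strongDist κ p q ^ 2)
    (b := 2 * (energyForm κ a p - energyForm κ a q - energyForm κ b p + energyForm κ b q))
    (c := strongDist κ a b ^ 2) (fun t => by
      rcases le_total 0 t with ht | ht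
      · have := expand ha hb hp' hq t.toNNReal
        rwa [Real.coe_toNNReal t ht] at this
      · have := expand ha hb hq hp' (-t).toNNReal
        rw [hk.strongDist_sq hp hq hp', ← hk.energyForm_comm hp hp' hq] at this
        rw [hk.strongDist_sq hp hp' hq]
        rw [Real.coe_toNNReal (-t) (by linarith)] at this
        linarith)
  rw [discrim] at hd
  refine abs_le_of_sq_le_sq ?_ (mul_nonneg (strongDist_nonneg _ _) (strongDist_nonneg _ _))
  nlinarith [hd]

lemma energyForm_zero_left (μ : Measure X) : energyForm κ 0 μ = 0 := by
  have : potential κ (0 : Measure X) = fun _ => 0 := by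
    funext x; simp [potential, eint]
  simp [energyForm, mutualEnergy, this, eint]

lemma energyForm_zero_right (ν : Measure X) : energyForm κ ν 0 = 0 := by
  simp [energyForm, mutualEnergy, eint]

lemma KernelDecomp.strongDist_zero_sq (hk : KernelDecomp κ k c) (hp : IsPositiveDefinite κ)
    {a : Measure X} (ha : a ∈ finiteEnergyOn κ univ) :
    strongDist κ a 0 ^ 2 = energyForm κ a a := by
  rw [hk.strongDist_sq hp ha hk.zero_mem, energyForm_zero_left, energyForm_zero_right]
  ring

lemma KernelDecomp.tendsto_energyForm_right (hk : KernelDecomp κ k c) (hp : IsPositiveDefinite κ)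
    {ι : Type*} {l : Filter ι} {u : ι → Measure X} {ν ζ : Measure X}
    (hu : ∀ᶠ i in l, u i ∈ finiteEnergyOn κ univ) (hν : ν ∈ finiteEnergyOn κ univ)
    (hζ : ζ ∈ finiteEnergyOn κ univ) (h : StrongTendsto κ u l ν) :
    Tendsto (fun i => energyForm κ ζ (u i)) l (𝓝 (energyForm κ ζ ν)) := by
  rw [tendsto_iff_dist_tendsto_zero]
  have h0 : Tendsto (fun i => strongDist κ ζ 0 * strongDist κ (u i) ν) l (𝓝 0) := by
    simpa using h.const_mul (strongDist κ ζ 0)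
  refine squeeze_zero' (Eventually.of_forall fun i => dist_nonneg) (hu.mono fun i hi => ?_) h0
  have := hk.abs_energyForm_le hp hζ hk.zero_mem hi hν
  simpa [energyForm_zero_left, Real.dist_eq] using this

lemma KernelDecomp.tendsto_energyForm_self (hk : KernelDecomp κ k c) (hp : IsPositiveDefinite κ)
    {ι : Type*} {l : Filter ι} {u : ι → Measure X} {ν : Measure X}
    (hu : ∀ᶠ i in l, u i ∈ finiteEnergyOn κ univ) (hν : ν ∈ finiteEnergyOn κ univ)
    (h : StrongTendsto κ u l ν) :
    Tendsto (fun i => energyForm κ (u i) (u i)) l (𝓝 (energyForm κ ν ν)) := by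
  have h1 := hk.tendsto_energyForm_right hp hu hν hν h
  have h2 : Tendsto (fun i => strongDist κ (u i) ν ^ 2) l (𝓝 (0 ^ 2)) := h.pow 2
  have h3 := (h2.add (h1.const_mul 2)).sub_const (energyForm κ ν ν)
  refine Tendsto.congr' (hu.mono fun i hi => ?_) (h3.trans (by rw [show (0:ℝ) ^ 2 +
    2 * energyForm κ ν ν - energyForm κ ν ν = energyForm κ ν ν by ring]))
  rw [hk.strongDist_sq hp hi hν, hk.energyForm_comm hp hν hi]
  ring

lemma IsPerfect.exists_strongTendsto (h : IsPerfect κ) {ι : Type*} {l : Filter ι} [l.NeBot]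
    {u : ι → Measure X} (hu : ∀ᶠ i in l, u i ∈ finiteEnergyOn κ univ)
    (hc : ∀ ε : ℝ, 0 < ε → ∃ s ∈ l, ∀ i ∈ s, ∀ j ∈ s, strongDist κ (u i) (u j) < ε) :
    ∃ ν ∈ finiteEnergyOn κ univ, StrongTendsto κ u l ν := by
  obtain ⟨ν, hν, hF⟩ := h.1 (map u l) inferInstance hu fun ε hε => by
    obtain ⟨s, hs, hs'⟩ := hc ε hε
    refine ⟨u '' s, image_mem_map hs, ?_⟩
    rintro _ ⟨i, hi, rfl⟩ _ ⟨j, hj, rfl⟩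
    exact hs' i hi j hj
  exact ⟨ν, hν, tendsto_map'_iff.1 hF⟩

lemma IsPerfect.vagueTendsto (h : IsPerfect κ) {ι : Type*} {l : Filter ι}
    {u : ι → Measure X} {ν : Measure X} (hu : ∀ᶠ i in l, u i ∈ finiteEnergyOn κ univ)
    (hν : ν ∈ finiteEnergyOn κ univ) (hs : StrongTendsto κ u l ν) : VagueTendsto u l ν := by
  intro φ h1 h2
  rw [Metric.tendsto_nhds]
  intro ε hε
  obtain ⟨δ, hδ, hδ'⟩ := h.2 φ h1 h2 ν hν ε hε
  filter_upwards [hu, hs.eventually (gt_mem_nhds hδ)] with i hi hi'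
  exact hδ' _ hi hi'

/-- The strong topology is finer than the vague one, and vague limits separate regular measures: a
perfect kernel is strictly positive definite on positive measures of finite energy. -/
lemma IsPerfect.eq_of_strongDist_eq_zero (h : IsPerfect κ) {ν μ : Measure X}
    (hν : ν ∈ finiteEnergyOn κ univ) (hμ : μ ∈ finiteEnergyOn κ univ)
    (h0 : strongDist κ μ ν = 0) : μ = ν := by
  have := hν.1.1
  have := hμ.1.1
  refine eq_of_integral_eq fun φ h1 h2 => ?_
  refine eq_of_abs_sub_nonpos (le_of_forall_pos_le_add fun ε hε => ?_)
  obtain ⟨δ, hδ, hδ'⟩ := h.2 φ h1 h2 ν hν ε hε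
  simpa using (hδ' μ hμ (by rw [h0]; exact hδ)).le

lemma VagueTendsto.mem_radonOn {ι : Type*} {l : Filter ι} [l.NeBot] {u : ι → Measure X}
    {ν : Measure X} {E : Set X} (hE : IsClosed E) (h : VagueTendsto u l ν) (hν : ν.Regular)
    (hu : ∀ᶠ i in l, u i ∈ radonOn E) : ν ∈ radonOn E := by
  rw [mem_radonOn_iff hE]
  refine ⟨hν, ?_⟩
  have hl : LowerSemicontinuous (Eᶜ.indicator (1 : X → ℝ≥0∞)) :=
    hE.isOpen_compl.lowerSemicontinuous_indicator zero_le_one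
  have := h.lintegral_le hν (hu.mono fun i hi => hi.1).frequently hl (b := 0) (hu.mono fun i hi => by
    rw [lintegral_indicator_one hE.isOpen_compl.measurableSet]
    exact ((mem_radonOn_iff hE).1 hi).2.le)
  rwa [lintegral_indicator_one hE.isOpen_compl.measurableSet, nonpos_iff_eq_zero] at this

lemma VagueTendsto.le {ι : Type*} {l : Filter ι} [l.NeBot] {u v : ι → Measure X}
    {ν σ : Measure X} (h : VagueTendsto u l ν) (h' : VagueTendsto v l σ) (hν : ν.Regular)
    (hσ : σ.Regular) (hu : ∀ᶠ i in l, (v i).Regular ∧ u i ≤ v i) : ν ≤ σ :=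
  measure_le_of_integral_le fun φ h1 h2 h3 =>
    le_of_tendsto_of_tendsto (h φ h1 h2) (h' φ h1 h2) (hu.mono fun _ hi =>
      have := hi.1
      integral_le_of_measure_le hi.2 h1 h2 h3)

end Energy

/-! ### Interior capacity and measures of finite energy. -/

section Capacity

variable {X : Type*} [TopologicalSpace X] [T2Space X] [LocallyCompactSpace X]
  [MeasurableSpace X] [BorelSpace X] {κ : X × X → EReal} {k : X × X → ℝ≥0∞} {c : ℝ≥0}

/-- The midpoint of two measures. -/
noncomputable def midpointMeasure (ν μ : Measure X) : Measure X :=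
  (1 / 2 : ℝ≥0) • ν + (1 / 2 : ℝ≥0) • μ

lemma KernelDecomp.midpoint_mem (hk : KernelDecomp κ k c) (hp : IsPositiveDefinite κ) {E : Set X}
    {ν μ : Measure X} (hν : ν ∈ finiteEnergyOn κ E) (hμ : μ ∈ finiteEnergyOn κ E) :
    midpointMeasure ν μ ∈ finiteEnergyOn κ E :=
  hk.add_mem hp (hk.smul_mem hν _) (hk.smul_mem hμ _)

lemma KernelDecomp.strongDist_sq_eq_midpoint (hk : KernelDecomp κ k c) (hp : IsPositiveDefinite κ)
    {ν μ : Measure X} (hν : ν ∈ finiteEnergyOn κ univ) (hμ : μ ∈ finiteEnergyOn κ univ) :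
    strongDist κ ν μ ^ 2 = 2 * energyForm κ ν ν + 2 * energyForm κ μ μ -
      4 * energyForm κ (midpointMeasure ν μ) (midpointMeasure ν μ) := by
  rw [midpointMeasure, hk.energyForm_combo hp hν hμ, hk.strongDist_sq hp hν hμ]
  push_cast
  ring

lemma lintegral_midpoint (ν μ : Measure X) (h : X → ℝ≥0∞) :
    ∫⁻ x, h x ∂(midpointMeasure ν μ) =
      ((1 / 2 : ℝ≥0) : ℝ≥0∞) * ∫⁻ x, h x ∂ν + ((1 / 2 : ℝ≥0) : ℝ≥0∞) * ∫⁻ x, h x ∂μ := by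
  rw [midpointMeasure, lintegral_add_measure, lintegral_smul_measure, lintegral_smul_measure]
  rfl

lemma coe_half_add_half : ((1 / 2 : ℝ≥0) : ℝ≥0∞) + ((1 / 2 : ℝ≥0) : ℝ≥0∞) = 1 := by
  rw [← ENNReal.coe_add, add_halves, ENNReal.coe_one]

lemma KernelDecomp.restrict_mem (hk : KernelDecomp κ k c) {ν : Measure X} {E A F : Set X}
    (hν : ν ∈ finiteEnergyOn κ E) (hA : ν A ≠ ⊤) (hF : IsClosed F) (hAF : A ⊆ F) :
    ν.restrict A ∈ finiteEnergyOn κ F := by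
  have := hν.1.1
  rw [hk.mem_finiteEnergyOn_iff] at hν ⊢
  refine ⟨(mem_radonOn_iff hF).2 ⟨Measure.Regular.restrict_of_measure_ne_top hA, ?_⟩,
    ne_top_of_le_ne_top hν.2 (posEnergy_mono Measure.restrict_le_self Measure.restrict_le_self)⟩
  rw [Measure.restrict_apply hF.isOpen_compl.measurableSet,
    (disjoint_compl_left_iff_subset.2 hAF).inter_eq, measure_empty]

/-- The Radon probability measures supported by some compact subset of `A`. -/
def compactUnitMeasures (A : Set X) : Set (Measure X) :=
  {μ | μ univ = 1 ∧ ∃ Q, IsCompact Q ∧ Q ⊆ A ∧ μ ∈ radonOn Q}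

lemma compactUnitMeasures_mono {A B : Set X} (h : A ⊆ B) :
    compactUnitMeasures A ⊆ compactUnitMeasures B :=
  fun _ ⟨h1, Q, h2, h3, h4⟩ => ⟨h1, Q, h2, h3.trans h, h4⟩

lemma capacity_mono {A B : Set X} (h : A ⊆ B) : capacity κ A ≤ capacity κ B :=
  iSup_mono fun _ => iSup_mono fun _ => iSup_mono' fun hK => ⟨hK.trans h, le_rfl⟩

lemma inv_capacity_le {A : Set X} {μ : Measure X} (hμ : μ ∈ compactUnitMeasures A) :
    (capacity κ A)⁻¹ ≤ (mutualEnergy κ μ μ).toENNReal := by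
  obtain ⟨h1, Q, h2, h3, h4⟩ := hμ
  rw [ENNReal.inv_le_iff_inv_le]
  refine le_trans ?_ (le_iSup₂_of_le Q h2 (le_iSup_of_le h3 le_rfl))
  rw [ENNReal.inv_le_inv]
  exact iInf₂_le_of_le μ h4 (iInf_le _ h1)

lemma exists_energy_lt_of_lt_capacity {A : Set X} {t : ℝ≥0∞} (h : t < capacity κ A) :
    ∃ μ ∈ compactUnitMeasures A, (mutualEnergy κ μ μ).toENNReal < t⁻¹ := by
  simp only [capacity, lt_iSup_iff] at h
  obtain ⟨Q, h2, h3, h⟩ := h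
  rw [ENNReal.lt_inv_iff_lt_inv] at h
  simp only [iInf_lt_iff] at h
  obtain ⟨μ, h4, h1, h⟩ := h
  exact ⟨μ, ⟨h1, Q, h2, h3, h4⟩, h⟩

lemma midpoint_mem_compactUnitMeasures {A : Set X} {ν μ : Measure X}
    (hν : ν ∈ compactUnitMeasures A) (hμ : μ ∈ compactUnitMeasures A) :
    midpointMeasure ν μ ∈ compactUnitMeasures A := by
  obtain ⟨h1, Q, h2, h3, h4⟩ := hν
  obtain ⟨k1, R, k2, k3, k4⟩ := hμ
  rw [mem_radonOn_iff h2.isClosed] at h4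
  rw [mem_radonOn_iff k2.isClosed] at k4
  have hr1 := h4.1
  have hr2 := k4.1
  refine ⟨?_, Q ∪ R, h2.union k2, union_subset h3 k3, ?_⟩
  · have := lintegral_midpoint ν μ 1
    simp only [Pi.one_apply, lintegral_one, h1, k1, mul_one, coe_half_add_half] at this
    exact this
  · rw [mem_radonOn_iff (h2.union k2).isClosed]
    refine ⟨regular_add inferInstance inferInstance, ?_⟩
    rw [midpointMeasure, Measure.add_apply, Measure.smul_apply, Measure.smul_apply, compl_union,
      measure_mono_null inter_subset_left h4.2, measure_mono_null inter_subset_right k4.2]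
    simp

lemma KernelDecomp.toENNReal_mutualEnergy (hk : KernelDecomp κ k c) (hp : IsPositiveDefinite κ)
    {μ : Measure X} (hμ : μ ∈ finiteEnergyOn κ univ) :
    (mutualEnergy κ μ μ).toENNReal = ENNReal.ofReal (energyForm κ μ μ) := by
  rw [(hk.energyForm_eq hp hμ hμ).1, EReal.toENNReal_of_ne_top (EReal.coe_ne_top _),
    EReal.toReal_coe]

lemma KernelDecomp.energyForm_self_nonneg (hk : KernelDecomp κ k c) (hp : IsPositiveDefinite κ)
    {μ : Measure X} (hμ : μ ∈ finiteEnergyOn κ univ) : 0 ≤ energyForm κ μ μ := by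
  rw [← hk.strongDist_zero_sq hp hμ]
  positivity

lemma KernelDecomp.inv_capacity_toReal_le (hk : KernelDecomp κ k c) (hp : IsPositiveDefinite κ)
    {A : Set X} {μ : Measure X} (hμ : μ ∈ compactUnitMeasures A) (hμ' : μ ∈ finiteEnergyOn κ univ) :
    (capacity κ A)⁻¹.toReal ≤ energyForm κ μ μ := by
  have := inv_capacity_le (κ := κ) hμ
  rw [hk.toENNReal_mutualEnergy hp hμ'] at this
  exact ENNReal.toReal_le_of_le_ofReal (hk.energyForm_self_nonneg hp hμ') this

lemma KernelDecomp.exists_energyForm_lt (hk : KernelDecomp κ k c) (hp : IsPositiveDefinite κ)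
    {A : Set X} (h0 : capacity κ A ≠ 0) {δ : ℝ} (hδ : 0 < δ) :
    ∃ μ ∈ compactUnitMeasures A, μ ∈ finiteEnergyOn κ univ ∧
      energyForm κ μ μ < (capacity κ A)⁻¹.toReal + δ := by
  have hinv : (capacity κ A)⁻¹ ≠ ⊤ := ENNReal.inv_ne_top.2 h0
  have hlt : ((capacity κ A)⁻¹ + ENNReal.ofReal δ)⁻¹ < capacity κ A := by
    rw [ENNReal.inv_lt_iff_inv_lt]
    exact ENNReal.lt_add_right hinv (by simpa using hδ)
  obtain ⟨μ, hμ, h⟩ := exists_energy_lt_of_lt_capacity hlt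
  rw [inv_inv] at h
  have hμr : μ.Regular := by
    obtain ⟨-, Q, -, -, h⟩ := hμ
    exact h.1
  have htop : mutualEnergy κ μ μ ≠ ⊤ := by
    intro ht
    rw [ht] at h
    simp at h
  -- Positive definiteness against the zero measure; `toENNReal` alone would hide a negative energy.
  have hpos : 0 ≤ mutualEnergy κ μ μ := by
    have := hp.2 μ 0 hμr inferInstance
    rw [hk.mutualEnergy_eq μ 0, hk.mutualEnergy_eq 0 0] at this
    simpa [posEnergy] using this
  have hμ' : μ ∈ finiteEnergyOn κ univ :=
    ⟨⟨hμr, subset_univ _⟩, lt_of_lt_of_le (by simp) hpos, lt_top_iff_ne_top.2 htop⟩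
  refine ⟨μ, hμ, hμ', ?_⟩
  rw [hk.toENNReal_mutualEnergy hp hμ'] at h
  have h2 := (ENNReal.toReal_lt_toReal (by simp) (by simp [h0])).2 h
  rwa [ENNReal.toReal_ofReal (hk.energyForm_self_nonneg hp hμ'),
    ENNReal.toReal_add hinv (by simp), ENNReal.toReal_ofReal hδ.le] at h2

/-- For a perfect kernel, a closed set of finite capacity has compact subsets whose complements
have small capacity. -/
lemma KernelDecomp.exists_compact_capacity_sdiff_lt (hk : KernelDecomp κ k c)
    (hp : IsPositiveDefinite κ) (hperf : IsPerfect κ) {E : Set X}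
    (hcap : capacity κ E < ⊤) {ε : ℝ≥0∞} (hε : ε ≠ 0) :
    ∃ K, IsCompact K ∧ capacity κ (E \ K) < ε := by
  by_contra! hcon
  have hne : ∀ K : TopologicalSpace.Compacts X, capacity κ (E \ K) ≠ 0 := fun K h0 =>
    hε (nonpos_iff_eq_zero.1 (h0 ▸ hcon K K.isCompact))
  -- `w K = 1 / C(E \ K)` increases with `K`, and the assumed lower bound on capacities keeps it
  -- bounded.
  set w : TopologicalSpace.Compacts X → ℝ := fun K => (capacity κ (E \ K))⁻¹.toReal with hw
  have hwmono : Monotone w := fun K L hKL => ENNReal.toReal_mono (ENNReal.inv_ne_top.2 (hne L))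
    (ENNReal.inv_le_inv.2 (capacity_mono (sdiff_subset_sdiff_right hKL)))
  have hwbdd : BddAbove (range w) := by
    refine ⟨(ε⁻¹).toReal, ?_⟩
    rintro _ ⟨K, rfl⟩
    exact ENNReal.toReal_mono (ENNReal.inv_ne_top.2 hε)
      (ENNReal.inv_le_inv.2 (hcon K K.isCompact))
  have hwpos : 0 < w ⊥ := by
    refine ENNReal.toReal_pos ?_ (ENNReal.inv_ne_top.2 (hne ⊥))
    rw [ENNReal.inv_ne_zero]
    exact ((capacity_mono sdiff_subset).trans_lt hcap).ne
  -- The index is a pair because the infimum of the energy need not be attained: `n` measures how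
  -- nearly `u (K, n)` is optimal off `K`.
  have hex : ∀ p : TopologicalSpace.Compacts X × ℕ, ∃ μ ∈ compactUnitMeasures (E \ p.1),
      μ ∈ finiteEnergyOn κ univ ∧ energyForm κ μ μ < w p.1 + 1 / ((p.2 : ℝ) + 1) := fun p =>
    hk.exists_energyForm_lt hp (hne p.1) Nat.one_div_pos_of_nat
  choose u hu huE hlt using hex
  set W := ⨆ K, w K with hW
  have hcauchy : ∀ ε : ℝ, 0 < ε → ∃ s ∈ (atTop : Filter (TopologicalSpace.Compacts X × ℕ)),
      ∀ i ∈ s, ∀ j ∈ s, strongDist κ (u i) (u j) < ε := by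
    intro ε hε
    set δ := ε ^ 2 / 9 with hδ
    have hδ0 : 0 < δ := by positivity
    obtain ⟨K, hK⟩ := exists_lt_of_lt_ciSup (show W - δ < ⨆ K, w K by linarith)
    obtain ⟨n, hn⟩ := exists_nat_one_div_lt hδ0
    refine ⟨Ici (K, n), Ici_mem_atTop _, ?_⟩
    have hup : ∀ p ∈ Ici (K, n), energyForm κ (u p) (u p) < W + δ := by
      rintro p ⟨_, hp2⟩
      refine (hlt p).trans_le (add_le_add (le_ciSup hwbdd p.1) (le_trans ?_ hn.le))
      exact Nat.one_div_le_one_div hp2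
    intro p hpm q hqm
    have hsq := hk.strongDist_sq_eq_midpoint hp (huE p) (huE q)
    -- Beyond `K` both measures live on `E \ K`, and so does their midpoint; its energy is at least
    -- `w K`, close to the supremum `W`, so the parallelogram identity bounds their distance.
    have hmid := hk.inv_capacity_toReal_le hp (midpoint_mem_compactUnitMeasures
      (compactUnitMeasures_mono (sdiff_subset_sdiff_right hpm.1) (hu p))
      (compactUnitMeasures_mono (sdiff_subset_sdiff_right hqm.1) (hu q)))
      (hk.midpoint_mem hp (huE p) (huE q))
    have h1 := hup p hpm
    have h2 := hup q hqm
    have h3 : W - δ < energyForm κ (midpointMeasure (u p) (u q)) (midpointMeasure (u p) (u q)) :=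
      hK.trans_le hmid
    refine lt_of_pow_lt_pow_left₀ 2 hε.le ?_
    rw [hsq]
    have : ε ^ 2 = 9 * δ := by rw [hδ]; ring
    linarith
  obtain ⟨ν, hν, hs⟩ := hperf.exists_strongTendsto (Eventually.of_forall huE) hcauchy
  have hv := hperf.vagueTendsto (Eventually.of_forall huE) hν hs
  -- A test function is integrated to zero by `u p` as soon as `p.1` contains its support.
  have hν0 : ν = 0 := by
    have := hν.1.1
    refine eq_of_integral_eq fun φ h1 h2 => ?_
    refine tendsto_nhds_unique (hv φ h1 h2) (tendsto_const_nhds.congr' ?_)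
    filter_upwards [Ici_mem_atTop ((⟨tsupport φ, h2⟩ : TopologicalSpace.Compacts X), 0)] with p hp'
    rw [integral_zero_measure]
    obtain ⟨-, Q, hQ, hQE, hQr⟩ := hu p
    refine (integral_eq_zero_of_ae ?_).symm
    have hQ0 : ∀ᵐ x ∂(u p), x ∈ Q := ((mem_radonOn_iff hQ.isClosed).1 hQr).2
    filter_upwards [hQ0] with x hx
    by_contra hne
    exact (hQE hx).2 (hp'.1 (subset_tsupport φ hne))
  have hE := hk.tendsto_energyForm_self hp (Eventually.of_forall huE) hν hs
  rw [hν0, energyForm_zero_left] at hE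
  -- The energies stay above `w ⊥ > 0`, whereas the energy of the limit is zero.
  have : w ⊥ ≤ 0 := ge_of_tendsto' hE fun p =>
    (hwmono bot_le).trans (hk.inv_capacity_toReal_le hp (hu p) (huE p))
  linarith

/-- The restriction of `ν` to `Q`, normalized to a probability measure, competes in the definition
of the capacity, so its energy is at least 1 / C(A). -/
lemma KernelDecomp.measure_sq_le (hk : KernelDecomp κ k c) (hp : IsPositiveDefinite κ)
    {ν : Measure X} (hν : ν ∈ finiteEnergyOn κ univ) {A Q : Set X} (hA : capacity κ A ≠ ⊤)
    (hQ : IsCompact Q) (hQA : Q ⊆ A) :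
    ν Q ^ 2 ≤ capacity κ A * ENNReal.ofReal (energyForm κ (ν.restrict Q) (ν.restrict Q)) := by
  have := hν.1.1
  have hQt : ν Q ≠ ⊤ := hQ.measure_ne_top
  rcases eq_or_ne (ν Q) 0 with h0 | h0
  · simp [h0]
  have hr := hk.restrict_mem hν hQt hQ.isClosed subset_rfl
  set t : ℝ≥0 := (ν Q)⁻¹.toNNReal with ht
  have htc : (t : ℝ≥0∞) = (ν Q)⁻¹ := ENNReal.coe_toNNReal (ENNReal.inv_ne_top.2 h0)
  have hm : t • ν.restrict Q ∈ compactUnitMeasures A := by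
    refine ⟨?_, Q, hQ, hQA, (hk.smul_mem hr t).1⟩
    rw [Measure.smul_apply, Measure.restrict_apply_univ, ENNReal.smul_def, htc, smul_eq_mul,
      ENNReal.inv_mul_cancel h0 hQt]
  have hr' := mem_finiteEnergyOn_univ hr
  have h := inv_capacity_le (κ := κ) hm
  rw [hk.toENNReal_mutualEnergy hp (hk.smul_mem hr' t),
    hk.energyForm_smul_left hp hr' (hk.smul_mem hr' t), hk.energyForm_smul_right hp hr' hr',
    ENNReal.ofReal_mul (by positivity), ENNReal.ofReal_mul (by positivity),
    ENNReal.ofReal_coe_nnreal, htc] at h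
  set e := ENNReal.ofReal (energyForm κ (ν.restrict Q) (ν.restrict Q))
  have hC0 : capacity κ A ≠ 0 := by
    intro hC
    rw [hC, ENNReal.inv_zero, top_le_iff] at h
    exact ENNReal.mul_ne_top (by simpa using h0) (ENNReal.mul_ne_top (by simpa using h0)
      (by simp [e])) h
  calc ν Q ^ 2 = capacity κ A * (capacity κ A)⁻¹ * ν Q ^ 2 := by
        rw [ENNReal.mul_inv_cancel hC0 hA, one_mul]
    _ ≤ capacity κ A * ((ν Q)⁻¹ * ((ν Q)⁻¹ * e)) * ν Q ^ 2 := by gcongr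
    _ = capacity κ A * e * ((ν Q)⁻¹ * ν Q) ^ 2 := by ring
    _ = capacity κ A * e := by rw [ENNReal.inv_mul_cancel h0 hQt]; simp

/-- A measurable set without compact subsets of positive measure is null, as soon as it is
`σ`-finite through an integrable function. -/
lemma measure_eq_zero_of_forall_isCompact {ν : Measure X} [ν.Regular] {N : Set X}
    (hN : MeasurableSet N) {h : X → ℝ≥0∞} (hm : Measurable h) (hfin : ∫⁻ x, h x ∂ν ≠ ⊤)
    (hpos : ∀ x ∈ N, h x ≠ 0) (hQ : ∀ Q, IsCompact Q → Q ⊆ N → ν Q = 0) : ν N = 0 := by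
  have hsub : N ⊆ ⋃ n : ℕ, N ∩ {x | ((n : ℝ≥0∞) + 1)⁻¹ ≤ h x} := by
    intro x hx
    obtain ⟨n, hn⟩ := ENNReal.exists_inv_nat_lt (hpos x hx)
    refine mem_iUnion.2 ⟨n, hx, le_trans (ENNReal.inv_le_inv.2 le_self_add) hn.le⟩
  refine measure_mono_null hsub (measure_iUnion_null fun n => ?_)
  have hmeas : MeasurableSet (N ∩ {x | ((n : ℝ≥0∞) + 1)⁻¹ ≤ h x}) :=
    hN.inter (measurableSet_le measurable_const hm)
  have hlt : ν (N ∩ {x | ((n : ℝ≥0∞) + 1)⁻¹ ≤ h x}) ≠ ⊤ :=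
    ne_top_of_le_ne_top (meas_ge_le_lintegral_div hm.aemeasurable (by simp) (by simp) |>.trans_lt
      (ENNReal.div_lt_top hfin (by simp))).ne (measure_mono inter_subset_right)
  by_contra hne
  obtain ⟨Q, hQN, hQc, hlt'⟩ := hmeas.exists_lt_isCompact_of_ne_top hlt (pos_iff_ne_zero.2 hne)
  exact hlt'.ne' (hQ Q hQc (hQN.trans inter_subset_left))

/-- Interior capacity only controls compact subsets. The integrable function `h`, positive on `N`,
gives the σ-finiteness that lets inner regularity reach `N` itself. -/
lemma KernelDecomp.measure_eq_zero_of_capacity_eq_zero (hk : KernelDecomp κ k c)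
    (hp : IsPositiveDefinite κ) {ν : Measure X} (hν : ν ∈ finiteEnergyOn κ univ) {N : Set X}
    (hN : MeasurableSet N) (hcap : capacity κ N = 0) {h : X → ℝ≥0∞} (hm : Measurable h)
    (hfin : ∫⁻ x, h x ∂ν ≠ ⊤) (hpos : ∀ x ∈ N, h x ≠ 0) : ν N = 0 := by
  have := hν.1.1
  refine measure_eq_zero_of_forall_isCompact hN hm hfin hpos fun Q hQ hQN => ?_
  have := hk.measure_sq_le hp hν (by simp [hcap]) hQ hQN
  simpa [hcap] using this

end Capacity

/-! ### Tightness of the weighted masses. -/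

section Weight

variable {X : Type*} [TopologicalSpace X] [T2Space X] [LocallyCompactSpace X]
  [MeasurableSpace X] [BorelSpace X] {κ : X × X → EReal} {k : X × X → ℝ≥0∞} {c : ℝ≥0}
  {g : X → ℝ} {U E : Set X}

/-- Nothing is known about `g` outside `U`. Its truncation is measurable and coincides with `g`
almost everywhere for any measure carried by a closed `E ⊆ U`. -/
lemma measurable_indicator_weight (hU : IsOpen U) (hg : ContinuousOn g U) :
    Measurable (U.indicator g) := by
  classical
  have := hg.measurable_piecewise (g := fun _ => (0 : ℝ)) continuousOn_const hU.measurableSet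
  rwa [show U.piecewise g (fun _ => 0) = U.indicator g from piecewise_eq_indicator] at this

lemma ae_indicator_weight_eq (hE : IsClosed E) (hEU : E ⊆ U) {ν : Measure X}
    (hν : ν ∈ radonOn E) : ∀ᵐ x ∂ν, U.indicator g x = g x := by
  have : ∀ᵐ x ∂ν, x ∈ E := ((mem_radonOn_iff hE).1 hν).2
  exact this.mono fun x hx => indicator_of_mem (hEU hx) _

lemma lintegral_indicator_weight (hE : IsClosed E) (hEU : E ⊆ U) {ν : Measure X}
    (hν : ν ∈ radonOn E) :
    ∫⁻ x, ENNReal.ofReal (U.indicator g x) ∂ν = ∫⁻ x, ENNReal.ofReal (g x) ∂ν :=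
  lintegral_congr_ae ((ae_indicator_weight_eq (g := g) hE hEU hν).mono fun x hx => by simp only [hx])

/-- Compact subsets of E \ K have squared measure at most C(E \ K) · M, and C(E \ K) can be made
small. With `c = 0` the kernel is nonnegative, so restricting a measure does not increase its
energy. -/
lemma KernelDecomp.exists_compact_measure_compl_le (hk : KernelDecomp κ k 0)
    (hp : IsPositiveDefinite κ) (hperf : IsPerfect κ) (hE : IsClosed E) (hcap : capacity κ E < ⊤)
    (M : ℝ) {δ : ℝ≥0∞} (hδ : δ ≠ 0) :
    ∃ K, IsCompact K ∧ K ⊆ E ∧ ∀ ν ∈ finiteEnergyOn κ E, energyForm κ ν ν ≤ M → ν Kᶜ ≤ δ := by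
  have hη : δ ^ 2 / (ENNReal.ofReal M + 1) ≠ 0 :=
    (ENNReal.div_pos (pow_ne_zero 2 hδ) (by simp)).ne'
  obtain ⟨K, hK, hKlt⟩ := hk.exists_compact_capacity_sdiff_lt hp hperf hcap hη
  refine ⟨K ∩ E, hK.inter_right hE, inter_subset_right, fun ν hν hM => ?_⟩
  have := hν.1.1
  have hν' := mem_finiteEnergyOn_univ hν
  rw [(hK.inter_right hE).isClosed.isOpen_compl.measure_eq_iSup_isCompact ν]
  refine iSup₂_le fun Q hQK => iSup_le fun hQ => ?_
  have hQE : IsCompact (Q ∩ E) := hQ.inter_right hE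
  have h1 : ν Q = ν (Q ∩ E) :=
    (measure_inter_conull (((mem_radonOn_iff hE).1 hν.1).2)).symm
  have hsub : Q ∩ E ⊆ E \ K := fun x hx => ⟨hx.2, fun hxK => hQK hx.1 ⟨hxK, hx.2⟩⟩
  have h2 := hk.measure_sq_le hp hν' ((capacity_mono sdiff_subset).trans_lt hcap).ne hQE hsub
  have hr := mem_finiteEnergyOn_univ
    (hk.restrict_mem hν' hQE.measure_ne_top hQE.isClosed subset_rfl)
  have h3 : energyForm κ (ν.restrict (Q ∩ E)) (ν.restrict (Q ∩ E)) ≤ M := by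
    refine le_trans ?_ hM
    rw [(hk.energyForm_eq hp hr hr).2, (hk.energyForm_eq hp hν' hν').2]
    simpa using ENNReal.toReal_mono (hk.posEnergy_ne_top hp hν' hν')
      (posEnergy_mono Measure.restrict_le_self Measure.restrict_le_self)
  rw [h1, ← ENNReal.pow_le_pow_left_iff two_ne_zero]
  calc ν (Q ∩ E) ^ 2 ≤ _ := h2
    _ ≤ δ ^ 2 / (ENNReal.ofReal M + 1) * (ENNReal.ofReal M + 1) :=
        mul_le_mul' hKlt.le ((ENNReal.ofReal_le_ofReal h3).trans le_self_add)
    _ ≤ δ ^ 2 := by rw [mul_comm]; exact ENNReal.mul_div_le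

/-- The weighted masses of the measures of bounded energy on a closed set of finite capacity are
uniformly tight. -/
lemma KernelDecomp.exists_compact_weight_compl_le (hk : KernelDecomp κ k c)
    (hp : IsPositiveDefinite κ) (hperf : IsPerfect κ) (hE : IsClosed E) (hEU : E ⊆ U)
    (hU : IsOpen U) (hg_pos : ∀ x ∈ U, 0 < g x) (hg_cont : ContinuousOn g U)
    (hcap : capacity κ E < ⊤)
    (hg : (∃ M : ℝ, ∀ x ∈ U, g x ≤ M) ∨
      ∃ (r : ℝ) (ω : SignedRadon X), 1 < r ∧ ω.FiniteEnergy κ ∧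
        NearlyEverywhereOn κ U (fun x => ((g x ^ r : ℝ) : EReal) ≤ ω.potential κ x))
    (M : ℝ) {ε : ℝ≥0∞} (hε : ε ≠ 0) (hεt : ε ≠ ⊤) :
    ∃ K, IsCompact K ∧ K ⊆ E ∧ ∀ ν ∈ finiteEnergyOn κ E, energyForm κ ν ν ≤ M →
      ∫⁻ x, ENNReal.ofReal (g x) ∂ν ≠ ⊤ → ∫⁻ x in Kᶜ, ENNReal.ofReal (g x) ∂ν ≤ ε := by
  rcases hk.compact with rfl | hc
  swap
  · refine ⟨E, hE.isCompact, subset_rfl, fun ν hν _ _ => ?_⟩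
    rw [setLIntegral_measure_zero _ _ ((mem_radonOn_iff hE).1 hν.1).2]
    exact zero_le
  rcases hg with ⟨B, hB⟩ | ⟨r, ω, hr, hω, hne⟩
  · obtain ⟨K, hK, hKE, h⟩ := hk.exists_compact_measure_compl_le hp hperf hE hcap M
      (δ := ε / (ENNReal.ofReal B + 1)) (ENNReal.div_pos hε (by simp)).ne'
    refine ⟨K, hK, hKE, fun ν hν hM _ => ?_⟩
    have hνE : ∀ᵐ x ∂ν, x ∈ E := ((mem_radonOn_iff hE).1 hν.1).2
    calc ∫⁻ x in Kᶜ, ENNReal.ofReal (g x) ∂ν ≤ ∫⁻ _ in Kᶜ, (ENNReal.ofReal B + 1) ∂ν := by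
          refine lintegral_mono_ae ((ae_restrict_of_ae hνE).mono fun x hx => ?_)
          exact (ENNReal.ofReal_le_ofReal (hB x (hEU hx))).trans le_self_add
      _ = (ENNReal.ofReal B + 1) * ν Kᶜ := setLIntegral_const _ _
      _ ≤ (ENNReal.ofReal B + 1) * (ε / (ENNReal.ofReal B + 1)) := by gcongr; exact h ν hν hM
      _ ≤ ε := ENNReal.mul_div_le
  · have hconj := Real.HolderConjugate.conjExponent hr
    set q := r.conjExponent
    -- From ∫ g^r dν ≤ κ(ω⁺, ν) ≤ (‖ω⁺‖² + ‖ν‖²) / 2. The exponent `q` in `hδ` is chosen so that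
    -- Hölder's inequality leaves a product below `ε`.
    set T : ℝ≥0∞ := ENNReal.ofReal ((energyForm κ ω.pos ω.pos + M) / 2) with hT
    have hTr : T ^ (1 / r) ≠ ⊤ :=
      ENNReal.rpow_ne_top_of_nonneg (by have := hconj.pos; positivity) (by simp [hT])
    have hδ : (ε / (T ^ (1 / r) + 1)) ^ q ≠ 0 := by
      refine (ENNReal.rpow_pos (ENNReal.div_pos hε (by simpa using hTr)) ?_).ne'
      exact ENNReal.div_ne_top hεt (by simp)
    obtain ⟨K, hK, hKE, h⟩ := hk.exists_compact_measure_compl_le hp hperf hE hcap M hδ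
    refine ⟨K, hK, hKE, fun ν hν hM hfin => ?_⟩
    have := hν.1.1
    have := hω.1.1.1
    have hν' := mem_finiteEnergyOn_univ hν
    have hae := ae_indicator_weight_eq (g := g) hE hEU hν.1
    have hmeas := (measurable_indicator_weight hU hg_cont).ennreal_ofReal
    have hmeas' : AEMeasurable (fun x => ENNReal.ofReal (g x)) ν :=
      ⟨_, hmeas, hae.mono fun x hx => by simp only [hx]⟩
    have hνE : ∀ᵐ x ∂ν, x ∈ E := ((mem_radonOn_iff hE).1 hν.1).2
    have hpt : ∀ᵐ x ∂ν, ENNReal.ofReal (g x) ^ r ≤ ∫⁻ y, k (x, y) ∂ω.pos := by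
      -- A measurable part of the exceptional set: for a nonnegative kernel the potential of `ω.pos`
      -- dominates that of `ω`, so failure for the former implies failure for the latter.
      set N : Set X := U ∩ {x | ENNReal.ofReal (U.indicator g x) ^ r ≤ ∫⁻ y, k (x, y) ∂ω.pos}ᶜ
        with hN
      have hNm : MeasurableSet N := hU.measurableSet.inter
        (measurableSet_le (hmeas.pow_const r) (hk.measurable_fiber ω.pos)).compl
      have hNsub : N ⊆ {x | x ∈ U ∧ ¬ ((g x ^ r : ℝ) : EReal) ≤ ω.potential κ x} := by
        rintro x ⟨hxU, hx⟩
        refine ⟨hxU, fun hle => hx ?_⟩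
        have := hω.2.1.1
        rw [SignedRadon.potential, hk.potential_eq ω.pos, hk.potential_eq ω.neg] at hle
        simp only [ENNReal.coe_zero, zero_mul, EReal.coe_ennreal_zero, sub_zero] at hle
        have h2 := hle.trans (EReal.sub_le_sub le_rfl (EReal.coe_ennreal_nonneg _))
        rw [sub_zero] at h2
        have h3 := EReal.toENNReal_le_toENNReal h2
        rw [EReal.toENNReal_of_ne_top (EReal.coe_ne_top _), EReal.toReal_coe,
          EReal.toENNReal_coe] at h3
        rw [mem_ofPred_eq, indicator_of_mem hxU, ENNReal.ofReal_rpow_of_pos (hg_pos x hxU)]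
        exact h3
      have hN0 : ν N = 0 := by
        refine hk.measure_eq_zero_of_capacity_eq_zero hp hν' hNm
          (nonpos_iff_eq_zero.1 ((capacity_mono hNsub).trans hne.le)) hmeas ?_ ?_
        · rwa [lintegral_indicator_weight hE hEU hν.1]
        · rintro x ⟨hxU, -⟩
          rw [indicator_of_mem hxU]
          simpa using hg_pos x hxU
      have hN1 : ∀ᵐ x ∂ν, x ∉ N := measure_eq_zero_iff_ae_notMem.1 hN0
      filter_upwards [hN1, hνE] with x hx hxE
      by_contra hcon
      refine hx ⟨hEU hxE, ?_⟩
      rw [mem_compl_iff, mem_ofPred_eq, indicator_of_mem (hEU hxE)]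
      exact hcon
    have hT' : ∫⁻ x, ENNReal.ofReal (g x) ^ r ∂ν ≤ T := by
      refine (lintegral_mono_ae hpt).trans ?_
      have h1 := (hk.energyForm_eq hp hω.1 hν').2
      have h2 := hk.energyForm_sub_nonneg hp hω.1 hν'
      have h3 := hk.posEnergy_ne_top hp hω.1 hν'
      change posEnergy k ω.pos ν ≤ T
      rw [hT, ENNReal.le_ofReal_iff_toReal_le h3]
      · simp only [ENNReal.coe_zero, zero_mul, ENNReal.toReal_zero, sub_zero] at h1
        linarith
      · have := hk.energyForm_self_nonneg hp hω.1
        have := hk.energyForm_self_nonneg hp hν'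
        linarith
    calc ∫⁻ x in Kᶜ, ENNReal.ofReal (g x) ∂ν
        = ∫⁻ x in Kᶜ, ((fun x => ENNReal.ofReal (g x)) * fun _ => (1 : ℝ≥0∞) : X → ℝ≥0∞) x ∂ν := by
          simp
      _ ≤ (∫⁻ x in Kᶜ, ENNReal.ofReal (g x) ^ r ∂ν) ^ (1 / r) *
          (∫⁻ x in Kᶜ, 1 ^ q ∂ν) ^ (1 / q) :=
          ENNReal.lintegral_mul_le_Lp_mul_Lq _ hconj hmeas'.restrict aemeasurable_const
      _ ≤ T ^ (1 / r) * ((ε / (T ^ (1 / r) + 1)) ^ q) ^ (1 / q) := by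
          have := hconj.pos
          have := hconj.symm.pos
          gcongr
          · exact (setLIntegral_le_lintegral _ _).trans hT'
          · simpa using h ν hν hM
      _ = T ^ (1 / r) * (ε / (T ^ (1 / r) + 1)) := by
          rw [← ENNReal.rpow_mul, mul_one_div_cancel hconj.symm.ne_zero, ENNReal.rpow_one]
      _ ≤ (T ^ (1 / r) + 1) * (ε / (T ^ (1 / r) + 1)) := by gcongr; exact le_self_add
      _ ≤ ε := ENNReal.mul_div_le

end Weight

/-! ### External fields and convexity of the weighted energy. -/

section Field

variable {X : Type*} [TopologicalSpace X] [T2Space X] [LocallyCompactSpace X]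
  [MeasurableSpace X] [BorelSpace X] {κ : X × X → EReal} {k : X × X → ℝ≥0∞} {c : ℝ≥0}
  {f : X → EReal} {g : X → ℝ} {U : Set X} {h₁ h₂ : X → ℝ≥0∞}

/-- The real value of the weighted energy, for a field of the form `h₁ - h₂`. -/
noncomputable def realWeightedEnergy (κ : X × X → EReal) (h₁ h₂ : X → ℝ≥0∞) (ν : Measure X) : ℝ :=
  energyForm κ ν ν + 2 * ((∫⁻ x, h₁ x ∂ν).toReal - (∫⁻ x, h₂ x ∂ν).toReal)

/-- A representation `f = h₁ - h₂` of an external field, valid almost everywhere for all measures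
of finite energy, with `h₁` lower semicontinuous and `h₂` strongly continuous. -/
structure FieldDecomp (κ : X × X → EReal) (f : X → EReal) (g : X → ℝ) (U : Set X)
    (h₁ h₂ : X → ℝ≥0∞) : Prop where
  lsc : LowerSemicontinuous h₁
  meas : Measurable h₂
  ae_eq : ∀ ν ∈ finiteEnergyOn κ univ, ∀ᵐ x ∂ν, f x = (h₁ x : EReal) - (h₂ x : EReal)
  fin : ∀ ν ∈ finiteEnergyOn κ univ, ∫⁻ x, h₂ x ∂ν ≠ ⊤
  tendsto : ∀ F : Filter (Measure X), finiteEnergyOn κ univ ∈ F → ∀ ν ∈ finiteEnergyOn κ univ,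
    StrongTendsto κ id F ν → Tendsto (fun μ => ∫⁻ x, h₂ x ∂μ) F (𝓝 (∫⁻ x, h₂ x ∂ν))
  lower : ∀ E, IsClosed E → E ⊆ U → ∃ b : ℝ, ∀ ν ∈ finiteEnergyOn κ E,
    ∫⁻ x, ENNReal.ofReal (g x) ∂ν = 1 → ∫⁻ x, h₁ x ∂ν ≠ ⊤ → b ≤ realWeightedEnergy κ h₁ h₂ ν

/-- On a compact space the constant 1 is a test function, so total masses converge vaguely;
otherwise the constant is 0 and there is nothing to control. -/
lemma tendsto_const_mul_measure_univ {a : ℝ≥0∞} (ha : a ≠ ⊤) (hc : a = 0 ∨ CompactSpace X)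
    {ι : Type*} {l : Filter ι} {u : ι → Measure X} {ν : Measure X} (hν : ν.Regular)
    (hu : ∀ᶠ i in l, (u i).Regular) (h : VagueTendsto u l ν) :
    Tendsto (fun i => a * u i univ) l (𝓝 (a * ν univ)) := by
  rcases hc with rfl | hc
  · simpa using tendsto_const_nhds
  · refine ENNReal.Tendsto.const_mul ?_ (Or.inr ha)
    have h1 := h (fun _ => 1) continuous_const (HasCompactSupport.of_compactSpace _)
    have h2 := (ENNReal.continuous_ofReal.tendsto _).comp h1
    have e : ∀ μ : Measure X, μ.Regular → ENNReal.ofReal (∫ _, (1 : ℝ) ∂μ) = μ univ := by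
      intro μ hμ
      simp [measureReal_def]
    rw [e ν hν] at h2
    exact h2.congr' (hu.mono fun i hi => e _ hi)

lemma KernelDecomp.tendsto_posEnergy (hk : KernelDecomp κ k c) (hp : IsPositiveDefinite κ)
    (hperf : IsPerfect κ) {ι : Type*} {l : Filter ι} {u : ι → Measure X} {ν ζ : Measure X}
    (hu : ∀ᶠ i in l, u i ∈ finiteEnergyOn κ univ) (hν : ν ∈ finiteEnergyOn κ univ)
    (hζ : ζ ∈ finiteEnergyOn κ univ) (h : StrongTendsto κ u l ν) :
    Tendsto (fun i => posEnergy k ζ (u i)) l (𝓝 (posEnergy k ζ ν)) := by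
  have := hζ.1.1
  have := hν.1.1
  have hm := tendsto_const_mul_measure_univ (hk.const_mul_ne_top ζ)
    (hk.compact.imp_left fun h => by simp [h]) hν.1.1 (hu.mono fun i hi => hi.1.1)
    (hperf.vagueTendsto hu hν h)
  have hm' := (ENNReal.tendsto_toReal (hk.const_mul_mul_ne_top ζ ν)).comp hm
  have h1 := (ENNReal.continuous_ofReal.tendsto _).comp
    ((hk.tendsto_energyForm_right hp hu hν hζ h).add hm')
  have e : ∀ μ ∈ finiteEnergyOn κ univ, ENNReal.ofReal (energyForm κ ζ μ +
      ((c : ℝ≥0∞) * ζ univ * μ univ).toReal) = posEnergy k ζ μ := by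
    intro μ hμ
    rw [(hk.energyForm_eq hp hζ hμ).2, sub_add_cancel,
      ENNReal.ofReal_toReal (hk.posEnergy_ne_top hp hζ hμ)]
  rw [e ν hν] at h1
  exact h1.congr' (hu.mono fun i hi => e _ hi)

/-- For a field bounded below by a nonzero constant, X is compact and `g` has a positive minimum on
`E`. Then ⟨g, ν⟩ = 1 bounds the total mass, hence the negative part of the weighted energy. -/
lemma IsPhi.exists_fieldDecomp (hk : KernelDecomp κ k c) (hp : IsPositiveDefinite κ)
    (hperf : IsPerfect κ) (hg_pos : ∀ x ∈ U, 0 < g x) (hg_cont : ContinuousOn g U)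
    (hf : IsPhi f) : ∃ h₁ h₂, FieldDecomp κ f g U h₁ h₂ := by
  obtain ⟨h, a, hl, ha, heq⟩ := hf.exists_eq_sub
  have hfin : ∀ ν ∈ finiteEnergyOn κ univ, (a : ℝ≥0∞) * ν univ ≠ ⊤ := by
    intro ν hν
    have := hν.1.1
    rcases ha with rfl | ha
    · simp
    · exact ENNReal.mul_ne_top (by simp) (measure_ne_top ν univ)
  refine ⟨h, fun _ => a, hl, measurable_const, fun ν _ => Eventually.of_forall heq,
    fun ν hν => by rw [lintegral_const]; exact hfin ν hν, fun F hF ν hν hs => ?_,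
    fun E hE hEU => ?_⟩
  · simp_rw [lintegral_const]
    exact tendsto_const_mul_measure_univ (by simp) (ha.imp_left fun h => by simp [h]) hν.1.1
      (Filter.mem_of_superset hF fun μ hμ => hμ.1.1) (hperf.vagueTendsto (u := id) hF hν hs)
  · obtain ⟨d, hd⟩ : ∃ d : ℝ≥0, ∀ ν ∈ finiteEnergyOn κ E, ∫⁻ x, ENNReal.ofReal (g x) ∂ν = 1 →
        (a : ℝ≥0∞) * ν univ ≤ d := by
      rcases ha with rfl | ha
      · exact ⟨0, fun ν _ _ => by simp⟩
      rcases E.eq_empty_or_nonempty with rfl | hne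
      · refine ⟨0, fun ν hν h1 => ?_⟩
        have := ((mem_radonOn_iff isClosed_empty).1 hν.1).2
        rw [compl_empty, Measure.measure_univ_eq_zero] at this
        simp [this] at h1
      obtain ⟨x₀, hx₀, hmin⟩ := hE.isCompact.exists_isMinOn hne (hg_cont.mono hEU)
      have hg0 : 0 < g x₀ := hg_pos x₀ (hEU hx₀)
      refine ⟨a * (g x₀)⁻¹.toNNReal, fun ν hν h1 => ?_⟩
      have hνE : ∀ᵐ x ∂ν, x ∈ E := ((mem_radonOn_iff hE).1 hν.1).2
      have h2 : ENNReal.ofReal (g x₀) * ν univ ≤ 1 := by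
        rw [← h1, ← lintegral_const]
        exact lintegral_mono_ae (hνE.mono fun x hx => ENNReal.ofReal_le_ofReal (hmin hx))
      have h3 : ν univ ≤ (ENNReal.ofReal (g x₀))⁻¹ := by
        rwa [ENNReal.le_inv_iff_mul_le, mul_comm]
      rw [ENNReal.coe_mul]
      gcongr
      rwa [← ENNReal.ofReal_inv_of_pos hg0] at h3
    refine ⟨-(2 * d), fun ν hν h1 _ => ?_⟩
    have hB := hk.energyForm_self_nonneg hp (mem_finiteEnergyOn_univ hν)
    have hN : (∫⁻ _, (a : ℝ≥0∞) ∂ν).toReal ≤ d := by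
      rw [lintegral_const]
      exact ENNReal.toReal_le_coe_of_le_coe (hd ν hν h1)
    have hH : 0 ≤ (∫⁻ x, h x ∂ν).toReal := ENNReal.toReal_nonneg
    rw [realWeightedEnergy]
    linarith

/-- The two parts of `ζ` have finite mutual energy with every ν of finite energy, so their
potentials are ν-almost everywhere finite. The lower bound is a completed square: G(ν) = ‖ν + ζ‖² -
‖ζ‖². -/
lemma SignedRadon.FiniteEnergy.exists_fieldDecomp (hk : KernelDecomp κ k c)
    (hp : IsPositiveDefinite κ) (hperf : IsPerfect κ) {ζ : SignedRadon X} (hζ : ζ.FiniteEnergy κ)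
    (hf : ∀ x, ζ.PotentialDefinedAt κ x → f x = ζ.potential κ x) :
    ∃ h₁ h₂, FieldDecomp κ f g U h₁ h₂ := by
  have hrp := hζ.1.1.1
  have hrn := hζ.2.1.1
  have hA := hk.const_mul_ne_top ζ.pos
  have hB := hk.const_mul_ne_top ζ.neg
  have hmp := hk.measurable_fiber ζ.pos
  have hmn := hk.measurable_fiber ζ.neg
  have hint : ∀ (ξ : Measure X) [ξ.Regular] (a : ℝ≥0∞) (μ : Measure X),
      ∫⁻ x, (∫⁻ y, k (x, y) ∂ξ + a) ∂μ = posEnergy k ξ μ + a * μ univ := by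
    intro ξ _ a μ
    rw [lintegral_add_left (hk.measurable_fiber ξ), lintegral_const]
    rfl
  refine ⟨fun x => ∫⁻ y, k (x, y) ∂ζ.pos + c * ζ.neg univ,
    fun x => ∫⁻ y, k (x, y) ∂ζ.neg + c * ζ.pos univ, ?_, hmn.add_const _, ?_, ?_, ?_, ?_⟩
  · exact (lowerSemicontinuous_lintegral_fiber hk.lsc ζ.pos).add lowerSemicontinuous_const
  · intro ν hν
    have := hν.1.1
    filter_upwards [ae_lt_top hmp (hk.posEnergy_ne_top hp hζ.1 hν),
      ae_lt_top hmn (hk.posEnergy_ne_top hp hζ.2 hν)] with x h1 h2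
    have hx : ζ.PotentialDefinedAt κ x := by
      left
      rw [hk.potential_eq]
      lift ∫⁻ y, k (x, y) ∂ζ.pos to ℝ≥0 using h1.ne with P
      lift (c : ℝ≥0∞) * ζ.pos univ to ℝ≥0 using hA with A
      simp only [EReal.coe_nnreal_eq_coe_real, ← EReal.coe_sub]
      exact EReal.coe_ne_top _
    rw [hf x hx, SignedRadon.potential, hk.potential_eq, hk.potential_eq]
    lift ∫⁻ y, k (x, y) ∂ζ.pos to ℝ≥0 using h1.ne with P
    lift (c : ℝ≥0∞) * ζ.pos univ to ℝ≥0 using hA with A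
    lift ∫⁻ y, k (x, y) ∂ζ.neg to ℝ≥0 using h2.ne with Q
    lift (c : ℝ≥0∞) * ζ.neg univ to ℝ≥0 using hB with B
    simp only [← ENNReal.coe_add, EReal.coe_nnreal_eq_coe_real, ← EReal.coe_sub]
    congr 1
    push_cast
    ring
  · intro ν hν
    have := hν.1.1
    rw [hint]
    exact ENNReal.add_ne_top.2 ⟨hk.posEnergy_ne_top hp hζ.2 hν, hk.const_mul_mul_ne_top ζ.pos ν⟩
  · intro F hF ν hν hs
    simp_rw [hint]
    exact (hk.tendsto_posEnergy hp hperf (u := id) hF hν hζ.2 hs).add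
      (tendsto_const_mul_measure_univ hA (hk.compact.imp_left fun h => by simp [h]) hν.1.1
        (Filter.mem_of_superset hF fun μ hμ => hμ.1.1) (hperf.vagueTendsto (u := id) hF hν hs))
  · intro E hE _
    refine ⟨-(energyForm κ ζ.pos ζ.pos + energyForm κ ζ.neg ζ.neg -
      2 * energyForm κ ζ.pos ζ.neg), fun ν hνE _ _ => ?_⟩
    have hν := mem_finiteEnergyOn_univ hνE
    have := hν.1.1
    have hsum := hk.add_mem hp hν hζ.1
    have h0 := hk.energyForm_sub_nonneg hp hsum hζ.2
    rw [hk.energyForm_add_left hp hν hζ.1 hsum, hk.energyForm_add_left hp hν hζ.1 hζ.2,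
      hk.energyForm_add_right hp hν hν hζ.1, hk.energyForm_add_right hp hζ.1 hν hζ.1,
      hk.energyForm_comm hp hν hζ.1, hk.energyForm_comm hp hν hζ.2] at h0
    rw [realWeightedEnergy, hint, hint,
      ENNReal.toReal_add (hk.posEnergy_ne_top hp hζ.1 hν) (hk.const_mul_mul_ne_top ζ.neg ν),
      ENNReal.toReal_add (hk.posEnergy_ne_top hp hζ.2 hν) (hk.const_mul_mul_ne_top ζ.pos ν)]
    have h1 := (hk.energyForm_eq hp hζ.1 hν).2
    have h2 := (hk.energyForm_eq hp hζ.2 hν).2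
    linarith

lemma IsExternalField.exists_fieldDecomp (hk : KernelDecomp κ k c)
    (hp : IsPositiveDefinite κ) (hperf : IsPerfect κ) (hg_pos : ∀ x ∈ U, 0 < g x)
    (hg_cont : ContinuousOn g U) (hf : IsExternalField κ f) :
    ∃ h₁ h₂, FieldDecomp κ f g U h₁ h₂ := by
  rcases hf with hf | ⟨ζ, hζ, hf⟩
  · exact hf.exists_fieldDecomp hk hp hperf hg_pos hg_cont
  · exact hζ.exists_fieldDecomp hk hp hperf hf

/-- The measures of finite energy with finite weighted energy. -/
def finiteWeighted (κ : X × X → EReal) (h₁ : X → ℝ≥0∞) : Set (Measure X) :=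
  {ν | ν ∈ finiteEnergyOn κ univ ∧ ∫⁻ x, h₁ x ∂ν ≠ ⊤}

lemma FieldDecomp.weightedEnergy_eq (hF : FieldDecomp κ f g U h₁ h₂) (hk : KernelDecomp κ k c)
    (hp : IsPositiveDefinite κ) {ν : Measure X} (hν : ν ∈ finiteWeighted κ h₁) :
    weightedEnergy κ f ν = (realWeightedEnergy κ h₁ h₂ ν : EReal) := by
  obtain ⟨hν, h1⟩ := hν
  have h2 := hF.fin ν hν
  rw [weightedEnergy, (hk.energyForm_eq hp hν hν).1,
    eint_eq_sub hF.lsc.measurable hF.meas (hF.ae_eq ν hν) h2, realWeightedEnergy]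
  lift ∫⁻ x, h₁ x ∂ν to ℝ≥0 using h1 with a
  lift ∫⁻ x, h₂ x ∂ν to ℝ≥0 using h2 with b
  simp only [EReal.coe_nnreal_eq_coe_real, ENNReal.coe_toReal]
  rfl

lemma FieldDecomp.mem_finiteWeighted (hF : FieldDecomp κ f g U h₁ h₂) (hk : KernelDecomp κ k c)
    (hp : IsPositiveDefinite κ) {ν : Measure X} (hν : ν ∈ finiteEnergyOn κ univ)
    (h : weightedEnergy κ f ν < ⊤) : ν ∈ finiteWeighted κ h₁ := by
  refine ⟨hν, fun h1 => ?_⟩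
  have h2 := hF.fin ν hν
  rw [weightedEnergy, (hk.energyForm_eq hp hν hν).1,
    eint_eq_sub hF.lsc.measurable hF.meas (hF.ae_eq ν hν) h2, h1] at h
  lift ∫⁻ x, h₂ x ∂ν to ℝ≥0 using h2 with b
  rw [EReal.coe_nnreal_eq_coe_real, EReal.coe_ennreal_top, EReal.top_sub_coe,
    EReal.mul_top_of_pos (by norm_num), EReal.coe_add_top] at h
  exact h.ne rfl

lemma lintegral_combo (s t : ℝ≥0) (ν μ : Measure X) (h : X → ℝ≥0∞) :
    ∫⁻ x, h x ∂(s • ν + t • μ) = s * ∫⁻ x, h x ∂ν + t * ∫⁻ x, h x ∂μ := by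
  rw [lintegral_add_measure, lintegral_smul_measure, lintegral_smul_measure]
  rfl

lemma KernelDecomp.combo_mem (hk : KernelDecomp κ k c) (hp : IsPositiveDefinite κ)
    {ν μ : Measure X} (hν : ν ∈ finiteWeighted κ h₁) (hμ : μ ∈ finiteWeighted κ h₁) (s t : ℝ≥0) :
    s • ν + t • μ ∈ finiteWeighted κ h₁ := by
  refine ⟨hk.add_mem hp (hk.smul_mem hν.1 s) (hk.smul_mem hμ.1 t), ?_⟩
  rw [lintegral_combo]
  exact ENNReal.add_ne_top.2 ⟨ENNReal.mul_ne_top (by simp) hν.2, ENNReal.mul_ne_top (by simp) hμ.2⟩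

lemma FieldDecomp.realWeightedEnergy_combo (hF : FieldDecomp κ f g U h₁ h₂)
    (hk : KernelDecomp κ k c) (hp : IsPositiveDefinite κ)
    {ν μ : Measure X} (hν : ν ∈ finiteWeighted κ h₁) (hμ : μ ∈ finiteWeighted κ h₁) {s t : ℝ≥0}
    (hst : s + t = 1) :
    realWeightedEnergy κ h₁ h₂ (s • ν + t • μ) = s * realWeightedEnergy κ h₁ h₂ ν +
      t * realWeightedEnergy κ h₁ h₂ μ - s * t * strongDist κ ν μ ^ 2 := by
  have hst' : (s : ℝ) = 1 - t := by
    rw [eq_sub_iff_add_eq]; exact_mod_cast hst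
  have key : ∀ h : X → ℝ≥0∞, ∫⁻ x, h x ∂ν ≠ ⊤ → ∫⁻ x, h x ∂μ ≠ ⊤ →
      (∫⁻ x, h x ∂(s • ν + t • μ)).toReal =
        s * (∫⁻ x, h x ∂ν).toReal + t * (∫⁻ x, h x ∂μ).toReal := by
    intro h h1 h2
    rw [lintegral_combo, ENNReal.toReal_add (ENNReal.mul_ne_top (by simp) h1)
      (ENNReal.mul_ne_top (by simp) h2)]
    simp
  rw [realWeightedEnergy, realWeightedEnergy, realWeightedEnergy, key h₁ hν.2 hμ.2,
    key h₂ (hF.fin ν hν.1) (hF.fin μ hμ.1), hk.energyForm_combo hp hν.1 hμ.1,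
    hk.strongDist_sq hp hν.1 hμ.1, hst']
  ring

/-- The field contributes linearly, so it cancels and the parallelogram identity of the energy
survives unchanged. -/
lemma FieldDecomp.strongDist_sq_eq (hF : FieldDecomp κ f g U h₁ h₂)
    (hk : KernelDecomp κ k c) (hp : IsPositiveDefinite κ)
    {ν μ : Measure X} (hν : ν ∈ finiteWeighted κ h₁) (hμ : μ ∈ finiteWeighted κ h₁) :
    strongDist κ ν μ ^ 2 = 2 * realWeightedEnergy κ h₁ h₂ ν + 2 * realWeightedEnergy κ h₁ h₂ μ -
      4 * realWeightedEnergy κ h₁ h₂ (midpointMeasure ν μ) := by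
  rw [midpointMeasure, hF.realWeightedEnergy_combo hk hp hν hμ (add_halves 1)]
  push_cast
  ring

/-- Strong lower semicontinuity of the weighted energy. -/
lemma FieldDecomp.realWeightedEnergy_le (hF : FieldDecomp κ f g U h₁ h₂)
    (hk : KernelDecomp κ k c) (hp : IsPositiveDefinite κ) (hperf : IsPerfect κ)
    {ι : Type*} {l : Filter ι} [l.NeBot] {u : ι → Measure X} {ν : Measure X} {b : ℝ}
    (hu : ∀ᶠ i in l, u i ∈ finiteWeighted κ h₁ ∧ realWeightedEnergy κ h₁ h₂ (u i) ≤ b)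
    (hν : ν ∈ finiteEnergyOn κ univ) (hs : StrongTendsto κ u l ν) :
    ν ∈ finiteWeighted κ h₁ ∧ realWeightedEnergy κ h₁ h₂ ν ≤ b := by
  have huE : ∀ᶠ i in l, u i ∈ finiteEnergyOn κ univ := hu.mono fun i hi => hi.1.1
  have hB := hk.tendsto_energyForm_self hp huE hν hs
  have hN := (ENNReal.tendsto_toReal (hF.fin ν hν)).comp
    ((hF.tendsto (map u l) huE ν hν (tendsto_map'_iff.2 hs)).comp tendsto_map)
  -- Solving G ≤ b for ∫ h₁. The energy and ∫ h₂ converge along the filter, so only the vague lower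
  -- semicontinuity of ∫ h₁ remains to be used.
  set r := (b - energyForm κ ν ν) / 2 + (∫⁻ x, h₂ x ∂ν).toReal with hr
  have hlim : Tendsto (fun i => (b - energyForm κ (u i) (u i)) / 2 + (∫⁻ x, h₂ x ∂(u i)).toReal) l
      (𝓝 r) := ((hB.const_sub b).div_const 2).add hN
  have hle : ∀ ε : ℝ, 0 < ε → 0 ≤ r + ε ∧ ∫⁻ x, h₁ x ∂ν ≤ ENNReal.ofReal (r + ε) := by
    intro ε hε
    have hev : ∀ᶠ i in l, ∫⁻ x, h₁ x ∂(u i) ≤ ENNReal.ofReal (r + ε) ∧ 0 ≤ r + ε := by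
      filter_upwards [hu, hlim.eventually (gt_mem_nhds (show r < r + ε by linarith))] with i hi hlt
      have h0 : 0 ≤ (∫⁻ x, h₁ x ∂(u i)).toReal := ENNReal.toReal_nonneg
      have h1 := hi.2
      rw [realWeightedEnergy] at h1
      have h2 : (∫⁻ x, h₁ x ∂(u i)).toReal ≤ r + ε := by linarith
      refine ⟨?_, h0.trans h2⟩
      rw [← ENNReal.ofReal_toReal hi.1.2]
      exact ENNReal.ofReal_le_ofReal h2
    exact ⟨hev.exists.choose_spec.2, (hperf.vagueTendsto huE hν hs).lintegral_le hν.1.1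
      (huE.mono fun i hi => hi.1.1).frequently hF.lsc (hev.mono fun i hi => hi.1)⟩
  have hfin : ∫⁻ x, h₁ x ∂ν ≠ ⊤ := ne_top_of_le_ne_top ENNReal.ofReal_ne_top (hle 1 one_pos).2
  have hH : (∫⁻ x, h₁ x ∂ν).toReal ≤ r := le_of_forall_pos_le_add fun ε hε =>
    ENNReal.toReal_le_of_le_ofReal (hle ε hε).1 (hle ε hε).2
  refine ⟨⟨hν, hfin⟩, ?_⟩
  rw [realWeightedEnergy]
  linarith

end Field

/-- The data of the problem, with the kernel and the field in decomposed form. -/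
structure EnergyProblem {X : Type*} [TopologicalSpace X] [MeasurableSpace X] (κ : X × X → EReal)
    (k : X × X → ℝ≥0∞) (c : ℝ≥0) (f : X → EReal) (h₁ h₂ : X → ℝ≥0∞) (g : X → ℝ) (U : Set X) :
    Prop where
  kernel : KernelDecomp κ k c
  posDef : IsPositiveDefinite κ
  perfect : IsPerfect κ
  field : FieldDecomp κ f g U h₁ h₂
  isOpen : IsOpen U
  weight_pos : ∀ x ∈ U, 0 < g x
  weight_cont : ContinuousOn g U
  weight_growth : (∃ M : ℝ, ∀ x ∈ U, g x ≤ M) ∨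
    ∃ (r : ℝ) (ω : SignedRadon X), 1 < r ∧ ω.FiniteEnergy κ ∧
      NearlyEverywhereOn κ U (fun x => ((g x ^ r : ℝ) : EReal) ≤ ω.potential κ x)

/-! ### Closedness of the admissible class; existence and uniqueness. -/

section Problem

variable {X : Type*} [TopologicalSpace X] [T2Space X] [LocallyCompactSpace X]
  [MeasurableSpace X] [BorelSpace X] {κ : X × X → EReal} {k : X × X → ℝ≥0∞} {c : ℝ≥0}
  {f : X → EReal} {g : X → ℝ} {U : Set X} {h₁ h₂ : X → ℝ≥0∞} {E : Set X} {σ : Measure X}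

lemma lowerSemicontinuous_weight (hU : IsOpen U) (hg : ContinuousOn g U) :
    LowerSemicontinuous (fun x => ENNReal.ofReal (U.indicator g x)) := by
  intro x
  by_cases hx : x ∈ U
  · have h1 : ContinuousAt (fun x => ENNReal.ofReal (g x)) x :=
      ENNReal.continuous_ofReal.continuousAt.comp (hg.continuousAt (hU.mem_nhds hx))
    have h2 : (fun x => ENNReal.ofReal (g x)) =ᶠ[𝓝 x]
        fun x => ENNReal.ofReal (U.indicator g x) := by
      filter_upwards [hU.mem_nhds hx] with y hy
      rw [indicator_of_mem hy]
    exact (h1.congr h2).lowerSemicontinuousAt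
  · intro y hy
    simp [indicator_of_notMem hx] at hy

namespace EnergyProblem

/-- Strong convergence implies vague convergence, which preserves the support, the constraint and
⟨g, ν⟩ ≤ 1. The reverse inequality is tightness, applicable because strong convergence also bounds
the energies. -/
lemma mem_admissible_of_tendsto (P : EnergyProblem κ k c f h₁ h₂ g U) (hE : IsClosed E)
    (hEU : E ⊆ U) (hcap : capacity κ E < ⊤) (hσ : σ.Regular) {ι : Type*} {l : Filter ι} [l.NeBot]
    {u : ι → Measure X} {ν : Measure X} (hu : ∀ᶠ i in l, u i ∈ admissible κ g E σ)
    (hν : ν ∈ finiteEnergyOn κ univ) (hs : StrongTendsto κ u l ν) :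
    ν ∈ admissible κ g E σ := by
  have huE : ∀ᶠ i in l, u i ∈ finiteEnergyOn κ univ :=
    hu.mono fun i hi => mem_finiteEnergyOn_univ hi.1
  have hv := P.perfect.vagueTendsto huE hν hs
  have hνE : ν ∈ radonOn E := hv.mem_radonOn hE hν.1.1 (hu.mono fun i hi => hi.1.1)
  have hνr := hν.1.1
  refine ⟨⟨hνE, hν.2⟩, le_antisymm ?_ ?_, ?_⟩
  · rw [← lintegral_indicator_weight hE hEU hνE]
    refine hv.lintegral_le hν.1.1 (huE.mono fun i hi => hi.1.1).frequently
      (lowerSemicontinuous_weight P.isOpen P.weight_cont) (hu.mono fun i hi => ?_)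
    rw [lintegral_indicator_weight hE hEU hi.1.1, hi.2.1]
  · refine ENNReal.le_of_forall_pos_le_add fun ε hε _ => ?_
    obtain ⟨K, hK, hKE, htight⟩ := P.kernel.exists_compact_weight_compl_le P.posDef P.perfect hE hEU
      P.isOpen P.weight_pos P.weight_cont hcap P.weight_growth (energyForm κ ν ν + 1)
      (ε := ε) (by simpa using hε.ne') (by simp)
    -- The cut-off `φ` must be supported in `U`: only then is `φ * g` continuous on all of `X`,
    -- hence a vague test function.
    obtain ⟨K', hK', hKK', hK'U⟩ := exists_compact_between hK P.isOpen (hKE.trans hEU)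
    obtain ⟨φ, hφ1, hφ0, hφc, hφ01⟩ := exists_continuous_one_zero_of_isCompact hK
      isOpen_interior.isClosed_compl (disjoint_compl_right_iff_subset.2 hKK')
    have hφs : tsupport φ ⊆ U := by
      refine (closure_minimal (fun x hx => ?_) hK'.isClosed).trans hK'U
      by_contra hxK
      exact hx (hφ0 fun hi => hxK (interior_subset hi))
    have hψs : tsupport (fun x => φ x * g x) ⊆ tsupport φ :=
      closure_mono fun x hx hφx => hx (by simp [hφx])
    have hψc : Continuous (fun x => φ x * g x) :=
      ContinuousOn.continuous_of_tsupport_subset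
        ((map_continuous φ).continuousOn.mul P.weight_cont) P.isOpen (hψs.trans hφs)
    have hψk : HasCompactSupport (fun x => φ x * g x) := hφc.mul_right
    have hψ0 : ∀ x, 0 ≤ φ x * g x := by
      intro x
      by_cases hx : φ x = 0
      · simp [hx]
      · exact mul_nonneg (hφ01 x).1 (P.weight_pos x (hφs (subset_tsupport _ hx))).le
    have hle : ∀ᶠ i in l, (1 : ℝ≥0∞) ≤ ENNReal.ofReal (∫ x, φ x * g x ∂(u i)) + ε := by
      filter_upwards [hu, (P.kernel.tendsto_energyForm_self P.posDef huE hν hs).eventually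
        (gt_mem_nhds (lt_add_one _))] with i hi hiM
      have := hi.1.1.1
      rw [← ofReal_integral_of_compactSupport _ hψc hψk hψ0]
      calc (1 : ℝ≥0∞) = ∫⁻ x, ENNReal.ofReal (g x) ∂(u i) := hi.2.1.symm
        _ = ∫⁻ x in K, ENNReal.ofReal (g x) ∂(u i) + ∫⁻ x in Kᶜ, ENNReal.ofReal (g x) ∂(u i) :=
            (lintegral_add_compl _ hK.measurableSet).symm
        _ ≤ ∫⁻ x, ENNReal.ofReal (φ x * g x) ∂(u i) + ε := by
            refine add_le_add ?_ (htight _ hi.1 hiM.le (by rw [hi.2.1]; simp))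
            calc ∫⁻ x in K, ENNReal.ofReal (g x) ∂(u i)
                = ∫⁻ x in K, ENNReal.ofReal (φ x * g x) ∂(u i) :=
                  setLIntegral_congr_fun hK.measurableSet fun x hx => by
                    have : φ x = 1 := hφ1 hx
                    simp [this]
              _ ≤ _ := setLIntegral_le_lintegral _ _
    have hlim := ((ENNReal.continuous_ofReal.tendsto _).comp (hv _ hψc hψk)).add_const (ε : ℝ≥0∞)
    refine (ge_of_tendsto hlim hle).trans ?_
    gcongr
    rw [← ofReal_integral_of_compactSupport _ hψc hψk hψ0]
    have hae : ∀ᵐ x ∂ν, x ∈ E := ((mem_radonOn_iff hE).1 hνE).2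
    refine lintegral_mono_ae (hae.mono fun x hx => ENNReal.ofReal_le_ofReal ?_)
    exact mul_le_of_le_one_left (P.weight_pos x (hEU hx)).le (hφ01 x).2
  · exact hv.le (v := fun _ => σ) (fun φ _ _ => tendsto_const_nhds) hν.1.1 hσ
      (hu.mono fun i hi => ⟨hσ, hi.2.2⟩)

lemma admissible_subset {E E' : Set X} {σ σ' : Measure X} (h : E ⊆ E') (h' : σ ≤ σ') :
    admissible κ g E σ ⊆ admissible κ g E' σ' :=
  fun _ hν => ⟨⟨⟨hν.1.1.1, hν.1.1.2.trans h⟩, hν.1.2⟩, hν.2.1, hν.2.2.trans h'⟩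

lemma minEnergy_anti {E E' : Set X} {σ σ' : Measure X} (h : E ⊆ E') (h' : σ ≤ σ') :
    minEnergy κ f g E' σ' ≤ minEnergy κ f g E σ :=
  biInf_mono (admissible_subset h h')

lemma smul_add_smul_mem_admissible (P : EnergyProblem κ k c f h₁ h₂ g U) {ν μ : Measure X}
    (hν : ν ∈ admissible κ g E σ) (hμ : μ ∈ admissible κ g E σ) {s t : ℝ≥0} (hst : s + t = 1) :
    s • ν + t • μ ∈ admissible κ g E σ := by
  have hst' : (s : ℝ≥0∞) + t = 1 := by exact_mod_cast hst
  refine ⟨P.kernel.add_mem P.posDef (P.kernel.smul_mem hν.1 s) (P.kernel.smul_mem hμ.1 t), ?_, ?_⟩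
  · rw [lintegral_combo, hν.2.1, hμ.2.1, mul_one, mul_one, hst']
  · refine Measure.le_iff'.2 fun A => ?_
    calc (s • ν + t • μ) A = s * ν A + t * μ A := rfl
      _ ≤ s * σ A + t * σ A := by
          gcongr
          · exact hν.2.2
          · exact hμ.2.2
      _ = σ A := by rw [← add_mul, hst', one_mul]

lemma exists_minEnergy_eq_coe (P : EnergyProblem κ k c f h₁ h₂ g U) (hE : IsClosed E)
    (hEU : E ⊆ U) (hfin : minEnergy κ f g E σ < ⊤) : ∃ m : ℝ, minEnergy κ f g E σ = m := by
  obtain ⟨b, hb⟩ := P.field.lower E hE hEU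
  have hle : (b : EReal) ≤ minEnergy κ f g E σ := by
    refine le_iInf₂ fun ν hν => ?_
    by_cases h : weightedEnergy κ f ν < ⊤
    · have hνW := P.field.mem_finiteWeighted P.kernel P.posDef (mem_finiteEnergyOn_univ hν.1) h
      rw [P.field.weightedEnergy_eq P.kernel P.posDef hνW]
      exact_mod_cast hb ν hν.1 hν.2.1 hνW.2
    · rw [not_lt_top_iff.1 h]
      exact le_top
  exact ⟨_, (EReal.coe_toReal hfin.ne ((EReal.bot_lt_coe b).trans_le hle).ne').symm⟩

lemma le_realWeightedEnergy (P : EnergyProblem κ k c f h₁ h₂ g U) {m : ℝ}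
    (hm : minEnergy κ f g E σ = m) {ν : Measure X} (hν : ν ∈ admissible κ g E σ)
    (hνW : ν ∈ finiteWeighted κ h₁) : m ≤ realWeightedEnergy κ h₁ h₂ ν := by
  have : minEnergy κ f g E σ ≤ weightedEnergy κ f ν := iInf₂_le ν hν
  rw [hm, P.field.weightedEnergy_eq P.kernel P.posDef hνW] at this
  exact_mod_cast this

lemma isEquilibrium_iff (P : EnergyProblem κ k c f h₁ h₂ g U) {m : ℝ}
    (hm : minEnergy κ f g E σ = m) {ν : Measure X} : IsEquilibrium κ f g E σ ν ↔
      ν ∈ admissible κ g E σ ∧ ν ∈ finiteWeighted κ h₁ ∧ realWeightedEnergy κ h₁ h₂ ν = m := by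
  refine ⟨fun h => ?_, fun ⟨h1, h2, h3⟩ => ⟨h1, ?_⟩⟩
  · have h2 := h.2
    rw [hm] at h2
    have hW := P.field.mem_finiteWeighted P.kernel P.posDef (mem_finiteEnergyOn_univ h.1.1)
      (by rw [h2]; exact EReal.coe_lt_top m)
    rw [P.field.weightedEnergy_eq P.kernel P.posDef hW] at h2
    exact ⟨h.1, hW, by exact_mod_cast h2⟩
  · rw [P.field.weightedEnergy_eq P.kernel P.posDef h2, h3, hm]

lemma exists_realWeightedEnergy_lt (P : EnergyProblem κ k c f h₁ h₂ g U) {m : ℝ}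
    (hm : minEnergy κ f g E σ = m) {ε : ℝ} (hε : 0 < ε) : ∃ ν ∈ admissible κ g E σ,
      ν ∈ finiteWeighted κ h₁ ∧ realWeightedEnergy κ h₁ h₂ ν < m + ε := by
  have : minEnergy κ f g E σ < ((m + ε : ℝ) : EReal) := by
    rw [hm]; exact_mod_cast lt_add_of_pos_right m hε
  simp only [minEnergy, iInf_lt_iff] at this
  obtain ⟨ν, hν, h⟩ := this
  have hW := P.field.mem_finiteWeighted P.kernel P.posDef (mem_finiteEnergyOn_univ hν.1)
    (h.trans (EReal.coe_lt_top _))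
  rw [P.field.weightedEnergy_eq P.kernel P.posDef hW] at h
  exact ⟨ν, hν, hW, by exact_mod_cast h⟩

/-- The midpoint is admissible, so its weighted energy is at least `m`; the parallelogram identity
does the rest. All Cauchy and convergence estimates for measures in a common admissible class come
from here. -/
lemma strongDist_sq_le (P : EnergyProblem κ k c f h₁ h₂ g U) {m : ℝ}
    (hm : minEnergy κ f g E σ = m) {ν μ : Measure X} (hν : ν ∈ admissible κ g E σ)
    (hνW : ν ∈ finiteWeighted κ h₁) (hμ : μ ∈ admissible κ g E σ)
    (hμW : μ ∈ finiteWeighted κ h₁) :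
    strongDist κ ν μ ^ 2 ≤ 2 * realWeightedEnergy κ h₁ h₂ ν + 2 * realWeightedEnergy κ h₁ h₂ μ -
      4 * m := by
  have h1 : midpointMeasure ν μ ∈ admissible κ g E σ :=
    P.smul_add_smul_mem_admissible hν hμ (add_halves 1)
  have h2 := P.le_realWeightedEnergy hm h1 (P.kernel.combo_mem P.posDef hνW hμW _ _)
  rw [P.field.strongDist_sq_eq P.kernel P.posDef hνW hμW]
  linarith

/-- Existence and uniqueness of the equilibrium measure. -/
theorem existsUnique_isEquilibrium (P : EnergyProblem κ k c f h₁ h₂ g U) (hE : IsClosed E)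
    (hEU : E ⊆ U) (hcap : capacity κ E < ⊤) (hσ : σ.Regular) (hfin : minEnergy κ f g E σ < ⊤) :
    ∃! lam : Measure X, IsEquilibrium κ f g E σ lam := by
  obtain ⟨m, hm⟩ := P.exists_minEnergy_eq_coe hE hEU hfin
  simp only [P.isEquilibrium_iff hm]
  have hex : ∀ n : ℕ, ∃ ν ∈ admissible κ g E σ, ν ∈ finiteWeighted κ h₁ ∧
      realWeightedEnergy κ h₁ h₂ ν < m + 1 / ((n : ℝ) + 1) := fun n =>
    P.exists_realWeightedEnergy_lt hm Nat.one_div_pos_of_nat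
  choose u hu huW hlt using hex
  have hev : ∀ δ : ℝ, 0 < δ → ∀ᶠ n in atTop, realWeightedEnergy κ h₁ h₂ (u n) < m + δ := by
    intro δ hδ
    obtain ⟨n, hn⟩ := exists_nat_one_div_lt hδ
    filter_upwards [Ici_mem_atTop n] with i hi
    exact (hlt i).trans_le (by gcongr; exact (Nat.one_div_le_one_div hi).trans hn.le)
  obtain ⟨ν, hν, hs⟩ := P.perfect.exists_strongTendsto (l := atTop)
    (Eventually.of_forall fun n => (huW n).1) fun ε hε => by
      refine ⟨_, hev (ε ^ 2 / 4) (by positivity), fun i hi j hj => ?_⟩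
      refine lt_of_pow_lt_pow_left₀ 2 hε.le ?_
      have h1 := P.strongDist_sq_le hm (hu i) (huW i) (hu j) (huW j)
      have hi' : realWeightedEnergy κ h₁ h₂ (u i) < m + ε ^ 2 / 4 := hi
      have hj' : realWeightedEnergy κ h₁ h₂ (u j) < m + ε ^ 2 / 4 := hj
      linarith
  have hadm := P.mem_admissible_of_tendsto hE hEU hcap hσ (Eventually.of_forall hu) hν hs
  have hle : ∀ δ : ℝ, 0 < δ → ν ∈ finiteWeighted κ h₁ ∧ realWeightedEnergy κ h₁ h₂ ν ≤ m + δ :=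
    fun δ hδ => P.field.realWeightedEnergy_le P.kernel P.posDef P.perfect
      ((hev δ hδ).mono fun n hn => ⟨huW n, hn.le⟩) hν hs
  have hνW := (hle 1 one_pos).1
  refine ⟨ν, ⟨hadm, hνW, le_antisymm (le_of_forall_pos_le_add fun δ hδ => (hle δ hδ).2)
    (P.le_realWeightedEnergy hm hadm hνW)⟩, ?_⟩
  rintro μ ⟨h1, h2, h3⟩
  refine P.perfect.eq_of_strongDist_eq_zero hν h2.1 ?_
  have h4 := P.strongDist_sq_le hm h1 h2 hadm hνW
  have h5 := le_of_forall_pos_le_add fun δ hδ => (hle δ hδ).2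
  exact pow_eq_zero_iff two_ne_zero |>.1 (le_antisymm (by linarith) (by positivity))

end EnergyProblem

end Problem

lemma strongTendsto_of_sq_le {X ι : Type*} [MeasurableSpace X] {κ : X × X → EReal} {l : Filter ι}
    {u : ι → Measure X} {ν : Measure X} {a : ι → ℝ}
    (h : ∀ᶠ i in l, strongDist κ (u i) ν ^ 2 ≤ a i) (ha : Tendsto a l (𝓝 0)) :
    StrongTendsto κ u l ν := by
  have h0 : Tendsto (fun i => √(a i)) l (𝓝 0) := by
    simpa [Function.comp_def] using (Real.continuous_sqrt.tendsto 0).comp ha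
  exact squeeze_zero' (Eventually.of_forall fun i => Real.sqrt_nonneg _)
    (h.mono fun i hi => Real.le_sqrt_of_sq_le hi) h0

/-! ### Decreasing nets of sets and constraints. -/

section Decreasing

variable {X : Type*} [TopologicalSpace X] [T2Space X] [LocallyCompactSpace X]
  [MeasurableSpace X] [BorelSpace X] {κ : X × X → EReal} {k : X × X → ℝ≥0∞} {c : ℝ≥0}
  {f : X → EReal} {g : X → ℝ} {U : Set X} {h₁ h₂ : X → ℝ≥0∞} {E : Set X} {σ : Measure X}

/-- Convergence along decreasing nets of closed sets and constraints. -/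
theorem EnergyProblem.tendsto_of_antitone (P : EnergyProblem κ k c f h₁ h₂ g U)
    (hσ : σ.Regular) (hfin : minEnergy κ f g E σ < ⊤)
    {S : Type*} [Preorder S] [IsDirectedOrder S] [Nonempty S]
    {Es : S → Set X} {σs : S → Measure X} (hEs : ∀ s, IsClosed (Es s)) (hEsU : ∀ s, Es s ⊆ U)
    (hEanti : Antitone Es) (hcap : ∀ s, capacity κ (Es s) < ⊤) (hinter : ⋂ s, Es s = E)
    (hσs : ∀ s, (σs s).Regular) (hσanti : Antitone σs) (hvague : VagueTendsto σs atTop σ) :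
    Tendsto (fun s => minEnergy κ f g (Es s) (σs s)) atTop (𝓝 (minEnergy κ f g E σ)) ∧
      (∀ s, ∃! lam : Measure X, IsEquilibrium κ f g (Es s) (σs s) lam) ∧
      ∀ (lam : Measure X) (lams : S → Measure X), IsEquilibrium κ f g E σ lam →
        (∀ s, IsEquilibrium κ f g (Es s) (σs s) (lams s)) →
        StrongTendsto κ lams atTop lam ∧ VagueTendsto lams atTop lam := by
  have hE : IsClosed E := hinter ▸ isClosed_iInter hEs
  have hsub : ∀ s, E ⊆ Es s := fun s => hinter ▸ iInter_subset Es s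
  have hEU : E ⊆ U := (hsub (Classical.arbitrary S)).trans (hEsU _)
  have hσle : ∀ s, σ ≤ σs s := fun s =>
    hvague.le (v := fun _ => σs s) (fun φ _ _ => tendsto_const_nhds) hσ (hσs s)
      ((eventually_ge_atTop s).mono fun i hi => ⟨hσs s, hσanti hi⟩)
  obtain ⟨m, hm⟩ := P.exists_minEnergy_eq_coe hE hEU hfin
  have hms : ∀ s, ∃ x : ℝ, minEnergy κ f g (Es s) (σs s) = x := fun s =>
    P.exists_minEnergy_eq_coe (hEs s) (hEsU s)
      ((EnergyProblem.minEnergy_anti (hsub s) (hσle s)).trans_lt hfin)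
  choose ms hms using hms
  have hex : ∀ s, ∃! lam : Measure X, IsEquilibrium κ f g (Es s) (σs s) lam := fun s =>
    P.existsUnique_isEquilibrium (hEs s) (hEsU s) (hcap s) (hσs s)
      (by rw [hms s]; exact EReal.coe_lt_top _)
  have hmono : Monotone ms := fun s t hst => by
    have := EnergyProblem.minEnergy_anti (κ := κ) (f := f) (g := g) (hEanti hst) (hσanti hst)
    rw [hms, hms] at this
    exact_mod_cast this
  have hlem : ∀ s, ms s ≤ m := fun s => by
    have := EnergyProblem.minEnergy_anti (κ := κ) (f := f) (g := g) (hsub s) (hσle s)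
    rw [hms, hm] at this
    exact_mod_cast this
  have hbdd : BddAbove (range ms) := ⟨m, by rintro _ ⟨s, rfl⟩; exact hlem s⟩
  have hlim : Tendsto ms atTop (𝓝 m) := by
    have hL := tendsto_atTop_ciSup hmono hbdd
    set L := ⨆ s, ms s
    suffices hmL : m ≤ L by
      have hLm : L = m := le_antisymm (ciSup_le hlem) hmL
      rwa [hLm] at hL
    choose u hu _ using hex
    have hu' := fun s => (P.isEquilibrium_iff (hms s)).1 (hu s)
    -- All later equilibrium measures belong to the class at `s`, and their energies lie between `ms
    -- s` and `L`; this gives the Cauchy property once `ms s` is close to `L`.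
    have hadm : ∀ s i, s ≤ i → u i ∈ admissible κ g (Es s) (σs s) := fun s i hsi =>
      EnergyProblem.admissible_subset (hEanti hsi) (hσanti hsi) (hu' i).1
    obtain ⟨ν, hν, hs⟩ := P.perfect.exists_strongTendsto (l := atTop)
      (Eventually.of_forall fun s => (hu' s).2.1.1) fun ε hε => by
        obtain ⟨s, hs⟩ := exists_lt_of_lt_ciSup (show L - ε ^ 2 / 4 < ⨆ s, ms s by
          have : 0 < ε ^ 2 / 4 := by positivity
          linarith)
        refine ⟨Ici s, Ici_mem_atTop s, fun i hi j hj => ?_⟩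
        refine lt_of_pow_lt_pow_left₀ 2 hε.le ?_
        have h1 := P.strongDist_sq_le (hms s) (hadm s i hi) (hu' i).2.1 (hadm s j hj) (hu' j).2.1
        rw [(hu' i).2.2, (hu' j).2.2] at h1
        have h2 := le_ciSup hbdd i
        have h3 := le_ciSup hbdd j
        linarith
    have hνs : ∀ s, ν ∈ admissible κ g (Es s) (σs s) := fun s =>
      P.mem_admissible_of_tendsto (hEs s) (hEsU s) (hcap s) (hσs s)
        ((eventually_ge_atTop s).mono fun i hi => hadm s i hi) hν hs
    have hνadm : ν ∈ admissible κ g E σ := by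
      refine ⟨⟨⟨hν.1.1, ?_⟩, hν.2⟩, (hνs (Classical.arbitrary S)).2.1, ?_⟩
      · rw [← hinter]
        exact subset_iInter fun s => (hνs s).1.1.2
      · exact VagueTendsto.le (u := fun _ => ν) (fun φ _ _ => tendsto_const_nhds) hvague hν.1.1 hσ
          (Eventually.of_forall fun s => ⟨hσs s, (hνs s).2.2⟩)
    obtain ⟨hνW, hνL⟩ := P.field.realWeightedEnergy_le P.kernel P.posDef P.perfect (b := L)
      (Eventually.of_forall fun s => ⟨(hu' s).2.1, by rw [(hu' s).2.2]; exact le_ciSup hbdd s⟩) hν hs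
    exact (P.le_realWeightedEnergy hm hνadm hνW).trans hνL
  refine ⟨?_, hex, fun lam lams hlam hlams => ?_⟩
  · rw [hm]
    simp_rw [hms]
    exact (continuous_coe_real_ereal.tendsto m).comp hlim
  · obtain ⟨h1, h2, h3⟩ := (P.isEquilibrium_iff hm).1 hlam
    have hlams' := fun s => (P.isEquilibrium_iff (hms s)).1 (hlams s)
    have hst : StrongTendsto κ lams atTop lam := by
      -- `lam` is itself admissible at every `s`, so the squared distance is at most 2 ms(s) + 2m -
      -- 4 ms(s).
      refine strongTendsto_of_sq_le (a := fun s => 2 * (m - ms s)) (Eventually.of_forall fun s => ?_) ?_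
      · have := P.strongDist_sq_le (hms s) (hlams' s).1 (hlams' s).2.1
          (EnergyProblem.admissible_subset (hsub s) (hσle s) h1) h2
        rw [(hlams' s).2.2, h3] at this
        linarith
      · simpa using (hlim.const_sub m).const_mul 2
    exact ⟨hst, P.perfect.vagueTendsto (Eventually.of_forall fun s => (hlams' s).2.1.1) h2.1 hst⟩

end Decreasing

/-! ### Exhaustion by compact subsets. -/

section CompactExhaustion

variable {X : Type*} [TopologicalSpace X]

instance (E : Set X) : Nonempty (CompactIn E) := ⟨⟨∅, isCompact_empty, empty_subset _⟩⟩

instance (E : Set X) : IsDirectedOrder (CompactIn E) :=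
  ⟨fun K L => ⟨⟨K.1 ∪ L.1, K.2.1.union L.2.1, union_subset K.2.2 L.2.2⟩,
    (subset_union_left : K.1 ⊆ K.1 ∪ L.1), (subset_union_right : L.1 ⊆ K.1 ∪ L.1)⟩⟩

/-- Take 1 + 1/(N + 1), where N is the least index with `k N` not contained in `K`. It decreases as
`K` grows, and N ≥ n once `K` contains the first n sets. Without such a sequence the constant net 1
is used. -/
lemma exists_antitone_tendsto_one (E : Set X) : ∃ βs : CompactIn E → ℝ,
    (∀ K, 1 ≤ βs K) ∧ Antitone βs ∧ Tendsto βs atTop (𝓝 1) ∧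
      ((∃ k : ℕ → CompactIn E, ∀ K : CompactIn E, ∃ n, ¬ k n ≤ K) → ∀ K, 1 < βs K) := by
  classical
  by_cases h : ∃ k : ℕ → CompactIn E, ∀ K : CompactIn E, ∃ n, ¬ k n ≤ K
  · obtain ⟨k, hk⟩ := h
    have hpos : ∀ K, (0 : ℝ) < 1 / ((Nat.find (hk K) : ℝ) + 1) := fun K => Nat.one_div_pos_of_nat
    have hanti : Antitone fun K => (1 : ℝ) + 1 / ((Nat.find (hk K) : ℝ) + 1) := by
      intro K L hKL
      have : Nat.find (hk K) ≤ Nat.find (hk L) :=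
        Nat.find_min' _ fun hle => Nat.find_spec (hk L) (hle.trans hKL)
      exact add_le_add_right (Nat.one_div_le_one_div this) _
    refine ⟨fun K => 1 + 1 / ((Nat.find (hk K) : ℝ) + 1),
      fun K => le_add_of_nonneg_right (hpos K).le, hanti, ?_, fun _ K => lt_add_of_pos_right _ (hpos K)⟩
    refine tendsto_order.2 ⟨fun a ha => Eventually.of_forall fun K =>
      ha.trans (lt_add_of_pos_right _ (hpos K)), fun a ha => ?_⟩
    obtain ⟨n, hn⟩ := exists_nat_one_div_lt (sub_pos.2 ha)
    obtain ⟨K, hK⟩ := ((Finset.range n).image k).exists_le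
    filter_upwards [eventually_ge_atTop K] with L hL
    have : n ≤ Nat.find (hk L) := (Nat.le_find_iff _ _).2 fun j hj =>
      not_not.2 ((hK _ (Finset.mem_image_of_mem k (Finset.mem_range.2 hj))).trans hL)
    linarith [Nat.one_div_le_one_div (α := ℝ) this]
  · exact ⟨fun _ => 1, fun _ => le_rfl, antitone_const, tendsto_const_nhds, fun h' => absurd h' h⟩

variable [T2Space X] [MeasurableSpace X] [BorelSpace X]

/-- The integral over a closed set is the limit of the integrals over its compact subsets, for
regular measures which are `σ`-finite through an integrable function. -/
lemma tendsto_setLIntegral_compactIn {E : Set X} (hE : IsClosed E) {ν : Measure X} [ν.Regular]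
    (hν : ν Eᶜ = 0) {w : X → ℝ≥0∞} (hw : Measurable w) (hfin : ∫⁻ x, w x ∂ν ≠ ⊤)
    (hpos : ∀ x ∈ E, w x ≠ 0) (h : X → ℝ≥0∞) :
    Tendsto (fun K : CompactIn E => ∫⁻ x in K.1, h x ∂ν) atTop (𝓝 (∫⁻ x, h x ∂ν)) := by
  have hmono : Monotone (fun K : CompactIn E => ∫⁻ x in K.1, h x ∂ν) :=
    fun K L hKL => lintegral_mono_set hKL
  suffices hsup : ⨆ K : CompactIn E, ∫⁻ x in K.1, h x ∂ν = ∫⁻ x, h x ∂ν by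
    rw [← hsup]
    exact tendsto_atTop_iSup hmono
  refine le_antisymm (iSup_le fun K => setLIntegral_le_lintegral _ _) ?_
  set D : ℕ → Set X := fun n => E ∩ {x | ((n : ℝ≥0∞) + 1)⁻¹ ≤ w x} with hD
  have hDm : ∀ n, MeasurableSet (D n) := fun n =>
    hE.measurableSet.inter (measurableSet_le measurable_const hw)
  have hDfin : ∀ n, ν (D n) ≠ ⊤ := fun n =>
    ne_top_of_le_ne_top (meas_ge_le_lintegral_div hw.aemeasurable (by simp) (by simp) |>.trans_lt
      (ENNReal.div_lt_top hfin (by simp))).ne (measure_mono inter_subset_right)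
  have hDE : E ⊆ ⋃ n, D n := by
    intro x hx
    obtain ⟨n, hn⟩ := ENNReal.exists_inv_nat_lt (hpos x hx)
    exact mem_iUnion.2 ⟨n, hx, le_trans (ENNReal.inv_le_inv.2 le_self_add) hn.le⟩
  -- Each `D n` has finite measure and is filled by compact sets up to arbitrarily small measure, so
  -- countably many compact sets carry `ν`.
  have hK : ∀ p : ℕ × ℕ, ∃ K ⊆ D p.1, IsCompact K ∧ ν (D p.1 \ K) < ((p.2 : ℝ≥0∞) + 1)⁻¹ := by
    intro p
    exact (hDm p.1).exists_isCompact_sdiff_lt (hDfin p.1) (by simp)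
  choose K hKD hKc hKlt using hK
  have hnull : ν (⋃ p, K p)ᶜ = 0 := by
    have hsub : (⋃ p, K p)ᶜ ⊆ Eᶜ ∪ ⋃ n, (D n \ ⋃ p, K p) := by
      intro x hx
      by_cases hxE : x ∈ E
      · obtain ⟨n, hn⟩ := mem_iUnion.1 (hDE hxE)
        exact Or.inr (mem_iUnion.2 ⟨n, hn, hx⟩)
      · exact Or.inl hxE
    refine measure_mono_null hsub (measure_union_null hν (measure_iUnion_null fun n => ?_))
    refine le_antisymm (le_of_forall_gt_imp_ge_of_dense fun ε hε => ?_) zero_le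
    obtain ⟨j, hj⟩ := ENNReal.exists_inv_nat_lt hε.ne'
    calc ν (D n \ ⋃ p, K p) ≤ ν (D n \ K (n, j)) :=
          measure_mono (sdiff_subset_sdiff_right (subset_iUnion K (n, j)))
      _ ≤ ((j : ℝ≥0∞) + 1)⁻¹ := (hKlt (n, j)).le
      _ ≤ (j : ℝ≥0∞)⁻¹ := ENNReal.inv_le_inv.2 le_self_add
      _ ≤ ε := hj.le
  -- Finite unions are compact and form a countable directed family, so the integrals converge
  -- without any measurability of `h`.
  have hunion : (⋃ p, K p) = ⋃ F : Finset (ℕ × ℕ), ⋃ p ∈ F, K p := by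
    rw [iUnion_eq_iUnion_finset]
  rw [← setLIntegral_univ, ← setLIntegral_congr (show (⋃ p, K p : Set X) =ᵐ[ν] univ from by
    rwa [ae_eq_univ]), hunion, setLIntegral_iUnion_of_directed]
  · refine iSup_le fun F => le_iSup_of_le
      ⟨⋃ p ∈ F, K p, F.isCompact_biUnion fun p _ => hKc p, ?_⟩ le_rfl
    exact iUnion₂_subset fun p _ => (hKD p).trans inter_subset_left
  · exact Monotone.directed_le fun F G hFG => biUnion_subset_biUnion_left hFG

end CompactExhaustion

/-! ### Increasing compact sets and enlarged constraints. -/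

section Increasing

variable {X : Type*} [TopologicalSpace X] [T2Space X] [LocallyCompactSpace X]
  [MeasurableSpace X] [BorelSpace X] {κ : X × X → EReal} {k : X × X → ℝ≥0∞} {c : ℝ≥0}
  {f : X → EReal} {g : X → ℝ} {U : Set X} {h₁ h₂ : X → ℝ≥0∞} {E : Set X} {σ : Measure X}

/-- Terms monotone in the measure are estimated by `μ`; those entering with a minus sign are kept
for `ν`. Thus only the subtracted terms need limits for restrictions, and they can be dropped for a
uniform bound. -/
lemma KernelDecomp.realWeightedEnergy_le_of_le (hk : KernelDecomp κ k c)
    (hp : IsPositiveDefinite κ) {ν μ : Measure X} (hν : ν ∈ finiteWeighted κ h₁)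
    (hμ : μ ∈ finiteWeighted κ h₁) (h : ν ≤ μ) :
    realWeightedEnergy κ h₁ h₂ ν ≤ (posEnergy k μ μ).toReal -
      ((c : ℝ≥0∞) * ν univ * ν univ).toReal +
      2 * ((∫⁻ x, h₁ x ∂μ).toReal - (∫⁻ x, h₂ x ∂ν).toReal) := by
  have h1 := ENNReal.toReal_mono (hk.posEnergy_ne_top hp hμ.1 hμ.1) (posEnergy_mono (k := k) h h)
  have h2 := ENNReal.toReal_mono hμ.2 (lintegral_mono' h (le_refl h₁))
  rw [realWeightedEnergy, (hk.energyForm_eq hp hν.1 hν.1).2]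
  linarith

lemma KernelDecomp.restrict_mem_finiteWeighted (hk : KernelDecomp κ k c) {ν : Measure X} {A : Set X}
    (hν : ν ∈ finiteWeighted κ h₁) (hA : ν A ≠ ⊤) : ν.restrict A ∈ finiteWeighted κ h₁ :=
  ⟨hk.restrict_mem hν.1 hA isClosed_univ (subset_univ _),
    ne_top_of_le_ne_top hν.2 (setLIntegral_le_lintegral _ _)⟩

namespace EnergyProblem

/-- Along the compact subsets of `E`, the restrictions of a measure asymptotically do not exceed it
in weighted energy. -/
lemma exists_tendsto_restrict_le (P : EnergyProblem κ k c f h₁ h₂ g U) (hE : IsClosed E)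
    (hEU : E ⊆ U) {lam : Measure X} (hlam : lam ∈ admissible κ g E σ)
    (hlamW : lam ∈ finiteWeighted κ h₁) : ∃ a : CompactIn E → ℝ,
      Tendsto a atTop (𝓝 (realWeightedEnergy κ h₁ h₂ lam)) ∧
      ∀ K, realWeightedEnergy κ h₁ h₂ (lam.restrict K.1) ≤ a K := by
  have hr := hlamW.1.1.1
  have hlamE := ((mem_radonOn_iff hE).1 hlam.1.1).2
  have hexh := tendsto_setLIntegral_compactIn hE hlamE
    (measurable_indicator_weight P.isOpen P.weight_cont).ennreal_ofReal
    (by rw [lintegral_indicator_weight hE hEU hlam.1.1, hlam.2.1]; simp)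
    (fun x hx => by
      rw [indicator_of_mem (hEU hx)]
      simpa using P.weight_pos x (hEU hx))
  refine ⟨fun K => (posEnergy k lam lam).toReal -
      ((c : ℝ≥0∞) * lam.restrict K.1 univ * lam.restrict K.1 univ).toReal +
      2 * ((∫⁻ x, h₁ x ∂lam).toReal - (∫⁻ x in K.1, h₂ x ∂lam).toReal), ?_, fun K =>
      P.kernel.realWeightedEnergy_le_of_le P.posDef
        (P.kernel.restrict_mem_finiteWeighted hlamW K.2.1.measure_ne_top) hlamW
        Measure.restrict_le_self⟩
  rw [realWeightedEnergy, (P.kernel.energyForm_eq P.posDef hlamW.1 hlamW.1).2]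
  have hN := (ENNReal.tendsto_toReal (P.field.fin lam hlamW.1)).comp (hexh h₂)
  refine (Tendsto.const_sub _ ?_).add ((hN.const_sub _).const_mul 2)
  rcases P.kernel.compact with rfl | hX
  · simp
  · have h1 := hexh 1
    simp only [Pi.one_apply, lintegral_one] at h1
    have h2 := (ENNReal.tendsto_toReal (measure_ne_top lam univ)).comp h1
    simp only [ENNReal.toReal_mul]
    exact (h2.const_mul _).mul h2

/-- Near-minimizers on the compact subsets of `E`, which do not use a larger constraint. -/
lemma exists_tendsto_minEnergy_restrict_le (P : EnergyProblem κ k c f h₁ h₂ g U) (hE : IsClosed E)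
    (hEU : E ⊆ U) (hcap : capacity κ E < ⊤) (hσ : σ.Regular) {m : ℝ}
    (hm : minEnergy κ f g E σ = m) {K₀ : CompactIn E}
    (hK₀ : minEnergy κ f g K₀.1 (σ.restrict K₀.1) < ⊤) :
    ∃ a : CompactIn E → ℝ, Tendsto a atTop (𝓝 m) ∧
      ∀ᶠ K : CompactIn E in atTop, minEnergy κ f g K.1 (σ.restrict K.1) ≤ a K := by
  obtain ⟨lam, hlam, -⟩ := P.existsUnique_isEquilibrium hE hEU hcap hσ
    (by rw [hm]; exact EReal.coe_lt_top m)
  obtain ⟨hlam, hlamW, hlamm⟩ := (P.isEquilibrium_iff hm).1 hlam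
  obtain ⟨m₀, hm₀⟩ := P.exists_minEnergy_eq_coe K₀.2.1.isClosed (K₀.2.2.trans hEU) hK₀
  obtain ⟨ν, hν, hνW, -⟩ := P.exists_realWeightedEnergy_lt hm₀ one_pos
  obtain ⟨a, ha, hale⟩ := P.exists_tendsto_restrict_le hE hEU hlam hlamW
  rw [hlamm] at ha
  have hlamr := hlamW.1.1.1
  have hνr := hνW.1.1.1
  have hνσ : ν ≤ σ := hν.2.2.trans Measure.restrict_le_self
  set w : X → ℝ≥0∞ := fun x => ENNReal.ofReal (g x) with hw
  -- `lam` dominates `ν` on `K₀ \ s`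
  obtain ⟨s, hsm, hsK, hs⟩ : ∃ s, MeasurableSet s ∧ s ⊆ K₀.1 ∧
      ν.restrict (K₀.1 \ s) ≤ lam.restrict (K₀.1 \ s) := by
    have : IsFiniteMeasure (lam.restrict K₀.1) := ⟨by simpa using K₀.2.1.measure_lt_top⟩
    have : IsFiniteMeasure (ν.restrict K₀.1) := ⟨by simpa using K₀.2.1.measure_lt_top⟩
    obtain ⟨s, hs⟩ := exists_isHahnDecomposition (lam.restrict K₀.1) (ν.restrict K₀.1)
    refine ⟨s ∩ K₀.1, hs.measurableSet.inter K₀.2.1.measurableSet, inter_subset_right, ?_⟩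
    have := hs.ge_on_compl
    rw [Measure.restrict_restrict hs.measurableSet.compl,
      Measure.restrict_restrict hs.measurableSet.compl] at this
    rwa [show K₀.1 \ (s ∩ K₀.1) = sᶜ ∩ K₀.1 by ext; simp; tauto]
  have hfinlam : ∀ A : Set X, ∫⁻ x in A, w x ∂lam ≠ ⊤ := fun A =>
    ne_top_of_le_ne_top (by rw [hlam.2.1]; simp) (setLIntegral_le_lintegral A w)
  have hfinν : ∫⁻ x in s, w x ∂ν ≠ ⊤ :=
    ne_top_of_le_ne_top (by rw [hν.2.1]; simp) (setLIntegral_le_lintegral s w)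
  -- With `A = lam|_K` and `B = ν|_s + lam|_{K \ s}`, the maximum of `ν` and `lam|_K`, the g-masses
  -- are `α K = q + r K` and `p + r K`. The latter is at least 1 because `B` dominates `ν`.
  set p := (∫⁻ x in s, w x ∂ν).toReal with hpdef
  set q := (∫⁻ x in s, w x ∂lam).toReal with hqdef
  set r : CompactIn E → ℝ := fun K => (∫⁻ x in K.1 \ s, w x ∂lam).toReal with hrdef
  set α : CompactIn E → ℝ := fun K => (∫⁻ x in K.1, w x ∂lam).toReal with hαdef
  have hα1 : ∀ K, α K ≤ 1 := fun K => by
    refine ENNReal.toReal_le_of_le_ofReal zero_le_one ?_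
    rw [ENNReal.ofReal_one, ← hlam.2.1]
    exact setLIntegral_le_lintegral _ _
  have hαr : ∀ K, K₀ ≤ K → α K = q + r K := by
    intro K hK
    rw [hαdef, hqdef, hrdef]
    simp only
    rw [← ENNReal.toReal_add (hfinlam _) (hfinlam _)]
    congr 1
    rw [← lintegral_inter_add_sdiff w K.1 hsm, inter_eq_right.2 (hsK.trans hK)]
  have hpr : ∀ K, K₀ ≤ K → 1 ≤ p + r K := by
    intro K hK
    rw [hpdef, hrdef]
    simp only
    rw [← ENNReal.toReal_add hfinν (hfinlam _)]
    rw [← ENNReal.ofReal_le_iff_le_toReal (ENNReal.add_ne_top.2 ⟨hfinν, hfinlam _⟩)]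
    have hν0 : ∀ᵐ x ∂ν, x ∈ K₀.1 := ((mem_radonOn_iff K₀.2.1.isClosed).1 hν.1.1).2
    calc ENNReal.ofReal 1 = ∫⁻ x in K₀.1, w x ∂ν := by
          rw [ENNReal.ofReal_one, Measure.restrict_eq_self_of_ae_mem hν0, hν.2.1]
      _ = ∫⁻ x in s, w x ∂ν + ∫⁻ x in K₀.1 \ s, w x ∂ν := by
          rw [← lintegral_inter_add_sdiff w K₀.1 hsm, inter_eq_right.2 hsK]
      _ ≤ ∫⁻ x in s, w x ∂ν + ∫⁻ x in K.1 \ s, w x ∂lam := by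
          refine add_le_add le_rfl ?_
          exact (lintegral_mono' hs le_rfl).trans
            (lintegral_mono_set (sdiff_subset_sdiff_left hK))
  have hαlim : Tendsto α atTop (𝓝 1) := by
    have hexh := tendsto_setLIntegral_compactIn hE ((mem_radonOn_iff hE).1 hlam.1.1).2
      (measurable_indicator_weight P.isOpen P.weight_cont).ennreal_ofReal
      (by rw [lintegral_indicator_weight hE hEU hlam.1.1, hlam.2.1]; simp)
      (fun x hx => by
        rw [indicator_of_mem (hEU hx)]
        simpa using P.weight_pos x (hEU hx)) w
    rw [hlam.2.1] at hexh
    rw [← ENNReal.toReal_one]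
    exact (ENNReal.tendsto_toReal ENNReal.one_ne_top).comp hexh
  -- The gain in g-mass from `A` to `B` does not depend on `K ≥ K₀`. The weight `t K` solves α + t d
  -- = 1, so it lies in [0, 1] and tends to 0. If `d = 0`, then `α K = 1` and division by zero
  -- yields the correct weight 0.
  set d := p - q with hd
  set t : CompactIn E → ℝ := fun K => (1 - α K) / d with htdef
  have htlim : Tendsto t atTop (𝓝 0) := by
    simpa using (hαlim.const_sub 1).div_const d
  have hd0 : ∀ K, K₀ ≤ K → 1 - α K ≤ d := fun K hK => by
    rw [hd]; linarith [hαr K hK, hpr K hK]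
  have ht0 : ∀ K, K₀ ≤ K → 0 ≤ t K := fun K hK =>
    div_nonneg (by linarith [hα1 K]) (by linarith [hα1 K, hd0 K hK])
  have ht1 : ∀ K, K₀ ≤ K → t K ≤ 1 := fun K hK =>
    div_le_one_of_le₀ (hd0 K hK) (by linarith [hα1 K, hd0 K hK])
  have htd : ∀ K, K₀ ≤ K → t K * d = 1 - α K := fun K hK => by
    rw [htdef]
    simp only
    rcases eq_or_ne d 0 with h0 | h0
    · rw [h0, mul_zero]
      linarith [hα1 K, hd0 K hK]
    · rw [div_mul_cancel₀ _ h0]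
  have hηW : ν + lam ∈ finiteWeighted κ h₁ := by
    simpa using P.kernel.combo_mem P.posDef hνW hlamW 1 1
  -- A bound for the weighted energy of `B` independent of `K`, since `B ≤ ν + lam`.
  set C := (posEnergy k (ν + lam) (ν + lam)).toReal + 2 * (∫⁻ x, h₁ x ∂(ν + lam)).toReal with hC
  refine ⟨fun K => (1 - t K) * a K + t K * C, ?_, ?_⟩
  · simpa using ((htlim.const_sub 1).mul ha).add (htlim.mul_const C)
  filter_upwards [eventually_ge_atTop K₀] with K hK
  have hK' : K₀.1 ⊆ K.1 := hK
  have hνs : ν s ≠ ⊤ := ne_top_of_le_ne_top K₀.2.1.measure_ne_top (measure_mono hsK)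
  have hlamK : lam K.1 ≠ ⊤ := K.2.1.measure_ne_top
  have hlamKs : lam (K.1 \ s) ≠ ⊤ := ne_top_of_le_ne_top hlamK (measure_mono sdiff_subset)
  set A := lam.restrict K.1 with hA
  set B := ν.restrict s + lam.restrict (K.1 \ s) with hB
  have hAE : A ∈ finiteEnergyOn κ K.1 :=
    P.kernel.restrict_mem hlam.1 hlamK K.2.1.isClosed subset_rfl
  have hBE : B ∈ finiteEnergyOn κ K.1 := P.kernel.add_mem P.posDef
    (P.kernel.restrict_mem hν.1 hνs K.2.1.isClosed (hsK.trans hK'))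
    (P.kernel.restrict_mem hlam.1 hlamKs K.2.1.isClosed sdiff_subset)
  have hAW : A ∈ finiteWeighted κ h₁ := P.kernel.restrict_mem_finiteWeighted hlamW hlamK
  have hBη : B ≤ ν + lam := add_le_add Measure.restrict_le_self Measure.restrict_le_self
  have hBW : B ∈ finiteWeighted κ h₁ := ⟨mem_finiteEnergyOn_univ hBE,
    ne_top_of_le_ne_top hηW.2 (lintegral_mono' hBη le_rfl)⟩
  have hAσ : A ≤ σ.restrict K.1 := Measure.restrict_mono subset_rfl hlam.2.2
  have hBσ : B ≤ σ.restrict K.1 := by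
    calc B ≤ σ.restrict s + σ.restrict (K.1 \ s) :=
          add_le_add (Measure.restrict_mono subset_rfl hνσ)
            (Measure.restrict_mono subset_rfl hlam.2.2)
      _ = σ.restrict K.1 := by
          rw [← Measure.restrict_inter_add_sdiff K.1 hsm, inter_eq_right.2 (hsK.trans hK')]
  have hBG : realWeightedEnergy κ h₁ h₂ B ≤ C := by
    refine (P.kernel.realWeightedEnergy_le_of_le P.posDef hBW hηW hBη).trans ?_
    have h1 : 0 ≤ ((c : ℝ≥0∞) * B univ * B univ).toReal := ENNReal.toReal_nonneg
    have h2 : 0 ≤ (∫⁻ x, h₂ x ∂B).toReal := ENNReal.toReal_nonneg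
    rw [hC]
    linarith
  set T := (t K).toNNReal with hT
  have hTc : (T : ℝ) = t K := Real.coe_toNNReal _ (ht0 K hK)
  set V := (1 - t K).toNNReal with hV
  have hVc : (V : ℝ) = 1 - t K := Real.coe_toNNReal _ (by linarith [ht1 K hK])
  have hVT : V + T = 1 := by
    rw [← NNReal.coe_inj, NNReal.coe_add, hVc, hTc]
    simp
  have hmass : ∫⁻ x, w x ∂(V • A + T • B) = 1 := by
    have hBfin : ∫⁻ x, w x ∂B ≠ ⊤ := by
      rw [hB, lintegral_add_measure]
      exact ENNReal.add_ne_top.2 ⟨hfinν, hfinlam _⟩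
    have hBreal : (∫⁻ x, w x ∂B).toReal = p + r K := by
      rw [hB, lintegral_add_measure, ENNReal.toReal_add hfinν (hfinlam _)]
    have hne : (V : ℝ≥0∞) * ∫⁻ x, w x ∂A + T * ∫⁻ x, w x ∂B ≠ ⊤ :=
      ENNReal.add_ne_top.2 ⟨ENNReal.mul_ne_top (by simp) (hfinlam _),
        ENNReal.mul_ne_top (by simp) hBfin⟩
    rw [lintegral_combo, ← ENNReal.toReal_eq_toReal_iff' hne ENNReal.one_ne_top,
      ENNReal.toReal_add (ENNReal.mul_ne_top (by simp) (hfinlam _))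
        (ENNReal.mul_ne_top (by simp) hBfin), ENNReal.toReal_mul, ENNReal.toReal_mul, hBreal,
      ENNReal.coe_toReal, ENNReal.coe_toReal, ENNReal.toReal_one, hVc, hTc]
    change (1 - t K) * α K + t K * (p + r K) = 1
    have h1 := htd K hK
    have h2 := hαr K hK
    rw [hd] at h1
    have h3 : p + r K = α K + (p - q) := by rw [h2]; ring
    rw [h3]
    linear_combination h1
  have hadm : V • A + T • B ∈ admissible κ g K.1 (σ.restrict K.1) := by
    refine ⟨P.kernel.add_mem P.posDef (P.kernel.smul_mem hAE V) (P.kernel.smul_mem hBE T), hmass, ?_⟩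
    have hVT' : (V : ℝ≥0∞) + T = 1 := by exact_mod_cast hVT
    refine Measure.le_iff'.2 fun Z => ?_
    calc (V • A + T • B) Z = V * A Z + T * B Z := rfl
      _ ≤ V * σ.restrict K.1 Z + T * σ.restrict K.1 Z :=
          add_le_add (mul_le_mul' le_rfl (hAσ Z)) (mul_le_mul' le_rfl (hBσ Z))
      _ = σ.restrict K.1 Z := by rw [← add_mul, hVT', one_mul]
  have hle : minEnergy κ f g K.1 (σ.restrict K.1) ≤ weightedEnergy κ f (V • A + T • B) :=
    iInf₂_le _ hadm
  refine hle.trans ?_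
  rw [P.field.weightedEnergy_eq P.kernel P.posDef (P.kernel.combo_mem P.posDef hAW hBW V T),
    EReal.coe_le_coe_iff, P.field.realWeightedEnergy_combo P.kernel P.posDef hAW hBW hVT, hVc, hTc]
  -- By convexity, the term -t(1 - t)‖A - B‖² may be discarded from the upper bound.
  have h1 : 0 ≤ (1 - t K) * t K * strongDist κ A B ^ 2 :=
    mul_nonneg (mul_nonneg (by linarith [ht1 K hK]) (ht0 K hK)) (sq_nonneg _)
  have h2 := mul_le_mul_of_nonneg_left (hale K) (by linarith [ht1 K hK] : 0 ≤ 1 - t K)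
  have h3 := mul_le_mul_of_nonneg_left hBG (ht0 K hK)
  linarith

/-- Convergence along the compact subsets of `E`, with slightly enlarged constraints. -/
theorem tendsto_of_compactIn (P : EnergyProblem κ k c f h₁ h₂ g U) (hE : IsClosed E)
    (hEU : E ⊆ U) (hcap : capacity κ E < ⊤) (hσ : σ.Regular) (hfin : minEnergy κ f g E σ < ⊤)
    {K₀ : CompactIn E} (hK₀ : minEnergy κ f g K₀.1 (σ.restrict K₀.1) < ⊤)
    {βs : CompactIn E → ℝ} (hβs1 : ∀ K, 1 ≤ βs K) (hβsanti : Antitone βs)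
    (hβslim : Tendsto βs atTop (𝓝 1)) {β : CompactIn E → ℝ} (hβ : ∀ K, 1 ≤ β K ∧ β K ≤ βs K) :
    Tendsto (fun K : CompactIn E =>
        minEnergy κ f g K.1 (ENNReal.ofReal (β K) • σ.restrict K.1)) atTop
        (𝓝 (minEnergy κ f g E σ)) ∧
      (∀ᶠ K : CompactIn E in atTop, ∃! lam : Measure X,
        IsEquilibrium κ f g K.1 (ENNReal.ofReal (β K) • σ.restrict K.1) lam) ∧
      ∀ (lam : Measure X) (lams : CompactIn E → Measure X), IsEquilibrium κ f g E σ lam →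
        (∀ᶠ K : CompactIn E in atTop,
          IsEquilibrium κ f g K.1 (ENNReal.ofReal (β K) • σ.restrict K.1) (lams K)) →
        StrongTendsto κ lams atTop lam ∧ VagueTendsto lams atTop lam := by
  obtain ⟨m, hm⟩ := P.exists_minEnergy_eq_coe hE hEU hfin
  obtain ⟨a, halim, ha⟩ := P.exists_tendsto_minEnergy_restrict_le hE hEU hcap hσ hm hK₀
  have hle_smul : ∀ (b : ℝ) (τ : Measure X), 1 ≤ b → τ ≤ ENNReal.ofReal b • τ := by
    intro b τ hb
    refine Measure.le_iff'.2 fun Z => ?_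
    rw [Measure.smul_apply, smul_eq_mul]
    exact le_mul_of_one_le_left zero_le (by simpa using hb)
  have hsmul_mono : ∀ (b b' : ℝ) (τ τ' : Measure X), b ≤ b' → τ ≤ τ' →
      ENNReal.ofReal b • τ ≤ ENNReal.ofReal b' • τ' := by
    intro b b' τ τ' hb hτ
    refine Measure.le_iff'.2 fun Z => ?_
    rw [Measure.smul_apply, Measure.smul_apply, smul_eq_mul, smul_eq_mul]
    exact mul_le_mul' (ENNReal.ofReal_le_ofReal hb) (hτ Z)
  have hle1 : ∀ K, minEnergy κ f g K.1 (ENNReal.ofReal (β K) • σ.restrict K.1) ≤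
      minEnergy κ f g K.1 (σ.restrict K.1) := fun K =>
    minEnergy_anti subset_rfl (hle_smul _ _ (hβ K).1)
  have hσ' : ∀ K, ENNReal.ofReal (β K) • σ.restrict K.1 ≤ ENNReal.ofReal (βs K) • σ := fun K =>
    hsmul_mono _ _ _ _ (hβ K).2 Measure.restrict_le_self
  -- Part (b) with the constant set `E` and the constraints `βs K • σ`, which decrease vaguely to
  -- `σ`. Their classes contain the problem on `K`, so their minima bound it from below.
  obtain ⟨hblim, -, -⟩ := P.tendsto_of_antitone (Es := fun _ : CompactIn E => E)
    (σs := fun K => ENNReal.ofReal (βs K) • σ) hσ hfin (fun _ => hE) (fun _ => hEU)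
    antitone_const (fun _ => hcap) (iInter_const E) (fun K => Measure.Regular.smul (by simp))
    (fun K L hKL => hsmul_mono _ _ _ _ (hβsanti hKL) le_rfl) (fun φ _ _ => by
      have h1 : ∀ K, ∫ x, φ x ∂(ENNReal.ofReal (βs K) • σ) = βs K * ∫ x, φ x ∂σ := fun K => by
        rw [integral_smul_measure, ENNReal.toReal_ofReal (zero_le_one.trans (hβs1 K)), smul_eq_mul]
      simp_rw [h1]
      simpa using hβslim.mul_const (∫ x, φ x ∂σ))
  have hbound : ∀ K, minEnergy κ f g E (ENNReal.ofReal (βs K) • σ) ≤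
      minEnergy κ f g K.1 (ENNReal.ofReal (β K) • σ.restrict K.1) := fun K =>
    minEnergy_anti K.2.2 (hσ' K)
  have hlim : Tendsto (fun K : CompactIn E =>
      minEnergy κ f g K.1 (ENNReal.ofReal (β K) • σ.restrict K.1)) atTop
      (𝓝 (minEnergy κ f g E σ)) := by
    refine tendsto_of_tendsto_of_tendsto_of_le_of_le' hblim
      (h := fun K => (a K : EReal)) ?_ (Eventually.of_forall hbound)
      (ha.mono fun K hK => (hle1 K).trans hK)
    rw [hm]
    exact (continuous_coe_real_ereal.tendsto m).comp halim
  refine ⟨hlim, ?_, fun lam lams hlam hlams => ?_⟩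
  · filter_upwards [ha] with K hK
    have := Measure.Regular.restrict_of_measure_ne_top (μ := σ) K.2.1.measure_ne_top
    exact P.existsUnique_isEquilibrium K.2.1.isClosed (K.2.2.trans hEU)
      ((capacity_mono K.2.2).trans_lt hcap) (Measure.Regular.smul (by simp))
      (((hle1 K).trans hK).trans_lt (EReal.coe_lt_top _))
  · obtain ⟨h1, h2, h3⟩ := (P.isEquilibrium_iff hm).1 hlam
    have hn : ∀ K, ∃ x : ℝ, minEnergy κ f g E (ENNReal.ofReal (βs K) • σ) = x := fun K =>
      P.exists_minEnergy_eq_coe hE hEU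
        ((minEnergy_anti subset_rfl (hle_smul _ _ (hβs1 K))).trans_lt hfin)
    choose n hn using hn
    have hnlim : Tendsto n atTop (𝓝 m) := by
      rw [hm] at hblim
      simp_rw [hn] at hblim
      exact EReal.tendsto_coe.1 hblim
    -- Both `lams K` and `lam` belong to the class of `E` with constraint `βs K • σ`. The basic
    -- inequality is applied there, with the minimum `n K` tending to `m`.
    have hev : ∀ᶠ K in atTop, lams K ∈ finiteWeighted κ h₁ ∧
        strongDist κ (lams K) lam ^ 2 ≤ 2 * a K + 2 * m - 4 * n K := by
      filter_upwards [ha, hlams] with K hK hlamK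
      obtain ⟨x, hx⟩ := P.exists_minEnergy_eq_coe K.2.1.isClosed (K.2.2.trans hEU)
        (((hle1 K).trans hK).trans_lt (EReal.coe_lt_top _))
      obtain ⟨k1, k2, k3⟩ := (P.isEquilibrium_iff hx).1 hlamK
      have hxa : x ≤ a K := by
        have := (hle1 K).trans hK
        rw [hx] at this
        exact_mod_cast this
      have h4 := P.strongDist_sq_le (hn K) (admissible_subset K.2.2 (hσ' K) k1) k2
        (admissible_subset subset_rfl (hle_smul _ _ (hβs1 K)) h1) h2
      refine ⟨k2, ?_⟩
      rw [k3, h3] at h4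
      linarith
    have hst : StrongTendsto κ lams atTop lam := by
      refine strongTendsto_of_sq_le (hev.mono fun K hK => hK.2) ?_
      have := (((halim.const_mul 2).add_const (2 * m)).sub (hnlim.const_mul 4))
      convert! this using 2
      ring
    exact ⟨hst, P.perfect.vagueTendsto (hev.mono fun K hK => hK.1.1) h2.1 hst⟩

end EnergyProblem

end Increasing

end ConstrainedEnergy

/-! ### Assembly of the three assertions. -/

theorem theorem1 {X : Type*} [TopologicalSpace X] [T2Space X] [LocallyCompactSpace X]
    [MeasurableSpace X] [BorelSpace X]
    (κ : X × X → EReal) (f : X → EReal) (g : X → ℝ) (U E : Set X) (σ : Measure X)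
    (hκ : ConstrainedEnergy.IsPhi κ)
    (hκ_pos : ConstrainedEnergy.IsPositiveDefinite κ)
    (hκ_perfect : ConstrainedEnergy.IsPerfect κ)
    (hf : ConstrainedEnergy.IsExternalField κ f)
    (hE : IsClosed E) (hE_ne : E.Nonempty)
    (hU : IsOpen U) (hEU : E ⊆ U)
    (hg_pos : ∀ x ∈ U, 0 < g x) (hg_cont : ContinuousOn g U)
    (hXg : SigmaCompactSpace X ∨ ∃ c : ℝ, 0 < c ∧ ∀ x ∈ U, c ≤ g x)
    (hσ : σ ∈ ConstrainedEnergy.radonOn E)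
    (hfin : ConstrainedEnergy.minEnergy κ f g E σ < ⊤)
    (hcap : ConstrainedEnergy.capacity κ E < ⊤)
    (hg : (∃ M : ℝ, ∀ x ∈ U, g x ≤ M) ∨
      ∃ (r : ℝ) (ω : ConstrainedEnergy.SignedRadon X), 1 < r ∧ ω.FiniteEnergy κ ∧
        ConstrainedEnergy.NearlyEverywhereOn κ U
          (fun x => ((g x ^ r : ℝ) : EReal) ≤ ω.potential κ x)) :
    -- (a) existence and uniqueness
    (∃! lam : Measure X, ConstrainedEnergy.IsEquilibrium κ f g E σ lam) ∧
    -- (b) decreasing sets and constraints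
    (∀ (S : Type*) [Preorder S] [IsDirectedOrder S] [Nonempty S]
      (Es : S → Set X) (σs : S → Measure X),
      (∀ s, IsClosed (Es s)) → (∀ s, Es s ⊆ U) → Antitone Es →
      (∀ s, ConstrainedEnergy.capacity κ (Es s) < ⊤) → (⋂ s, Es s) = E →
      (∀ s, σs s ∈ ConstrainedEnergy.radonOn (Es s)) → Antitone σs →
      ConstrainedEnergy.VagueTendsto σs atTop σ →
      Tendsto (fun s => ConstrainedEnergy.minEnergy κ f g (Es s) (σs s)) atTop
        (𝓝 (ConstrainedEnergy.minEnergy κ f g E σ)) ∧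
      (∀ s, ∃! lam : Measure X, ConstrainedEnergy.IsEquilibrium κ f g (Es s) (σs s) lam) ∧
      ∀ (lam : Measure X) (lams : S → Measure X),
        ConstrainedEnergy.IsEquilibrium κ f g E σ lam →
        (∀ s, ConstrainedEnergy.IsEquilibrium κ f g (Es s) (σs s) (lams s)) →
        ConstrainedEnergy.StrongTendsto κ lams atTop lam ∧
        ConstrainedEnergy.VagueTendsto lams atTop lam) ∧
    -- (c) increasing compact sets; the problem is feasible on at least one compact set
    ((∃ K : ConstrainedEnergy.CompactIn E,
        ConstrainedEnergy.minEnergy κ f g K.1 (σ.restrict K.1) < ⊤) →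
      ∃ βs : ConstrainedEnergy.CompactIn E → ℝ,
        (∀ K, 1 ≤ βs K) ∧ Antitone βs ∧ Tendsto βs atTop (𝓝 1) ∧
        -- the net lies in `(1, ∞)` whenever some net in `(1, ∞)` decreases to `1`
        ((∃ k : ℕ → ConstrainedEnergy.CompactIn E, ∀ K : ConstrainedEnergy.CompactIn E,
          ∃ n, ¬ k n ≤ K) → ∀ K, 1 < βs K) ∧
        ∀ β : ConstrainedEnergy.CompactIn E → ℝ, (∀ K, 1 ≤ β K ∧ β K ≤ βs K) →
          Tendsto (fun K : ConstrainedEnergy.CompactIn E =>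
            ConstrainedEnergy.minEnergy κ f g K.1 (ENNReal.ofReal (β K) • σ.restrict K.1)) atTop
            (𝓝 (ConstrainedEnergy.minEnergy κ f g E σ)) ∧
          (∀ᶠ K : ConstrainedEnergy.CompactIn E in atTop, ∃! lam : Measure X,
            ConstrainedEnergy.IsEquilibrium κ f g K.1
              (ENNReal.ofReal (β K) • σ.restrict K.1) lam) ∧
          ∀ (lam : Measure X) (lams : ConstrainedEnergy.CompactIn E → Measure X),
            ConstrainedEnergy.IsEquilibrium κ f g E σ lam →
            (∀ᶠ K : ConstrainedEnergy.CompactIn E in atTop,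
              ConstrainedEnergy.IsEquilibrium κ f g K.1
                (ENNReal.ofReal (β K) • σ.restrict K.1) (lams K)) →
            ConstrainedEnergy.StrongTendsto κ lams atTop lam ∧
            ConstrainedEnergy.VagueTendsto lams atTop lam) := by
  obtain ⟨k, c, hk⟩ := ConstrainedEnergy.exists_kernelDecomp hκ hκ_pos.1
  obtain ⟨h₁, h₂, hF⟩ := hf.exists_fieldDecomp hk hκ_pos hκ_perfect hg_pos hg_cont
  have P : ConstrainedEnergy.EnergyProblem κ k c f h₁ h₂ g U :=
    ⟨hk, hκ_pos, hκ_perfect, hF, hU, hg_pos, hg_cont, hg⟩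
  refine ⟨P.existsUnique_isEquilibrium hE hEU hcap hσ.1 hfin, ?_, ?_⟩
  · intro S _ _ _ Es σs hEs hEsU hEanti hEcap hinter hσs hσanti hvague
    exact P.tendsto_of_antitone hσ.1 hfin hEs hEsU hEanti hEcap hinter (fun s => (hσs s).1)
      hσanti hvague
  · rintro ⟨K₀, hK₀⟩
    obtain ⟨βs, hβs1, hβsanti, hβslim, hβs⟩ := ConstrainedEnergy.exists_antitone_tendsto_one E
    exact ⟨βs, hβs1, hβsanti, hβslim, hβs, fun β hβ =>
      P.tendsto_of_compactIn hE hEU hcap hσ.1 hfin hK₀ hβs1 hβsanti hβslim hβ⟩
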